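/- Let $d\ge 1$ be an integer, $0<a\le b<+\infty$ and $p\in(1,+\infty)$. Let $E$ be the set of nearest-neighbour edges of $\mathbb{Z}^d$, let $\nu=\frac12\delta_a+\frac12\delta_b$, and let $r=(r_e)_{e\in E}$ have law $\mu=\nu^{\otimes E}$. A unit flow from $x$ to $y$ ($x\ne y$) is an antisymmetric function $\theta$ on oriented edges with $\sum_{w\sim z}\theta(\overrightarrow{zw})=0$ for every $z\notin\{x,y\}$, $\sum_{w\sim x}\theta(\overrightarrow{xw})=1$ and $\sum_{w\sim y}\theta(\overrightarrow{wy})=1$. The $p$-resistance is $$\mathcal{R}^p_r(x\leftrightarrow y)=\inf_{\theta}\ \sum_{e\in E} r_e|\theta(e)|^p,$$ the infimum being over all unit flows $\theta$ from $x$ to $y$. Let $|v|$ be the $\ell^1$-norm of $v\in\mathbb{Z}^d$ and, with the convention $d/(d-1)=+\infty$ when $d=1$, put $$a_d(n,p)=\begin{cases} n^{1-(d-1)(p-1)} & \text{if } p<\frac{d}{d-1},\\ \log n & \text{if } p=\frac{d}{d-1},\\ 1 & \text{if } p>\frac{d}{d-1}.\end{cases}$$ Then $\mathcal{R}^p_r(0\leftrightarrow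 v)$ is square-integrable for every $v\neq 0$ and, as $v$ goes to infinity in $\mathbb{Z}^d$ (with $a,b,d,p$ fixed), $$\mathbb{E}\big(\mathcal{R}^p_r(0\leftrightarrow v)\big)=\Theta\big(a_d(|v|,p)\big).$$ Moreover, if $d\ge 2$ and $p\le\frac{d}{d-1}$, then $$\mathrm{Var}_\mu\big(\mathcal{R}^p_r(0\leftrightarrow v)\big)=O\left(\frac{a_d(|v|,p)}{\log a_d(|v|,p)}\right),$$ and if $d\ge 2$ and $p>\frac{d}{d-1}$, then $\mathrm{Var}_\mu\big(\mathcal{R}^p_r(0\leftrightarrow v)\big)=O(1)$. -/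

import Mathlib

open MeasureTheory ProbabilityTheory Filter Asymptotics
open scoped ENNReal

namespace PResistance

/-- Vertices of the lattice `ℤ^d`. -/
abbrev Vertex (d : ℕ) : Type := Fin d → ℤ

/-- The (unoriented) nearest-neighbour edges of `ℤ^d`: the pair `(x, i)` stands for the edge joining
`x` and `x + e_i`. Every edge is represented exactly once. -/
abbrev Edge (d : ℕ) : Type := Vertex d × Fin d

/-- The `i`-th vector of the canonical basis. -/
def basisVec {d : ℕ} (i : Fin d) : Vertex d := Pi.single i 1

/-- An antisymmetric function on oriented edges is determined by its values on the edges oriented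
from `x` to `x + e_i`, so it is represented by `θ : Edge d → ℝ`; its value from `x` to `x + e_i` is
`θ (x, i)`, and its value from `x` to `x - e_i` is `-θ (x - e_i, i)`. This is the sum of the values
over all `2d` oriented edges leaving `x`. -/
def outflow {d : ℕ} (θ : Edge d → ℝ) (x : Vertex d) : ℝ :=
  ∑ i : Fin d, (θ (x, i) + -θ (x - basisVec i, i))

/-- `θ` is a flow of strength `1` from `x` to `y`: the node law holds off `{x, y}`, the flow out of
the source `x` is `1` and the flow into the sink `y` is `1`. -/
structure IsUnitFlow {d : ℕ} (x y : Vertex d) (θ : Edge d → ℝ) : Prop where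
  node_law : ∀ z, z ≠ x → z ≠ y → outflow θ z = 0
  source : outflow θ x = 1
  sink : -outflow θ y = 1

/-- The `p`-energy `∑ₑ rₑ |θ(e)|^p`, possibly infinite. -/
noncomputable def energy {d : ℕ} (p : ℝ) (r θ : Edge d → ℝ) : ℝ≥0∞ :=
  ∑' e : Edge d, ENNReal.ofReal (r e * |θ e| ^ p)

/-- The `p`-resistance between `x` and `y`: the infimum of the `p`-energy over all unit flows from
`x` to `y` (flows of infinite energy are allowed and do not affect the infimum). -/
noncomputable def resistance {d : ℕ} (p : ℝ) (r : Edge d → ℝ) (x y : Vertex d) : ℝ :=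
  (⨅ θ : {θ : Edge d → ℝ // IsUnitFlow x y θ}, energy p r θ.1).toReal

/-- The symmetric Bernoulli law `½ δ_a + ½ δ_b`. -/
noncomputable def bernoulliLaw (a b : ℝ) : Measure ℝ :=
  (2⁻¹ : ℝ≥0∞) • Measure.dirac a + (2⁻¹ : ℝ≥0∞) • Measure.dirac b

instance (a b : ℝ) : IsProbabilityMeasure (bernoulliLaw a b) :=
  ⟨by simp [bernoulliLaw, ENNReal.inv_two_add_inv_two]⟩

/-- The law of i.i.d. resistances on the edges of `ℤ^d` with common law `½ δ_a + ½ δ_b`. -/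
noncomputable def resistanceLaw (d : ℕ) (a b : ℝ) : Measure (Edge d → ℝ) :=
  Measure.infinitePi fun _ : Edge d => bernoulliLaw a b

/-- The `ℓ¹`-norm on `ℤ^d`. -/
def l1norm {d : ℕ} (v : Vertex d) : ℕ := ∑ i : Fin d, (v i).natAbs

/-- The order `a_d(n, p)`. The comparison of `p` with `d / (d - 1)` is written without division, so
that for `d = 1` (where `d / (d - 1) = +∞`) the first case applies. -/
noncomputable def rate (d n : ℕ) (p : ℝ) : ℝ :=
  open Classical in
  if ((d : ℝ) - 1) * p < d then (n : ℝ) ^ (1 - ((d : ℝ) - 1) * (p - 1))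
  else if ((d : ℝ) - 1) * p = d then Real.log n
  else 1

end PResistance

/-!
A unit flow from `0` to `v` crosses the boundary of every box that separates `0` from `v`, and such
a boundary has at most `C N^(d-1)` edges, so Jensen's inequality bounds the energy below by
`∑ N^(-(d-1)(p-1))`; spreading the mass evenly over growing boxes attains this order.

For the variance, `r` is encoded by fair coins. A flow of minimal energy is bounded by `1` and, if
`(d-1) p ≤ d`, dissipates energy at most of order `m` in a ball of radius `m`; the change of the
resistance when one coin is flipped is at most `(b - a) |θ e|^p`, so the influences add up to the
order of the resistance. The average of the resistance over the translations in a cube of side `m`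
differs from it by `O(m)` and all of its influences are small, so Talagrand's inequality, a
consequence of hypercontractivity, gains a logarithm for `m` a small power of the resistance.
-/

namespace PResistance

section Integrals

variable {Ω : Type*} [MeasurableSpace Ω] {μ : Measure Ω}

lemma abs_integral_mul_le_Lp_mul_Lq {p q : ℝ} (hpq : p.HolderConjugate q) {f g : Ω → ℝ}
    (hf : MemLp f (ENNReal.ofReal p) μ) (hg : MemLp g (ENNReal.ofReal q) μ) :
    |∫ ω, f ω * g ω ∂μ| ≤ (∫ ω, |f ω| ^ p ∂μ) ^ (1 / p) * (∫ ω, |g ω| ^ q ∂μ) ^ (1 / q) :=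
  calc |∫ ω, f ω * g ω ∂μ| ≤ ∫ ω, |f ω| * |g ω| ∂μ := by
        simpa only [abs_mul] using abs_integral_le_integral_abs (f := fun ω => f ω * g ω)
    _ ≤ _ := integral_mul_le_Lp_mul_Lq_of_nonneg hpq (.of_forall fun _ => abs_nonneg _)
        (.of_forall fun _ => abs_nonneg _) hf.abs hg.abs

lemma sq_integral_mul_le {f g : Ω → ℝ} (hf : MemLp f 2 μ) (hg : MemLp g 2 μ) :
    (∫ ω, f ω * g ω ∂μ) ^ 2 ≤ (∫ ω, f ω ^ 2 ∂μ) * ∫ ω, g ω ^ 2 ∂μ := by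
  have h := abs_integral_mul_le_Lp_mul_Lq (μ := μ) .two_two (by simpa using hf) (by simpa using hg)
  simp only [Real.rpow_two, sq_abs, ← Real.sqrt_eq_rpow] at h
  calc (∫ ω, f ω * g ω ∂μ) ^ 2 = |∫ ω, f ω * g ω ∂μ| ^ 2 := (sq_abs _).symm
    _ ≤ (√(∫ ω, f ω ^ 2 ∂μ) * √(∫ ω, g ω ^ 2 ∂μ)) ^ 2 := by gcongr
    _ = (∫ ω, f ω ^ 2 ∂μ) * ∫ ω, g ω ^ 2 ∂μ := by
        rw [mul_pow, Real.sq_sqrt (integral_nonneg fun _ => sq_nonneg _),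
          Real.sq_sqrt (integral_nonneg fun _ => sq_nonneg _)]

lemma integral_mul_pow_four_le [IsFiniteMeasure μ] {g u : Ω → ℝ}
    (hg : AEStronglyMeasurable g μ) (hg1 : ∀ ω, |g ω| ≤ 1) (hu : MemLp u 4 μ) :
    (∫ ω, g ω * u ω ∂μ) ^ 4 ≤ (∫ ω, |g ω| ∂μ) ^ 3 * ∫ ω, u ω ^ 4 ∂μ := by
  have hgLp (q : ℝ≥0∞) : MemLp g q μ := MemLp.of_bound hg 1 (.of_forall hg1)
  have hconj : (4 / 3 : ℝ).HolderConjugate 4 := by rw [Real.holderConjugate_iff]; norm_num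
  have hhoelder := abs_integral_mul_le_Lp_mul_Lq hconj (hgLp _) (by simpa using hu)
  have hpow : ∫ ω, |g ω| ^ (4 / 3 : ℝ) ∂μ ≤ ∫ ω, |g ω| ∂μ :=
    integral_mono_of_nonneg (.of_forall fun _ => by positivity)
      ((hgLp 1).integrable le_rfl).abs (.of_forall fun ω =>
        Real.rpow_le_self_of_le_one (abs_nonneg _) (hg1 ω) (by norm_num))
  have habs : ∀ x : ℝ, |x| ^ (4 : ℝ) = x ^ 4 := fun x => by
    rw [Real.rpow_ofNat, Even.pow_abs (by decide)]
  have h0 : 0 ≤ ∫ ω, |g ω| ^ (4 / 3 : ℝ) ∂μ := integral_nonneg fun _ => by positivity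
  have h1 : 0 ≤ ∫ ω, u ω ^ 4 ∂μ := integral_nonneg fun _ => by positivity
  simp only [habs] at hhoelder
  calc (∫ ω, g ω * u ω ∂μ) ^ 4 = |∫ ω, g ω * u ω ∂μ| ^ 4 := (Even.pow_abs (by decide) _).symm
    _ ≤ ((∫ ω, |g ω| ^ (4 / 3 : ℝ) ∂μ) ^ (1 / (4 / 3) : ℝ)
          * (∫ ω, u ω ^ 4 ∂μ) ^ (1 / 4 : ℝ)) ^ 4 := by gcongr
    _ = (∫ ω, |g ω| ^ (4 / 3 : ℝ) ∂μ) ^ 3 * ∫ ω, u ω ^ 4 ∂μ := by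
        rw [mul_pow, ← Real.rpow_mul_natCast h0, ← Real.rpow_mul_natCast h1]
        norm_num
    _ ≤ (∫ ω, |g ω| ∂μ) ^ 3 * ∫ ω, u ω ^ 4 ∂μ := by gcongr

lemma integrable_of_continuous [TopologicalSpace Ω] [CompactSpace Ω] [OpensMeasurableSpace Ω]
    [IsFiniteMeasure μ] {f : Ω → ℝ} (hf : Continuous f) : Integrable f μ :=
  hf.integrable_of_hasCompactSupport (.of_compactSpace f)

lemma memLp_of_continuous [TopologicalSpace Ω] [CompactSpace Ω] [OpensMeasurableSpace Ω]
    [IsFiniteMeasure μ] {f : Ω → ℝ} (hf : Continuous f) (q : ℝ≥0∞) : MemLp f q μ :=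
  hf.memLp_of_hasCompactSupport (.of_compactSpace f)

end Integrals

section Walsh

variable {ι : Type*}

/-- The sign attached to a bit: the characters of the cube `ι → Bool` are products of these. -/
def bitSign (b : Bool) : ℝ := if b then -1 else 1

lemma bitSign_mul_self (b : Bool) : bitSign b * bitSign b = 1 := by cases b <;> simp [bitSign]

lemma bitSign_not (b : Bool) : bitSign (!b) = -bitSign b := by cases b <;> simp [bitSign]

@[fun_prop]
lemma continuous_bitSign : Continuous bitSign := continuous_of_discreteTopology

/-- The Walsh character of the cube `ι → Bool` indexed by a finite set of coordinates. -/
def walsh (S : Finset ι) (ω : ι → Bool) : ℝ := ∏ i ∈ S, bitSign (ω i)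

@[fun_prop]
lemma continuous_walsh (S : Finset ι) : Continuous (walsh S) :=
  continuous_finsetProd _ fun _ _ => by fun_prop

lemma walsh_mul_self (S : Finset ι) (ω : ι → Bool) : walsh S ω * walsh S ω = 1 := by
  simp [walsh, ← Finset.prod_mul_distrib, bitSign_mul_self]

/-- The linear combination `∑_{S ∈ A} c S · χ_S` of Walsh characters. -/
def walshSum (A : Finset (Finset ι)) (c : Finset ι → ℝ) (ω : ι → Bool) : ℝ :=
  ∑ S ∈ A, c S * walsh S ω

@[fun_prop]
lemma continuous_walshSum (A : Finset (Finset ι)) (c : Finset ι → ℝ) :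
    Continuous (walshSum A c) :=
  continuous_finsetSum _ fun _ _ => by fun_prop

/-- The coefficient `∫ f χ_S dP` of `f` along the Walsh character of `S`. -/
noncomputable def walshCoeff (P : Measure (ι → Bool)) (f : (ι → Bool) → ℝ) (S : Finset ι) : ℝ :=
  ∫ ω, f ω * walsh S ω ∂P

lemma walshCoeff_empty (P : Measure (ι → Bool)) (f : (ι → Bool) → ℝ) :
    walshCoeff P f ∅ = ∫ ω, f ω ∂P := by simp [walshCoeff, walsh]

lemma integral_mul_walshSum [Countable ι] {P : Measure (ι → Bool)} [IsFiniteMeasure P]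
    {f : (ι → Bool) → ℝ} (hf : Continuous f)
    (A : Finset (Finset ι)) (c : Finset ι → ℝ) :
    ∫ ω, f ω * walshSum A c ω ∂P = ∑ S ∈ A, c S * walshCoeff P f S := by
  simp only [walshSum, Finset.mul_sum]
  rw [integral_finsetSum _ fun S _ => integrable_of_continuous (by fun_prop)]
  refine Finset.sum_congr rfl fun S _ => ?_
  rw [walshCoeff, ← integral_const_mul]
  exact integral_congr_ae (.of_forall fun ω => by ring)

lemma walsh_insert [DecidableEq ι] {S : Finset ι} {i : ι} (h : i ∉ S) (ω : ι → Bool) :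
    walsh (insert i S) ω = bitSign (ω i) * walsh S ω := by
  simp [walsh, Finset.prod_insert h]

lemma exists_bitSign_mul_walsh_eq (S : Finset ι) (i : ι) :
    ∃ T : Finset ι, ∀ ω, bitSign (ω i) * walsh S ω = walsh T ω := by
  classical
  by_cases h : i ∈ S
  · refine ⟨S.erase i, fun ω => ?_⟩
    rw [walsh, ← Finset.mul_prod_erase _ _ h, ← mul_assoc, bitSign_mul_self, one_mul, walsh]
  · exact ⟨insert i S, fun ω => (walsh_insert h ω).symm⟩

/-- The `i`-th coordinate sign as a continuous function on the cube. -/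
def signCoord (i : ι) : C(ι → Bool, ℝ) := ⟨fun ω => bitSign (ω i), by fun_prop⟩

lemma exists_eq_walsh_of_mem_closure {g : C(ι → Bool, ℝ)}
    (hg : g ∈ Submonoid.closure (Set.range signCoord)) :
    ∃ S : Finset ι, (⟨walsh S, continuous_walsh S⟩ : C(ι → Bool, ℝ)) = g := by
  induction hg using Submonoid.closure_induction_left with
  | one => exact ⟨∅, by ext; simp [walsh]⟩
  | mul_left _ hx _ _ hy =>
    obtain ⟨i, rfl⟩ := hx
    obtain ⟨S, rfl⟩ := hy
    obtain ⟨T, hT⟩ := exists_bitSign_mul_walsh_eq S i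
    exact ⟨T, by ext ω; exact (hT ω).symm⟩

lemma exists_walshSum_eq_of_mem_adjoin {g : C(ι → Bool, ℝ)}
    (hg : g ∈ Algebra.adjoin ℝ (Set.range signCoord)) :
    ∃ (A : Finset (Finset ι)) (c : Finset ι → ℝ), ∀ ω, walshSum A c ω = g ω := by
  have hspan : g ∈ Submodule.span ℝ
      (Set.range fun S : Finset ι => (⟨walsh S, continuous_walsh S⟩ : C(ι → Bool, ℝ))) := by
    refine Submodule.span_mono (fun _ => exists_eq_walsh_of_mem_closure) ?_
    rwa [← Algebra.adjoin_eq_span]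
  obtain ⟨c, hc⟩ := Finsupp.mem_span_range_iff_exists_finsupp.1 hspan
  refine ⟨c.support, c, fun ω => ?_⟩
  rw [← hc, Finsupp.sum, ContinuousMap.sum_apply]
  rfl

lemma separatesPoints_adjoin_signCoord :
    (Algebra.adjoin ℝ (Set.range (signCoord (ι := ι)))).SeparatesPoints := by
  intro ω ω' hne
  obtain ⟨i, hi⟩ := Function.ne_iff.mp hne
  refine ⟨_, ⟨signCoord i, Algebra.subset_adjoin ⟨i, rfl⟩, rfl⟩, ?_⟩
  simp only [signCoord, ContinuousMap.coe_mk, bitSign]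
  revert hi
  cases ω i <;> cases ω' i <;> norm_num

lemma exists_walshSum_near {f : (ι → Bool) → ℝ} (hf : Continuous f) {ε : ℝ} (hε : 0 < ε) :
    ∃ (A : Finset (Finset ι)) (c : Finset ι → ℝ), ∀ ω, |walshSum A c ω - f ω| < ε := by
  obtain ⟨⟨g, hg⟩, hgf⟩ := ContinuousMap.exists_mem_subalgebra_near_continuous_of_separatesPoints _
    separatesPoints_adjoin_signCoord f hf ε hε
  obtain ⟨A, c, hc⟩ := exists_walshSum_eq_of_mem_adjoin hg
  exact ⟨A, c, fun ω => by rw [hc]; exact hgf ω⟩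

variable [DecidableEq ι]

/-- The involution of the cube `ι → Bool` that flips the `i`-th coordinate. -/
def flipBit (i : ι) (ω : ι → Bool) : ι → Bool := Function.update ω i (!ω i)

@[simp]
lemma flipBit_same (i : ι) (ω : ι → Bool) : flipBit i ω i = !ω i := by simp [flipBit]

@[simp]
lemma flipBit_of_ne {i j : ι} (h : j ≠ i) (ω : ι → Bool) : flipBit i ω j = ω j := by
  simp [flipBit, h]

@[simp]
lemma flipBit_flipBit (i : ι) (ω : ι → Bool) : flipBit i (flipBit i ω) = ω := by
  simp [flipBit]

@[fun_prop]
lemma continuous_flipBit (i : ι) : Continuous (flipBit i : (ι → Bool) → ι → Bool) :=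
  continuous_id.update i
    ((continuous_of_discreteTopology (f := Bool.not)).comp (continuous_apply i))

lemma walsh_flipBit_of_mem {S : Finset ι} {i : ι} (h : i ∈ S) (ω : ι → Bool) :
    walsh S (flipBit i ω) = -walsh S ω := by
  rw [walsh, walsh, ← Finset.mul_prod_erase _ _ h, ← Finset.mul_prod_erase S _ h, flipBit_same,
    bitSign_not, neg_mul]
  congr 2
  exact Finset.prod_congr rfl fun j hj => by rw [flipBit_of_ne (Finset.ne_of_mem_erase hj)]

lemma walsh_flipBit_of_notMem {S : Finset ι} {i : ι} (h : i ∉ S) (ω : ι → Bool) :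
    walsh S (flipBit i ω) = walsh S ω :=
  Finset.prod_congr rfl fun j hj => by rw [flipBit_of_ne (ne_of_mem_of_not_mem hj h)]

lemma walshSum_powerset_flipBit {A : Finset ι} {i : ι} (h : i ∉ A) (c : Finset ι → ℝ)
    (ω : ι → Bool) : walshSum A.powerset c (flipBit i ω) = walshSum A.powerset c ω :=
  Finset.sum_congr rfl fun S hS => by
    rw [walsh_flipBit_of_notMem fun hi => h (Finset.mem_powerset.1 hS hi)]

lemma walshSum_powerset_insert {A : Finset ι} {i : ι} (h : i ∉ A) (c : Finset ι → ℝ)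
    (ω : ι → Bool) :
    walshSum (insert i A).powerset c ω = walshSum A.powerset c ω
      + bitSign (ω i) * walshSum A.powerset (fun S => c (insert i S)) ω := by
  rw [walshSum, Finset.sum_powerset_insert h, walshSum, walshSum, Finset.mul_sum]
  congr 1
  refine Finset.sum_congr rfl fun S hS => ?_
  rw [walsh_insert fun hi => h (Finset.mem_powerset.1 hS hi)]
  ring

end Walsh

section FlipInvariant

variable {ι : Type*} [DecidableEq ι] {P : Measure (ι → Bool)} {f : (ι → Bool) → ℝ}

/-- A measure on the cube `ι → Bool` that is invariant under flipping any single coordinate: the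
property of the law of fair coins on which Fourier analysis on the cube rests. -/
def IsFlipInvariant (P : Measure (ι → Bool)) : Prop := ∀ i, MeasurePreserving (flipBit i) P P

lemma IsFlipInvariant.integral_comp_flipBit (hP : IsFlipInvariant P) (i : ι)
    (f : (ι → Bool) → ℝ) : ∫ ω, f (flipBit i ω) ∂P = ∫ ω, f ω ∂P :=
  (hP i).integral_comp (MeasurableEquiv.ofInvolutive _ (flipBit_flipBit i)
    (hP i).measurable).measurableEmbedding f

lemma IsFlipInvariant.integral_eq_zero_of_flipBit_eq_neg (hP : IsFlipInvariant P) {i : ι}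
    (h : ∀ ω, f (flipBit i ω) = -f ω) : ∫ ω, f ω ∂P = 0 := by
  have := hP.integral_comp_flipBit i f
  simp only [h, integral_neg] at this
  linarith

lemma integral_walsh_mul_walsh [IsProbabilityMeasure P] (hP : IsFlipInvariant P)
    (S T : Finset ι) : ∫ ω, walsh S ω * walsh T ω ∂P = if S = T then 1 else 0 := by
  split_ifs with h
  · simp [h, walsh_mul_self]
  · obtain ⟨i, hi⟩ : ∃ i, ¬(i ∈ S ↔ i ∈ T) := by simpa [Finset.ext_iff] using h
    refine hP.integral_eq_zero_of_flipBit_eq_neg (i := i) fun ω => ?_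
    by_cases hS : i ∈ S <;> by_cases hT : i ∈ T <;>
      simp_all [walsh_flipBit_of_mem, walsh_flipBit_of_notMem]

/-- The discrete derivative of a function on the cube in the direction of the `i`-th coordinate. -/
def flipDiff (i : ι) (f : (ι → Bool) → ℝ) (ω : ι → Bool) : ℝ := f ω - f (flipBit i ω)

@[fun_prop]
lemma continuous_flipDiff (i : ι) (hf : Continuous f) : Continuous (flipDiff i f) :=
  hf.sub (by fun_prop)

/-- The influence `E|f - f ∘ flipBit i|` of the `i`-th coordinate on `f`. -/
noncomputable def influence (P : Measure (ι → Bool)) (f : (ι → Bool) → ℝ) (i : ι) : ℝ :=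
  ∫ ω, |flipDiff i f ω| ∂P

lemma influence_nonneg (P : Measure (ι → Bool)) (f : (ι → Bool) → ℝ) (i : ι) :
    0 ≤ influence P f i := integral_nonneg fun _ => abs_nonneg _

variable [Countable ι] [IsProbabilityMeasure P]

lemma walshCoeff_walshSum (hP : IsFlipInvariant P) (A : Finset (Finset ι)) (c : Finset ι → ℝ)
    (S : Finset ι) : walshCoeff P (walshSum A c) S = if S ∈ A then c S else 0 :=
  calc walshCoeff P (walshSum A c) S = ∫ ω, walsh S ω * walshSum A c ω ∂P := by
        simp only [walshCoeff, mul_comm]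
    _ = ∑ T ∈ A, c T * ∫ ω, walsh S ω * walsh T ω ∂P :=
        integral_mul_walshSum (continuous_walsh S) A c
    _ = if S ∈ A then c S else 0 := by simp [integral_walsh_mul_walsh hP]

lemma integral_sq_sub_walshSum (hP : IsFlipInvariant P) (hf : Continuous f)
    (A : Finset (Finset ι)) (c : Finset ι → ℝ) :
    ∫ ω, (f ω - walshSum A c ω) ^ 2 ∂P = ∫ ω, f ω ^ 2 ∂P - ∑ S ∈ A, walshCoeff P f S ^ 2
      + ∑ S ∈ A, (c S - walshCoeff P f S) ^ 2 := by
  have hexp : ∫ ω, (f ω - walshSum A c ω) ^ 2 ∂P = ∫ ω, f ω ^ 2 ∂P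
      - 2 * ∫ ω, f ω * walshSum A c ω ∂P + ∫ ω, walshSum A c ω * walshSum A c ω ∂P := by
    rw [← integral_const_mul, ← integral_sub, ← integral_add]
    · exact integral_congr_ae (.of_forall fun ω => by ring)
    all_goals exact integrable_of_continuous (by fun_prop)
  have hnorm : ∑ S ∈ A, c S * walshCoeff P (walshSum A c) S = ∑ S ∈ A, c S ^ 2 :=
    Finset.sum_congr rfl fun S hS => by rw [walshCoeff_walshSum hP, if_pos hS, sq]
  have hsq : ∑ S ∈ A, (c S - walshCoeff P f S) ^ 2 = ∑ S ∈ A, c S ^ 2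
      - 2 * ∑ S ∈ A, c S * walshCoeff P f S + ∑ S ∈ A, walshCoeff P f S ^ 2 := by
    rw [Finset.mul_sum, ← Finset.sum_sub_distrib, ← Finset.sum_add_distrib]
    exact Finset.sum_congr rfl fun S _ => by ring
  rw [hexp, integral_mul_walshSum hf, integral_mul_walshSum (by fun_prop), hnorm, hsq]
  ring

lemma sum_sq_walshCoeff_le (hP : IsFlipInvariant P) (hf : Continuous f) (A : Finset (Finset ι)) :
    ∑ S ∈ A, walshCoeff P f S ^ 2 ≤ ∫ ω, f ω ^ 2 ∂P := by
  have h0 : 0 ≤ ∫ ω, (f ω - walshSum A (walshCoeff P f) ω) ^ 2 ∂P :=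
    integral_nonneg fun _ => sq_nonneg _
  simpa [integral_sq_sub_walshSum hP hf] using h0

lemma exists_integral_sq_le_sum_sq_walshCoeff_add (hP : IsFlipInvariant P) (hf : Continuous f)
    {ε : ℝ} (hε : 0 < ε) :
    ∃ A : Finset (Finset ι), ∫ ω, f ω ^ 2 ∂P ≤ ∑ S ∈ A, walshCoeff P f S ^ 2 + ε := by
  obtain ⟨A, c, happrox⟩ := exists_walshSum_near hf (Real.sqrt_pos.2 hε)
  have hdist : ∫ ω, (f ω - walshSum A c ω) ^ 2 ∂P ≤ ε :=
    calc ∫ ω, (f ω - walshSum A c ω) ^ 2 ∂P ≤ ∫ _, ε ∂P := by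
          refine integral_mono (integrable_of_continuous (by fun_prop)) (integrable_const _)
            fun ω => ?_
          rw [← sq_abs, abs_sub_comm]
          exact (pow_le_pow_left₀ (abs_nonneg _) (happrox ω).le 2).trans_eq (Real.sq_sqrt hε.le)
      _ = ε := by simp
  have h0 : 0 ≤ ∑ S ∈ A, (c S - walshCoeff P f S) ^ 2 := Finset.sum_nonneg fun _ _ => sq_nonneg _
  rw [integral_sq_sub_walshSum hP hf] at hdist
  exact ⟨A, by linarith⟩

lemma integral_add_bitSign_mul_pow_four (hP : IsFlipInvariant P) {i : ι}
    {g h : (ι → Bool) → ℝ} (hg : Continuous g) (hh : Continuous h)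
    (hgi : ∀ ω, g (flipBit i ω) = g ω) (hhi : ∀ ω, h (flipBit i ω) = h ω) :
    ∫ ω, (g ω + bitSign (ω i) * h ω) ^ 4 ∂P
      = ∫ ω, g ω ^ 4 ∂P + 6 * ∫ ω, g ω ^ 2 * h ω ^ 2 ∂P + ∫ ω, h ω ^ 4 ∂P := by
  have hodd : ∫ ω, bitSign (ω i) * (4 * (g ω ^ 3 * h ω + g ω * h ω ^ 3)) ∂P = 0 :=
    hP.integral_eq_zero_of_flipBit_eq_neg (i := i) fun ω => by
      rw [flipBit_same, bitSign_not, hgi, hhi, neg_mul]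
  rw [← add_zero (_ + _), ← hodd, ← integral_const_mul, ← integral_add, ← integral_add,
    ← integral_add]
  · refine integral_congr_ae (.of_forall fun ω => ?_)
    linear_combination (6 * g ω ^ 2 * h ω ^ 2 + 4 * bitSign (ω i) * g ω * h ω ^ 3
      + (bitSign (ω i) ^ 2 + 1) * h ω ^ 4) * bitSign_mul_self (ω i)
  all_goals exact integrable_of_continuous (by fun_prop)

-- Bonami's hypercontractive inequality from `L²` to `L⁴`, by induction on the coordinates.
lemma integral_walshSum_pow_four_le (hP : IsFlipInvariant P) (A : Finset ι)
    (c : Finset ι → ℝ) : ∫ ω, walshSum A.powerset c ω ^ 4 ∂P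
      ≤ (∑ S ∈ A.powerset, 3 ^ S.card * c S ^ 2) ^ 2 := by
  induction A using Finset.induction_on generalizing c with
  | empty => simp [walshSum, walsh, ← pow_mul]
  | insert i A hi ih =>
    set g := walshSum A.powerset c
    set h := walshSum A.powerset fun S => c (insert i S)
    set u := ∑ S ∈ A.powerset, 3 ^ S.card * c S ^ 2
    set w := ∑ S ∈ A.powerset, 3 ^ S.card * c (insert i S) ^ 2 with hw
    have hu0 : 0 ≤ u := Finset.sum_nonneg fun _ _ => by positivity
    have hw0 : 0 ≤ w := Finset.sum_nonneg fun _ _ => by positivity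
    have hg4 : ∫ ω, g ω ^ 4 ∂P ≤ u ^ 2 := ih c
    have hh4 : ∫ ω, h ω ^ 4 ∂P ≤ w ^ 2 := ih _
    have hcross : ∫ ω, g ω ^ 2 * h ω ^ 2 ∂P ≤ u * w := by
      refine le_of_sq_le_sq ?_ (mul_nonneg hu0 hw0)
      calc (∫ ω, g ω ^ 2 * h ω ^ 2 ∂P) ^ 2 ≤ (∫ ω, (g ω ^ 2) ^ 2 ∂P) * ∫ ω, (h ω ^ 2) ^ 2 ∂P :=
            sq_integral_mul_le (memLp_of_continuous (by fun_prop) 2)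
              (memLp_of_continuous (by fun_prop) 2)
        _ ≤ u ^ 2 * w ^ 2 := by
            simp only [← pow_mul, Nat.reduceMul]
            exact mul_le_mul hg4 hh4 (integral_nonneg fun _ => by positivity) (by positivity)
        _ = (u * w) ^ 2 := (mul_pow _ _ _).symm
    have hnorm : ∑ S ∈ (insert i A).powerset, (3 : ℝ) ^ S.card * c S ^ 2 = u + 3 * w := by
      rw [Finset.sum_powerset_insert hi, hw, Finset.mul_sum]
      congr 1
      refine Finset.sum_congr rfl fun S hS => ?_
      rw [Finset.card_insert_of_notMem fun hiS => hi (Finset.mem_powerset.1 hS hiS)]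
      ring
    simp only [walshSum_powerset_insert hi, hnorm]
    rw [integral_add_bitSign_mul_pow_four hP (by fun_prop) (by fun_prop)
      (walshSum_powerset_flipBit hi c) (walshSum_powerset_flipBit hi _)]
    linarith [sq_nonneg w]

lemma walshCoeff_flipDiff (hP : IsFlipInvariant P) (hf : Continuous f) (i : ι) (S : Finset ι) :
    walshCoeff P (flipDiff i f) S = if i ∈ S then 2 * walshCoeff P f S else 0 := by
  have hsub : walshCoeff P (flipDiff i f) S
      = walshCoeff P f S - ∫ ω, f (flipBit i ω) * walsh S ω ∂P := by
    rw [walshCoeff, walshCoeff, ← integral_sub (integrable_of_continuous (by fun_prop))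
      (integrable_of_continuous (by fun_prop))]
    simp only [flipDiff, sub_mul]
  have hflip : ∫ ω, f (flipBit i ω) * walsh S ω ∂P
      = ∫ ω, f ω * walsh S (flipBit i ω) ∂P := by
    rw [← hP.integral_comp_flipBit i]
    simp only [flipBit_flipBit]
  rw [hsub, hflip]
  split_ifs with h
  · simp only [walsh_flipBit_of_mem h, mul_neg, integral_neg, walshCoeff]
    ring
  · simp only [walsh_flipBit_of_notMem h, walshCoeff, sub_self]

lemma sum_biUnion_mul_sq_walshCoeff_flipDiff (hP : IsFlipInvariant P) (hf : Continuous f)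
    (A : Finset (Finset ι)) (w : Finset ι → ℝ) :
    ∑ i ∈ A.biUnion id, ∑ S ∈ A, w S * walshCoeff P (flipDiff i f) S ^ 2
      = 4 * ∑ S ∈ A, S.card * (w S * walshCoeff P f S ^ 2) := by
  rw [Finset.sum_comm, Finset.mul_sum]
  refine Finset.sum_congr rfl fun S hS => ?_
  have hsub : S ⊆ A.biUnion id := Finset.subset_biUnion_of_mem id hS
  simp only [walshCoeff_flipDiff hP hf, ite_pow, mul_ite, ne_eq, OfNat.ofNat_ne_zero,
    not_false_eq_true, zero_pow, mul_zero]
  rw [← Finset.sum_filter, Finset.sum_const, Finset.filter_mem_eq_inter,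
    Finset.inter_eq_right.2 hsub, nsmul_eq_mul]
  ring

-- `a = ∑_S 3^(-|S|) ĝ(S)²` is the pairing of `g` with its noise-damped version `u`, whose fourth
-- moment is at most `a²` by hypercontractivity; Hölder then gives `a⁴ ≤ (E|g|)³ a²`.
lemma sq_sum_inv_three_pow_mul_sq_walshCoeff_le (hP : IsFlipInvariant P) {g : (ι → Bool) → ℝ}
    (hg : Continuous g) (hg1 : ∀ ω, |g ω| ≤ 1) (A : Finset (Finset ι)) :
    (∑ S ∈ A, ((3 : ℝ) ^ S.card)⁻¹ * walshCoeff P g S ^ 2) ^ 2 ≤ (∫ ω, |g ω| ∂P) ^ 3 := by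
  set a := ∑ S ∈ A, ((3 : ℝ) ^ S.card)⁻¹ * walshCoeff P g S ^ 2
  set B : Finset ι := A.biUnion id
  have hAB : A ⊆ B.powerset := fun S hS =>
    Finset.mem_powerset.2 (Finset.subset_biUnion_of_mem id hS)
  set c : Finset ι → ℝ := fun S => if S ∈ A then ((3 : ℝ) ^ S.card)⁻¹ * walshCoeff P g S else 0
  set u := walshSum B.powerset c
  have hpair : ∫ ω, g ω * u ω ∂P = a := by
    rw [integral_mul_walshSum hg, ← Finset.sum_subset hAB fun S _ hS => by simp [c, hS]]
    exact Finset.sum_congr rfl fun S hS => by simp only [c, if_pos hS]; ring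
  have hfourth : ∫ ω, u ω ^ 4 ∂P ≤ a ^ 2 := by
    refine (integral_walshSum_pow_four_le hP B c).trans_eq ?_
    rw [← Finset.sum_subset hAB fun S _ hS => by simp [c, hS]]
    congr 1
    exact Finset.sum_congr rfl fun S hS => by simp only [c, if_pos hS]; field_simp
  have hhoelder : a ^ 2 * a ^ 2 ≤ (∫ ω, |g ω| ∂P) ^ 3 * a ^ 2 :=
    calc a ^ 2 * a ^ 2 = (∫ ω, g ω * u ω ∂P) ^ 4 := by rw [hpair]; ring
      _ ≤ (∫ ω, |g ω| ∂P) ^ 3 * ∫ ω, u ω ^ 4 ∂P :=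
          integral_mul_pow_four_le hg.aestronglyMeasurable hg1 (memLp_of_continuous (by fun_prop) 4)
      _ ≤ (∫ ω, |g ω| ∂P) ^ 3 * a ^ 2 := by gcongr
  rcases eq_or_ne a 0 with h | h
  · rw [h, zero_pow two_ne_zero]
    positivity
  · exact le_of_mul_le_mul_right hhoelder (by positivity)

lemma sum_card_mul_sq_walshCoeff_le (hP : IsFlipInvariant P) (hf : Continuous f)
    (h1 : ∀ i ω, |flipDiff i f ω| ≤ 1) {T : ℝ}
    (hT : ∀ B : Finset ι, ∑ i ∈ B, influence P f i ≤ T) (A : Finset (Finset ι)) :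
    4 * ∑ S ∈ A, S.card * walshCoeff P f S ^ 2 ≤ T :=
  calc 4 * ∑ S ∈ A, S.card * walshCoeff P f S ^ 2
      = ∑ i ∈ A.biUnion id, ∑ S ∈ A, walshCoeff P (flipDiff i f) S ^ 2 := by
        simpa only [one_mul] using
          (sum_biUnion_mul_sq_walshCoeff_flipDiff hP hf A fun _ => 1).symm
    _ ≤ ∑ i ∈ A.biUnion id, influence P f i := by
        refine Finset.sum_le_sum fun i _ => (sum_sq_walshCoeff_le hP (by fun_prop) A).trans ?_
        refine integral_mono (integrable_of_continuous (by fun_prop))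
          (integrable_of_continuous (by fun_prop)) fun ω => ?_
        rw [← sq_abs]
        exact pow_le_of_le_one (abs_nonneg _) (h1 i ω) two_ne_zero
    _ ≤ T := hT _

lemma sum_card_mul_inv_three_pow_mul_sq_walshCoeff_le (hP : IsFlipInvariant P)
    (hf : Continuous f) (h1 : ∀ i ω, |flipDiff i f ω| ≤ 1) {T δ : ℝ}
    (hT : ∀ B : Finset ι, ∑ i ∈ B, influence P f i ≤ T) (hδ : ∀ i, influence P f i ≤ δ)
    (A : Finset (Finset ι)) :
    4 * ∑ S ∈ A, S.card * (((3 : ℝ) ^ S.card)⁻¹ * walshCoeff P f S ^ 2) ≤ √δ * T :=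
  calc 4 * ∑ S ∈ A, S.card * (((3 : ℝ) ^ S.card)⁻¹ * walshCoeff P f S ^ 2)
      = ∑ i ∈ A.biUnion id, ∑ S ∈ A,
          ((3 : ℝ) ^ S.card)⁻¹ * walshCoeff P (flipDiff i f) S ^ 2 :=
        (sum_biUnion_mul_sq_walshCoeff_flipDiff hP hf A _).symm
    _ ≤ ∑ i ∈ A.biUnion id, √δ * influence P f i := by
        refine Finset.sum_le_sum fun i _ => ?_
        have hI := influence_nonneg P f i
        refine le_of_sq_le_sq ?_ (mul_nonneg (Real.sqrt_nonneg _) hI)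
        calc _ ≤ influence P f i ^ 3 :=
              sq_sum_inv_three_pow_mul_sq_walshCoeff_le hP (by fun_prop) (h1 i) A
          _ ≤ δ * influence P f i ^ 2 := by rw [pow_succ']; gcongr; exact hδ i
          _ = (√δ * influence P f i) ^ 2 := by rw [mul_pow, Real.sq_sqrt (hI.trans (hδ i))]
    _ ≤ √δ * T := by
        rw [← Finset.mul_sum]
        gcongr
        exact hT _

lemma variance_le_of_sum_sq_walshCoeff_le (hP : IsFlipInvariant P) (hf : Continuous f) {K : ℝ}
    (hK : ∀ A : Finset (Finset ι), ∅ ∉ A → ∑ S ∈ A, walshCoeff P f S ^ 2 ≤ K) :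
    variance f P ≤ K := by
  refine le_of_forall_pos_le_add fun ε hε => ?_
  obtain ⟨A, hA⟩ := exists_integral_sq_le_sum_sq_walshCoeff_add hP hf hε
  have hsplit : ∑ S ∈ A, walshCoeff P f S ^ 2
      ≤ walshCoeff P f ∅ ^ 2 + ∑ S ∈ A.erase ∅, walshCoeff P f S ^ 2 := by
    rw [← Finset.sum_insert (f := fun S => walshCoeff P f S ^ 2) (Finset.notMem_erase ∅ A)]
    exact Finset.sum_le_sum_of_subset_of_nonneg (Finset.insert_erase_subset _ _)
      fun _ _ _ => sq_nonneg _
  rw [variance_eq_sub (memLp_of_continuous hf 2), ← walshCoeff_empty P f]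
  simp only [Pi.pow_apply]
  linarith [hK _ (Finset.notMem_erase ∅ A)]

lemma le_card_mul_div_add_three_pow_mul {q : ℝ} (hq : 0 ≤ q) {n k : ℕ} (hn : 1 ≤ n)
    (hk : 1 ≤ k) : q ≤ n * q / k + 3 ^ k * (n * ((3 ^ n)⁻¹ * q)) := by
  have hn' : (1 : ℝ) ≤ n := by exact_mod_cast hn
  have hk' : (0 : ℝ) < k := by exact_mod_cast hk
  rcases le_total k n with hkn | hnk
  · have hhigh : q ≤ n * q / k := by
      rw [le_div_iff₀ hk', mul_comm]
      gcongr
    have : 0 ≤ 3 ^ k * (n * (((3 : ℝ) ^ n)⁻¹ * q)) := by positivity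
    linarith
  · have hlow : q ≤ 3 ^ k * (n * (((3 : ℝ) ^ n)⁻¹ * q)) :=
      calc q = 3 ^ n * (1 * (((3 : ℝ) ^ n)⁻¹ * q)) := by field_simp
        _ ≤ 3 ^ k * (n * (((3 : ℝ) ^ n)⁻¹ * q)) := by gcongr; norm_num
    have : 0 ≤ n * q / k := by positivity
    linarith

theorem variance_le_of_influence_le (hP : IsFlipInvariant P) (hf : Continuous f)
    (h1 : ∀ i ω, |flipDiff i f ω| ≤ 1) {T δ : ℝ}
    (hT : ∀ B : Finset ι, ∑ i ∈ B, influence P f i ≤ T) (hδ : ∀ i, influence P f i ≤ δ)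
    {k : ℕ} (hk : 1 ≤ k) : variance f P ≤ T / k + 3 ^ k * √δ * T := by
  have hT0 : 0 ≤ T := by simpa using hT ∅
  refine variance_le_of_sum_sq_walshCoeff_le hP hf fun A hA => ?_
  have hhigh := sum_card_mul_sq_walshCoeff_le hP hf h1 hT A
  have hlow := sum_card_mul_inv_three_pow_mul_sq_walshCoeff_le hP hf h1 hT hδ A
  have hlow0 : 0 ≤ √δ * T := by positivity
  calc ∑ S ∈ A, walshCoeff P f S ^ 2
      ≤ ∑ S ∈ A, (S.card * walshCoeff P f S ^ 2 / k
          + 3 ^ k * (S.card * ((3 ^ S.card)⁻¹ * walshCoeff P f S ^ 2))) :=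
        Finset.sum_le_sum fun S hS => le_card_mul_div_add_three_pow_mul (sq_nonneg _)
          (Finset.card_pos.2 (Finset.nonempty_iff_ne_empty.2 (ne_of_mem_of_not_mem hS hA))) hk
    _ = (∑ S ∈ A, S.card * walshCoeff P f S ^ 2) / k
          + 3 ^ k * ∑ S ∈ A, S.card * ((3 ^ S.card)⁻¹ * walshCoeff P f S ^ 2) := by
        rw [Finset.sum_add_distrib, Finset.sum_div, Finset.mul_sum]
    _ ≤ T / k + 3 ^ k * (√δ * T) := by gcongr <;> linarith
    _ = T / k + 3 ^ k * √δ * T := by rw [mul_assoc]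

end FlipInvariant

section Lattice

variable {d : ℕ}

lemma basisVec_same (i : Fin d) : basisVec i i = 1 := by simp [basisVec]

lemma basisVec_of_ne {i j : Fin d} (h : j ≠ i) : basisVec i j = 0 := by simp [basisVec, h]

/-- The endpoint `x + e_i` of the edge `(x, i)`; the other endpoint is its first component. -/
def Edge.head (e : Edge d) : Vertex d := e.1 + basisVec e.2

lemma head_apply_of_ne {e : Edge d} {j : Fin d} (h : j ≠ e.2) : e.head j = e.1 j := by
  simp [Edge.head, basisVec_of_ne h]

lemma head_apply_same (e : Edge d) : e.head e.2 = e.1 e.2 + 1 := by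
  simp [Edge.head, basisVec_same]

lemma natAbs_le_l1norm (v : Vertex d) (j : Fin d) : (v j).natAbs ≤ l1norm v :=
  Finset.single_le_sum (f := fun j => (v j).natAbs) (fun _ _ => Nat.zero_le _) (Finset.mem_univ j)

lemma one_le_l1norm {v : Vertex d} (hv : v ≠ 0) : 1 ≤ l1norm v := by
  obtain ⟨j, hj⟩ := Function.ne_iff.1 hv
  exact (Nat.one_le_iff_ne_zero.2 (by simpa using hj)).trans (natAbs_le_l1norm v j)

lemma outflow_add (θ φ : Edge d → ℝ) (x : Vertex d) :
    outflow (θ + φ) x = outflow θ x + outflow φ x := by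
  simp only [outflow, ← Finset.sum_add_distrib, Pi.add_apply]
  exact Finset.sum_congr rfl fun i _ => by ring

lemma outflow_smul (c : ℝ) (θ : Edge d → ℝ) (x : Vertex d) :
    outflow (c • θ) x = c * outflow θ x := by
  simp only [outflow, Finset.mul_sum, Pi.smul_apply, smul_eq_mul]
  exact Finset.sum_congr rfl fun i _ => by ring

lemma outflow_neg (θ : Edge d → ℝ) (x : Vertex d) : outflow (-θ) x = -outflow θ x := by
  simpa using outflow_smul (-1) θ x

lemma outflow_sub (θ φ : Edge d → ℝ) (x : Vertex d) :
    outflow (θ - φ) x = outflow θ x - outflow φ x := by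
  rw [sub_eq_add_neg, outflow_add, outflow_neg, sub_eq_add_neg]

lemma outflow_sum {κ : Type*} (A : Finset κ) (θ : κ → Edge d → ℝ) (x : Vertex d) :
    outflow (∑ k ∈ A, θ k) x = ∑ k ∈ A, outflow (θ k) x := by
  classical
  induction A using Finset.induction_on with
  | empty => simp [outflow]
  | insert k A hk ih => rw [Finset.sum_insert hk, Finset.sum_insert hk, outflow_add, ih]

/-- The point mass at `x`: a flow from `x` to `y` has outflow `pointMass x - pointMass y`. -/
def pointMass (x z : Vertex d) : ℝ := if z = x then 1 else 0

lemma isUnitFlow_iff {x y : Vertex d} (hxy : x ≠ y) {θ : Edge d → ℝ} :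
    IsUnitFlow x y θ ↔ ∀ z, outflow θ z = pointMass x z - pointMass y z := by
  refine ⟨fun h z => ?_, fun h => ⟨fun z hx hy => ?_, ?_, ?_⟩⟩
  · by_cases hx : z = x
    · simp [pointMass, hx, hxy, h.source]
    by_cases hy : z = y
    · simpa [pointMass, hy, hxy.symm] using neg_eq_iff_eq_neg.1 h.sink
    · simp [pointMass, hx, hy, h.node_law z hx hy]
  · simp [h, pointMass, hx, hy]
  · simp [h, pointMass, hxy]
  · simp [h, pointMass, hxy.symm]

/-- The sup-norm ball of radius `N` around the origin. -/
noncomputable def box (d N : ℕ) : Finset (Vertex d) :=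
  Fintype.piFinset fun _ => Finset.Icc (-(N : ℤ)) N

lemma mem_box {N : ℕ} {x : Vertex d} : x ∈ box d N ↔ ∀ j, -(N : ℤ) ≤ x j ∧ x j ≤ N := by
  simp [box]

lemma box_mono {N M : ℕ} (h : N ≤ M) : box d N ⊆ box d M :=
  Fintype.piFinset_subset _ _ fun _ => Finset.Icc_subset_Icc (by simpa) (by simpa)

lemma zero_mem_box (d N : ℕ) : 0 ∈ box d N := by simp [mem_box]

lemma mem_box_of_l1norm_le {N : ℕ} {x : Vertex d} (h : l1norm x ≤ N) : x ∈ box d N :=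
  mem_box.2 fun j => by have := (natAbs_le_l1norm x j).trans h; omega

lemma head_mem_box_iff {N : ℕ} {e : Edge d} : e.head ∈ box d N ↔
    (-(N : ℤ) ≤ e.1 e.2 + 1 ∧ e.1 e.2 + 1 ≤ N) ∧ ∀ j ≠ e.2, -(N : ℤ) ≤ e.1 j ∧ e.1 j ≤ N := by
  rw [mem_box]
  refine ⟨fun h => ⟨head_apply_same e ▸ h e.2, fun j hj => head_apply_of_ne hj ▸ h j⟩,
    fun h j => ?_⟩
  by_cases hj : j = e.2
  · rw [hj, head_apply_same]; exact h.1
  · rw [head_apply_of_ne hj]; exact h.2 j hj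

lemma tail_mem_box_iff {N : ℕ} {e : Edge d} : e.1 ∈ box d N ↔
    (-(N : ℤ) ≤ e.1 e.2 ∧ e.1 e.2 ≤ N) ∧ ∀ j ≠ e.2, -(N : ℤ) ≤ e.1 j ∧ e.1 j ≤ N := by
  rw [mem_box]
  refine ⟨fun h => ⟨h _, fun j _ => h j⟩, fun h j => ?_⟩
  by_cases hj : j = e.2
  · exact hj ▸ h.1
  · exact h.2 j hj

lemma head_mem_box_succ {N : ℕ} {e : Edge d} (h : e.1 ∈ box d N) : e.head ∈ box d (N + 1) := by
  rw [tail_mem_box_iff] at h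
  rw [head_mem_box_iff]
  push_cast
  exact ⟨by omega, fun j hj => by have := h.2 j hj; omega⟩

lemma tail_mem_box_succ {N : ℕ} {e : Edge d} (h : e.head ∈ box d N) : e.1 ∈ box d (N + 1) := by
  rw [head_mem_box_iff] at h
  rw [tail_mem_box_iff]
  push_cast
  exact ⟨by omega, fun j hj => by have := h.2 j hj; omega⟩

/-- The cutset of the edges with exactly one endpoint in the ball of radius `N`. -/
noncomputable def boxBdry (d N : ℕ) : Finset (Edge d) :=
  {e ∈ box d (N + 1) ×ˢ Finset.univ | ¬(e.1 ∈ box d N ↔ e.head ∈ box d N)}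

lemma mem_boxBdry {N : ℕ} {e : Edge d} :
    e ∈ boxBdry d N ↔ ¬(e.1 ∈ box d N ↔ e.head ∈ box d N) := by
  simp only [boxBdry, Finset.mem_filter, Finset.mem_product, Finset.mem_univ, and_true,
    and_iff_right_iff_imp]
  intro h
  by_cases h1 : e.1 ∈ box d N
  · exact box_mono (Nat.le_succ N) h1
  · exact tail_mem_box_succ (by tauto)

lemma mem_box_and_head_mem_box_of_mem_boxBdry {N M : ℕ} (h : N < M) {e : Edge d}
    (he : e ∈ boxBdry d N) : e.1 ∈ box d M ∧ e.head ∈ box d M := by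
  have hNM : box d (N + 1) ⊆ box d M := box_mono h
  have hN : box d N ⊆ box d M := box_mono h.le
  rw [mem_boxBdry] at he
  by_cases h1 : e.1 ∈ box d N
  · exact ⟨hN h1, hNM (head_mem_box_succ h1)⟩
  · have h2 : e.head ∈ box d N := by tauto
    exact ⟨hNM (tail_mem_box_succ h2), hN h2⟩

lemma pairwise_disjoint_boxBdry (d : ℕ) : Pairwise (Function.onFun Disjoint (boxBdry d)) := by
  refine (pairwise_disjoint_on _).2 fun N M hNM => Finset.disjoint_left.2 fun e he he' => ?_
  have h := mem_box_and_head_mem_box_of_mem_boxBdry hNM he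
  exact mem_boxBdry.1 he' (iff_of_true h.1 h.2)

lemma card_piFinset_update_singleton {I : Fin d → Finset ℤ} {K : ℕ} (hI : ∀ j, (I j).card = K)
    (i : Fin d) (t : ℤ) : (Fintype.piFinset (Function.update I i {t})).card = K ^ (d - 1) := by
  rw [Fintype.card_piFinset, ← Finset.mul_prod_erase _ _ (Finset.mem_univ i),
    Finset.prod_congr rfl (g := fun _ => K)]
  · simp [Finset.card_erase_of_mem]
  · intro j hj
    rw [Function.update_of_ne (Finset.ne_of_mem_erase hj), hI]

lemma mem_piFinset_update_singleton {I : Fin d → Finset ℤ} {i : Fin d} {t : ℤ} {x : Vertex d} :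
    x ∈ Fintype.piFinset (Function.update I i {t}) ↔ x i = t ∧ ∀ j ≠ i, x j ∈ I j := by
  rw [Fintype.mem_piFinset]
  refine ⟨fun h => ⟨by simpa using h i, fun j hj => by simpa [hj] using h j⟩, fun h j => ?_⟩
  by_cases hj : j = i
  · subst hj; simpa using h.1
  · simpa [hj] using h.2 j hj

lemma boxBdry_subset (d N : ℕ) : boxBdry d N ⊆ Finset.univ.biUnion fun i =>
    ({(N : ℤ), -(N : ℤ) - 1} : Finset ℤ).biUnion fun t =>
      (Fintype.piFinset (Function.update (fun _ => Finset.Icc (-(N : ℤ)) N) i {t})).image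
        (·, i) := by
  intro e he
  rw [mem_boxBdry, tail_mem_box_iff, head_mem_box_iff] at he
  simp only [Finset.mem_biUnion, Finset.mem_univ, true_and, Finset.mem_image,
    mem_piFinset_update_singleton, Finset.mem_Icc, Finset.mem_insert, Finset.mem_singleton]
  have hside : ∀ j ≠ e.2, -(N : ℤ) ≤ e.1 j ∧ e.1 j ≤ N := by
    by_contra hc
    exact he (iff_of_false (fun h => hc h.2) fun h => hc h.2)
  refine ⟨e.2, e.1 e.2, ?_, e.1, ⟨rfl, hside⟩, rfl⟩
  by_contra hc
  refine he (and_congr_left fun _ => ?_)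
  omega

lemma card_boxBdry_le (d N : ℕ) :
    ((boxBdry d N).card : ℝ) ≤ d * 2 ^ d * ((N : ℝ) + 1) ^ (d - 1) := by
  have hslab : ∀ i t, ((Fintype.piFinset (Function.update (fun _ : Fin d =>
      Finset.Icc (-(N : ℤ)) N) i {t})).image (·, i)).card ≤ (2 * (N + 1)) ^ (d - 1) := fun i t => by
    refine Finset.card_image_le.trans ?_
    rw [card_piFinset_update_singleton (K := 2 * N + 1) fun _ => by rw [Int.card_Icc]; omega]
    gcongr
    omega
  have hcount : (boxBdry d N).card ≤ d * (2 * (2 * (N + 1)) ^ (d - 1)) := by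
    refine (Finset.card_le_card (boxBdry_subset d N)).trans
      ((Finset.card_biUnion_le_card_mul _ _ (2 * (2 * (N + 1)) ^ (d - 1)) fun i _ => ?_).trans
        (by simp))
    exact (Finset.card_biUnion_le_card_mul _ _ _ fun t _ => hslab i t).trans
      (Nat.mul_le_mul_right _ Finset.card_le_two)
  rcases d with _ | m
  · simpa using hcount
  · refine (Nat.cast_le.2 hcount).trans_eq ?_
    rw [Nat.add_sub_cancel, mul_pow]
    push_cast
    ring

/-- The decrease of `k` along the edge `e`. -/
def potentialDrop (k : Vertex d → ℝ) (e : Edge d) : ℝ := k e.1 - k e.head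

lemma abs_potentialDrop_le {k : Vertex d → ℝ} {K : ℝ} (h0 : ∀ x, 0 ≤ k x) (hK : ∀ x, k x ≤ K)
    (e : Edge d) : |potentialDrop k e| ≤ K :=
  abs_sub_le_of_nonneg_of_le (h0 _) (hK _) (h0 _) (hK _)

/-- Summation by parts. -/
lemma sum_box_mul_outflow (θ : Edge d → ℝ) {k : Vertex d → ℝ} {N : ℕ}
    (hk : ∀ x ∉ box d N, k x = 0) :
    ∑ x ∈ box d N, k x * outflow θ x
      = ∑ e ∈ box d (N + 1) ×ˢ Finset.univ, θ e * potentialDrop k e := by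
  have hout : ∀ i, ∑ x ∈ box d N, k x * θ (x, i) = ∑ x ∈ box d (N + 1), k x * θ (x, i) := fun i =>
    Finset.sum_subset (box_mono (Nat.le_succ N)) fun x _ hx => by rw [hk x hx, zero_mul]
  have hin : ∀ i, ∑ x ∈ box d N, k x * θ (x - basisVec i, i)
      = ∑ x ∈ box d (N + 1), k (x + basisVec i) * θ (x, i) := fun i =>
    calc ∑ x ∈ box d N, k x * θ (x - basisVec i, i) = ∑' x, k x * θ (x - basisVec i, i) :=
          (tsum_eq_sum fun x hx => by rw [hk x hx, zero_mul]).symm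
      _ = ∑' x, k (x + basisVec i) * θ (x, i) := by
          rw [← (Equiv.addRight (basisVec i)).tsum_eq]
          simp
      _ = ∑ x ∈ box d (N + 1), k (x + basisVec i) * θ (x, i) := tsum_eq_sum fun x hx => by
          rw [hk (x + basisVec i) fun h => hx (tail_mem_box_succ (e := (x, i)) h), zero_mul]
  calc ∑ x ∈ box d N, k x * outflow θ x
      = ∑ i, (∑ x ∈ box d N, k x * θ (x, i) - ∑ x ∈ box d N, k x * θ (x - basisVec i, i)) := by
        simp only [outflow, Finset.mul_sum, ← Finset.sum_sub_distrib]
        rw [Finset.sum_comm]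
        exact Finset.sum_congr rfl fun i _ => Finset.sum_congr rfl fun x _ => by ring
    _ = ∑ i, ∑ x ∈ box d (N + 1), θ (x, i) * potentialDrop k (x, i) := by
        simp only [hout, hin, ← Finset.sum_sub_distrib, potentialDrop, Edge.head]
        exact Finset.sum_congr rfl fun i _ => Finset.sum_congr rfl fun x _ => by ring
    _ = _ := by rw [Finset.sum_product_right]

lemma sum_mul_potentialDrop_sub_le (θ : Edge d → ℝ) {k : Vertex d → ℝ} {K : ℝ} (h0 : ∀ x, 0 ≤ k x)
    (hK : ∀ x, k x ≤ K) {N : ℕ} {A : Finset (Edge d)}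
    (hA : ∀ e ∈ A, e.1 ∈ box d N ∧ e.head ∈ box d N) (hpos : ∀ e, 0 ≤ θ e * potentialDrop k e) :
    ∑ e ∈ A, θ e * potentialDrop k e - K * ∑ e ∈ boxBdry d N, |θ e|
      ≤ ∑ x ∈ box d N, k x * outflow θ x := by
  classical
  set k' : Vertex d → ℝ := (box d N : Set (Vertex d)).indicator k
  have hin : ∀ x ∈ box d N, k' x = k x := fun x hx => Set.indicator_of_mem (by simpa) k
  have hout : ∀ x ∉ box d N, k' x = 0 := fun x hx => Set.indicator_of_notMem (by simpa) k
  have hbdry : -(K * ∑ e ∈ boxBdry d N, |θ e|)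
      ≤ ∑ e ∈ boxBdry d N, θ e * potentialDrop k' e := by
    rw [Finset.mul_sum, ← Finset.sum_neg_distrib]
    refine Finset.sum_le_sum fun e _ => neg_le_of_neg_le ((neg_le_abs _).trans ?_)
    rw [abs_mul, mul_comm]
    refine mul_le_mul_of_nonneg_right (abs_potentialDrop_le (fun x => ?_) (fun x => ?_) e)
      (abs_nonneg _)
    · exact Set.indicator_nonneg (fun y _ => h0 y) x
    · exact Set.indicator_le' (fun y _ => hK y) (fun _ _ => (h0 0).trans (hK 0)) x
  have hinner : ∑ e ∈ A, θ e * potentialDrop k e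
      ≤ ∑ e ∈ box d (N + 1) ×ˢ Finset.univ with (e.1 ∈ box d N ↔ Edge.head e ∈ box d N),
        θ e * potentialDrop k' e := by
    rw [Finset.sum_congr rfl fun e he => show _ = θ e * potentialDrop k' e by
      rw [potentialDrop, potentialDrop, hin _ (hA e he).1, hin _ (hA e he).2]]
    refine Finset.sum_le_sum_of_subset_of_nonneg (fun e he => ?_) fun e he _ => ?_
    · simpa [hA e he] using box_mono (Nat.le_succ N) (hA e he).1
    · have hiff := (Finset.mem_filter.1 he).2
      by_cases h1 : e.1 ∈ box d N
      · rw [potentialDrop, hin _ h1, hin _ (hiff.1 h1)]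
        exact hpos e
      · rw [potentialDrop, hout _ h1, hout _ fun h => h1 (hiff.2 h), sub_zero, mul_zero]
  have hparts : ∑ x ∈ box d N, k x * outflow θ x
      = ∑ e ∈ box d (N + 1) ×ˢ Finset.univ, θ e * potentialDrop k' e := by
    rw [← sum_box_mul_outflow θ hout]
    exact Finset.sum_congr rfl fun x hx => by rw [hin x hx]
  rw [hparts, ← Finset.sum_filter_add_sum_filter_not (box d (N + 1) ×ˢ Finset.univ)
    fun e : Edge d => (e.1 ∈ box d N ↔ e.head ∈ box d N)]
  rw [boxBdry] at hbdry ⊢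
  linarith

lemma sum_box_mul_pointMass {N : ℕ} {x : Vertex d} (hx : x ∈ box d N) (k : Vertex d → ℝ) :
    ∑ z ∈ box d N, k z * pointMass x z = k x := by
  simp [pointMass, hx]

lemma one_le_sum_boxBdry {v : Vertex d} {θ : Edge d → ℝ} (hv : 0 ≠ v)
    (hθ : IsUnitFlow 0 v θ) {N : ℕ} (hN : v ∉ box d N) : 1 ≤ ∑ e ∈ boxBdry d N, |θ e| := by
  have hflux := sum_mul_potentialDrop_sub_le (-θ) (k := fun _ => 1) (K := 1) (N := N) (A := ∅)
    (by simp) (by simp) (by simp) (by simp [potentialDrop])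
  have hout : ∑ x ∈ box d N, outflow θ x = 1 := by
    simp only [(isUnitFlow_iff hv).1 hθ, Finset.sum_sub_distrib]
    simp [pointMass, zero_mem_box, hN]
  simp only [Finset.sum_empty, Pi.neg_apply, abs_neg, one_mul, outflow_neg,
    Finset.sum_neg_distrib, hout] at hflux
  linarith

end Lattice

section Cutsets

variable {d : ℕ} {p : ℝ}

/-- Hölder's inequality on the cutset `boxBdry d N`, which has `O(N^(d-1))` edges. -/
lemma mul_rpow_sum_boxBdry_le (hd : 1 ≤ d) (hp : 1 < p) (θ : Edge d → ℝ) (N : ℕ) :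
    ((d : ℝ) * 2 ^ d) ^ (-(p - 1)) * ((N : ℝ) + 1) ^ (-(((d : ℝ) - 1) * (p - 1)))
      * (∑ e ∈ boxBdry d N, |θ e|) ^ p ≤ ∑ e ∈ boxBdry d N, |θ e| ^ p := by
  have : (0 : ℝ) < d := by exact_mod_cast hd
  have hX : (0 : ℝ) < d * 2 ^ d * ((N : ℝ) + 1) ^ (d - 1) := by positivity
  have hconst : ((d : ℝ) * 2 ^ d) ^ (-(p - 1)) * ((N : ℝ) + 1) ^ (-(((d : ℝ) - 1) * (p - 1)))
      = ((d * 2 ^ d * ((N : ℝ) + 1) ^ (d - 1)) ^ (p - 1))⁻¹ := by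
    rw [← Real.rpow_neg hX.le, Real.mul_rpow (x := (d : ℝ) * 2 ^ d) (by positivity)
      (by positivity), ← Real.rpow_natCast ((N : ℝ) + 1), ← Real.rpow_mul (by positivity),
      Nat.cast_sub hd, Nat.cast_one, mul_neg]
  have : 0 ≤ p - 1 := by linarith
  rw [hconst, inv_mul_le_iff₀ (by positivity)]
  refine (Real.rpow_sum_le_const_mul_sum_rpow _ θ hp.le).trans ?_
  gcongr
  exact card_boxBdry_le d N

lemma sum_sum_boxBdry_le {θ : Edge d → ℝ} (hs : Summable fun e => |θ e| ^ p) (I : Finset ℕ) :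
    ∑ N ∈ I, ∑ e ∈ boxBdry d N, |θ e| ^ p ≤ ∑' e, |θ e| ^ p := by
  classical
  rw [← Finset.sum_biUnion fun N _ M _ h => pairwise_disjoint_boxBdry d h]
  exact hs.sum_le_tsum _ fun _ _ => by positivity

/-- The partial sums `∑_{j=1}^n j^{-s}`; the `p`-resistance at distance `n` has the order of the
one with exponent `s = (d - 1) (p - 1)`. -/
noncomputable def partialZeta (s : ℝ) (n : ℕ) : ℝ := ∑ j ∈ Finset.range n, ((j : ℝ) + 1) ^ (-s)

lemma partialZeta_nonneg (s : ℝ) (n : ℕ) : 0 ≤ partialZeta s n :=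
  Finset.sum_nonneg fun _ _ => by positivity

lemma mul_partialZeta_le_tsum_rpow (hd : 1 ≤ d) (hp : 1 < p) {v : Vertex d} (hv : 0 ≠ v)
    {θ : Edge d → ℝ} (hθ : IsUnitFlow 0 v θ) (hs : Summable fun e => |θ e| ^ p) {M : ℕ}
    (hM : ∀ N < M, v ∉ box d N) :
    ((d : ℝ) * 2 ^ d) ^ (-(p - 1)) * partialZeta (((d : ℝ) - 1) * (p - 1)) M
      ≤ ∑' e, |θ e| ^ p := by
  refine le_trans ?_ (sum_sum_boxBdry_le hs (Finset.range M))
  rw [partialZeta, Finset.mul_sum]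
  refine Finset.sum_le_sum fun N hN => le_trans ?_ (mul_rpow_sum_boxBdry_le hd hp θ N)
  exact le_mul_of_one_le_right (by positivity) (Real.one_le_rpow
    (one_le_sum_boxBdry hv hθ (hM N (Finset.mem_range.1 hN))) (by linarith))

lemma exists_sum_boxBdry_lt (hd : 1 ≤ d) (hp : 1 < p) (hdp : ((d : ℝ) - 1) * p ≤ d)
    {θ : Edge d → ℝ} (hs : Summable fun e => |θ e| ^ p) {ε : ℝ} (hε : 0 < ε) (N₀ : ℕ) :
    ∃ N, N₀ ≤ N ∧ ∑ e ∈ boxBdry d N, |θ e| < ε := by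
  by_contra! hcon
  set s := ((d : ℝ) - 1) * (p - 1)
  set c := ((d : ℝ) * 2 ^ d) ^ (-(p - 1)) * ε ^ p with hc
  have hc0 : 0 < c := by
    have : (0 : ℝ) < d := by exact_mod_cast hd
    positivity
  have hflux : Summable fun n : ℕ => c * (((n + N₀ : ℕ) : ℝ) + 1) ^ (-s) := by
    refine summable_of_sum_range_le (c := ∑' e, |θ e| ^ p) (fun n => by positivity) fun n => ?_
    refine le_trans ?_ (sum_sum_boxBdry_le hs (Finset.Ico N₀ (N₀ + n)))
    rw [Finset.sum_Ico_eq_sum_range, Nat.add_sub_cancel_left]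
    refine Finset.sum_le_sum fun j _ => le_trans ?_ (mul_rpow_sum_boxBdry_le hd hp θ (N₀ + j))
    rw [hc, mul_right_comm, add_comm j N₀]
    gcongr
    exact hcon _ (Nat.le_add_right _ _)
  have hzeta : Summable fun n : ℕ => (n : ℝ) ^ (-s) := by
    rw [← summable_nat_add_iff (N₀ + 1)]
    refine ((summable_mul_left_iff hc0.ne').1 hflux).congr fun n => ?_
    push_cast [add_assoc]
    rfl
  rw [Real.summable_nat_rpow] at hzeta
  linarith

end Cutsets

section ProductFlow

variable {d : ℕ}

/-- The flow transporting the product of the masses `m j` to the product of the masses `m' j`, one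
coordinate at a time; `g j` is a one-dimensional flow from `m j` to `m' j`. -/
def prodFlow (g m m' : Fin d → ℤ → ℝ) (e : Edge d) : ℝ :=
  g e.2 (e.1 e.2) * (∏ j with j < e.2, m' j (e.1 j)) * ∏ j with e.2 < j, m j (e.1 j)

variable {g m m' : Fin d → ℤ → ℝ}

lemma outflow_prodFlow (h : ∀ j t, g j t - g j (t - 1) = m j t - m' j t) (x : Vertex d) :
    outflow (prodFlow g m m') x = ∏ j, m j (x j) - ∏ j, m' j (x j) := by
  have htelescope := Finset.prod_sub_ordered Finset.univ (fun j => m j (x j))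
    (fun j => m j (x j) - m' j (x j))
  simp only [sub_sub_cancel] at htelescope
  rw [htelescope, sub_sub_cancel, outflow]
  refine Finset.sum_congr rfl fun i _ => ?_
  have hlow : ∏ j with j < i, m' j (x j - basisVec i j) = ∏ j with j < i, m' j (x j) :=
    Finset.prod_congr rfl fun j hj => by
      rw [basisVec_of_ne (Finset.mem_filter.1 hj).2.ne, sub_zero]
  have hhigh : ∏ j with i < j, m j (x j - basisVec i j) = ∏ j with i < j, m j (x j) :=
    Finset.prod_congr rfl fun j hj => by
      rw [basisVec_of_ne (Finset.mem_filter.1 hj).2.ne', sub_zero]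
  simp only [prodFlow, Pi.sub_apply, basisVec_same, hlow, hhigh, ← h]
  ring

lemma card_lt_add_card_gt (i : Fin d) :
    (Finset.univ.filter (· < i)).card + (Finset.univ.filter (i < ·)).card = d - 1 := by
  rw [← Finset.card_union_of_disjoint (Finset.disjoint_filter.2 fun j _ h => h.not_gt),
    ← Finset.filter_or, Finset.filter_congr fun j _ => lt_or_lt_iff_ne, Finset.filter_ne',
    Finset.card_erase_of_mem (Finset.mem_univ i), Finset.card_univ, Fintype.card_fin]

lemma abs_prodFlow_le {γ β : ℝ} (hγ : ∀ j t, |g j t| ≤ γ) (hm : ∀ j t, |m j t| ≤ β)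
    (hm' : ∀ j t, |m' j t| ≤ β) (e : Edge d) : |prodFlow g m m' e| ≤ γ * β ^ (d - 1) := by
  have hγ0 : 0 ≤ γ := (abs_nonneg _).trans (hγ e.2 0)
  have hβ0 : 0 ≤ β := (abs_nonneg _).trans (hm e.2 0)
  rw [prodFlow, abs_mul, abs_mul, mul_assoc, ← card_lt_add_card_gt e.2, pow_add, Finset.abs_prod,
    Finset.abs_prod]
  gcongr
  · exact hγ _ _
  · exact (Finset.prod_le_prod (fun _ _ => abs_nonneg _) fun j _ => hm' j _).trans (by simp)
  · exact (Finset.prod_le_prod (fun _ _ => abs_nonneg _) fun j _ => hm j _).trans (by simp)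

lemma ne_zero_of_prodFlow_ne_zero {e : Edge d} (h : prodFlow g m m' e ≠ 0) (j : Fin d) :
    g j (e.1 j) ≠ 0 ∧ j = e.2 ∨ m' j (e.1 j) ≠ 0 ∧ j < e.2 ∨ m j (e.1 j) ≠ 0 ∧ e.2 < j := by
  rw [prodFlow, mul_ne_zero_iff, mul_ne_zero_iff, Finset.prod_ne_zero_iff,
    Finset.prod_ne_zero_iff] at h
  obtain ⟨⟨hg, hlow⟩, hhigh⟩ := h
  rcases lt_trichotomy j e.2 with hj | hj | hj
  · exact Or.inr (Or.inl ⟨hlow j (by simp [hj]), hj⟩)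
  · exact Or.inl ⟨hj ▸ hg, hj⟩
  · exact Or.inr (Or.inr ⟨hhigh j (by simp [hj]), hj⟩)

end ProductFlow

section Uniform

/-- The uniform density on the integer interval `[c, c + k)`. -/
noncomputable def unifDensity (c : ℤ) (k : ℕ) (t : ℤ) : ℝ :=
  if c ≤ t ∧ t < c + k then (k : ℝ)⁻¹ else 0

/-- The distribution function of the uniform law on `[c, c + k)`. -/
noncomputable def unifCdf (c : ℤ) (k : ℕ) (t : ℤ) : ℝ := max 0 (min 1 (((t : ℝ) - c + 1) / k))

variable {c c' t : ℤ} {k k' : ℕ}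

lemma unifCdf_of_lt (h : t < c) : unifCdf c k t = 0 := by
  have h1 : (t : ℝ) - c + 1 ≤ 0 := by exact_mod_cast (by omega : t - c + 1 ≤ 0)
  have h2 : ((t : ℝ) - c + 1) / k ≤ 0 := div_nonpos_of_nonpos_of_nonneg h1 (Nat.cast_nonneg _)
  rw [unifCdf, max_eq_left ((min_le_right _ _).trans h2)]

lemma unifCdf_of_ge (hk : 1 ≤ k) (h : c + k ≤ t + 1) : unifCdf c k t = 1 := by
  have hk0 : (0 : ℝ) < k := by exact_mod_cast hk
  have h1 : (k : ℝ) ≤ (t : ℝ) - c + 1 := by exact_mod_cast (by omega : (k : ℤ) ≤ t - c + 1)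
  rw [unifCdf, min_eq_left ((one_le_div hk0).2 h1), max_eq_right zero_le_one]

lemma unifCdf_of_mem (hk : 1 ≤ k) (h : c ≤ t + 1) (h' : t + 1 ≤ c + k) :
    unifCdf c k t = ((t : ℝ) - c + 1) / k := by
  have hk0 : (0 : ℝ) < k := by exact_mod_cast hk
  have h1 : (t : ℝ) - c + 1 ≤ k := by exact_mod_cast (by omega : t - c + 1 ≤ (k : ℤ))
  have h2 : (0 : ℝ) ≤ (t : ℝ) - c + 1 := by exact_mod_cast (by omega : 0 ≤ t - c + 1)
  rw [unifCdf, min_eq_right ((div_le_one hk0).2 h1), max_eq_right (by positivity)]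

lemma unifCdf_sub (hk : 1 ≤ k) (c t : ℤ) :
    unifCdf c k t - unifCdf c k (t - 1) = unifDensity c k t := by
  unfold unifDensity
  by_cases h1 : t < c
  · rw [unifCdf_of_lt h1, unifCdf_of_lt (by omega), if_neg (by omega), sub_zero]
  by_cases h2 : c + k ≤ t
  · rw [unifCdf_of_ge hk (by omega), unifCdf_of_ge hk (by omega), if_neg (by omega), sub_self]
  · rw [unifCdf_of_mem hk (by omega) (by omega), unifCdf_of_mem hk (by omega) (by omega),
      if_pos (by omega)]
    push_cast
    ring

lemma abs_unifDensity_le (c : ℤ) (k : ℕ) (t : ℤ) : |unifDensity c k t| ≤ (k : ℝ)⁻¹ := by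
  unfold unifDensity
  split_ifs
  · rw [abs_of_nonneg (by positivity)]
  · simp

lemma unifDensity_one (c t : ℤ) : unifDensity c 1 t = if t = c then 1 else 0 := by
  simp only [unifDensity, Nat.cast_one, inv_one]
  congr 1
  exact propext (by omega)

lemma mem_of_unifDensity_ne_zero (h : unifDensity c k t ≠ 0) : c ≤ t ∧ t < c + k :=
  of_not_not fun hc => h (if_neg hc)

lemma abs_unifCdf_sub_le_one (c c' : ℤ) (k k' : ℕ) (t : ℤ) :
    |unifCdf c k t - unifCdf c' k' t| ≤ 1 :=
  abs_sub_le_of_nonneg_of_le (le_max_left _ _) (max_le zero_le_one (min_le_left _ _))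
    (le_max_left _ _) (max_le zero_le_one (min_le_left _ _))

lemma mem_of_unifCdf_sub_ne_zero (hk : 1 ≤ k) (hk' : 1 ≤ k')
    (h : unifCdf c k t - unifCdf c' k' t ≠ 0) :
    min c c' ≤ t ∧ t + 1 < max (c + k) (c' + k') := by
  refine ⟨le_of_not_gt fun hlt => h ?_, lt_of_not_ge fun hge => h ?_⟩
  · rw [unifCdf_of_lt (by omega), unifCdf_of_lt (by omega), sub_self]
  · rw [unifCdf_of_ge hk (by omega), unifCdf_of_ge hk' (by omega), sub_self]

lemma abs_unifCdf_sub_succ_le (hk : 1 ≤ k) (c t : ℤ) :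
    |unifCdf c k t - unifCdf c (k + 1) t| ≤ (k : ℝ)⁻¹ := by
  by_cases hzero : unifCdf c k t - unifCdf c (k + 1) t = 0
  · rw [hzero, abs_zero]
    positivity
  obtain ⟨hlow, hhigh⟩ := mem_of_unifCdf_sub_ne_zero hk (Nat.le_add_left 1 k) hzero
  push_cast at hhigh
  rw [unifCdf_of_mem hk (by omega) (by omega),
    unifCdf_of_mem (by omega) (by omega) (by push_cast; omega)]
  have : (0 : ℝ) < k := by exact_mod_cast hk
  have : (t : ℝ) - c + 1 ≤ k := by exact_mod_cast (by omega : t - c + 1 ≤ (k : ℤ))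
  have : (0 : ℝ) ≤ (t : ℝ) - c + 1 := by exact_mod_cast (by omega : 0 ≤ t - c + 1)
  have hdiff : ((t : ℝ) - c + 1) / k - ((t : ℝ) - c + 1) / ((k + 1 : ℕ) : ℝ)
      = (k : ℝ)⁻¹ * (((t : ℝ) - c + 1) / (k + 1)) := by
    push_cast
    field_simp
    ring
  rw [hdiff, abs_of_nonneg (by positivity)]
  refine mul_le_of_le_one_right (by positivity) ?_
  rw [div_le_one (by positivity)]
  linarith

end Uniform

section CubeFlow

variable {d : ℕ}

/-- The uniform law on the cube of side `k` with lowest corner `c`. -/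
noncomputable def unifCube (c : Vertex d) (k : ℕ) (x : Vertex d) : ℝ :=
  ∏ j, unifDensity (c j) k (x j)

/-- The product flow from the uniform law on the cube of side `k` with lowest corner `c` to the
uniform law on the cube of side `k'` with lowest corner `c'`. -/
noncomputable def cubeFlow (c c' : Vertex d) (k k' : ℕ) : Edge d → ℝ :=
  prodFlow (fun j t => unifCdf (c j) k t - unifCdf (c' j) k' t)
    (fun j => unifDensity (c j) k) (fun j => unifDensity (c' j) k')

variable {c c' : Vertex d} {k k' : ℕ}

lemma unifCube_one (c : Vertex d) : unifCube c 1 = pointMass c := by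
  ext x
  simp only [unifCube, unifDensity_one, pointMass, Finset.prod_ite_zero, Finset.prod_const_one,
    Finset.mem_univ, true_imp_iff, funext_iff]

lemma outflow_cubeFlow (c c' : Vertex d) (hk : 1 ≤ k) (hk' : 1 ≤ k') (x : Vertex d) :
    outflow (cubeFlow c c' k k') x = unifCube c k x - unifCube c' k' x := by
  refine outflow_prodFlow (fun j t => ?_) x
  rw [← unifCdf_sub hk, ← unifCdf_sub hk']
  ring

lemma mem_of_cubeFlow_ne_zero (hk : 1 ≤ k) (hk' : 1 ≤ k') {e : Edge d}
    (h : cubeFlow c c' k k' e ≠ 0) (j : Fin d) :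
    min (c j) (c' j) ≤ e.1 j ∧ e.1 j < max (c j + k) (c' j + k') := by
  rcases ne_zero_of_prodFlow_ne_zero h j with ⟨h1, -⟩ | ⟨h1, -⟩ | ⟨h1, -⟩
  · have := mem_of_unifCdf_sub_ne_zero hk hk' h1
    omega
  · have := mem_of_unifDensity_ne_zero h1
    omega
  · have := mem_of_unifDensity_ne_zero h1
    omega

lemma abs_cubeFlow_le (c c' : Vertex d) (k : ℕ) (e : Edge d) :
    |cubeFlow c c' k k e| ≤ ((k : ℝ) ^ (d - 1))⁻¹ :=
  (abs_prodFlow_le (fun _ _ => abs_unifCdf_sub_le_one _ _ _ _ _)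
    (fun _ _ => abs_unifDensity_le _ _ _) (fun _ _ => abs_unifDensity_le _ _ _) e).trans_eq
    (by rw [one_mul, inv_pow])

lemma abs_cubeFlow_succ_le (hd : 1 ≤ d) (c : Vertex d) (hk : 1 ≤ k) (e : Edge d) :
    |cubeFlow c c k (k + 1) e| ≤ ((k : ℝ) ^ d)⁻¹ := by
  have : (0 : ℝ) < k := by exact_mod_cast hk
  refine (abs_prodFlow_le (fun j t => abs_unifCdf_sub_succ_le hk _ _)
    (fun j t => abs_unifDensity_le _ _ _)
    (fun j t => (abs_unifDensity_le _ _ _).trans ?_) e).trans_eq ?_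
  · gcongr
    omega
  · rw [← pow_succ', Nat.sub_add_cancel hd, inv_pow]

end CubeFlow

section PathFlow

variable {d : ℕ}

/-- The unit flow along the lattice path from `x` to `y` that adjusts the coordinates one after
the other. -/
noncomputable def pathFlow (x y : Vertex d) : Edge d → ℝ := cubeFlow x y 1 1

/-- The edges of the lattice path from `x` to `y` that adjusts the coordinates one after the
other. -/
noncomputable def pathEdges (x y : Vertex d) : Finset (Edge d) :=
  Finset.univ.biUnion fun i => (Finset.Ico (min (x i) (y i)) (max (x i) (y i))).image fun t =>
    (fun j => if j < i then y j else if j = i then t else x j, i)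

lemma outflow_pathFlow (x y z : Vertex d) :
    outflow (pathFlow x y) z = pointMass x z - pointMass y z := by
  rw [pathFlow, outflow_cubeFlow x y le_rfl le_rfl, unifCube_one, unifCube_one]

lemma abs_pathFlow_le_one (x y : Vertex d) (e : Edge d) : |pathFlow x y e| ≤ 1 :=
  (abs_cubeFlow_le x y 1 e).trans_eq (by simp)

lemma card_pathEdges_le (x y : Vertex d) : (pathEdges x y).card ≤ l1norm (x - y) := by
  refine Finset.card_biUnion_le.trans (Finset.sum_le_sum fun i _ => Finset.card_image_le.trans ?_)
  rw [Int.card_Ico, Pi.sub_apply]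
  omega

lemma pathFlow_eq_zero {x y : Vertex d} {e : Edge d} (he : e ∉ pathEdges x y) :
    pathFlow x y e = 0 := by
  by_contra hne
  have hcoord := ne_zero_of_prodFlow_ne_zero (show cubeFlow x y 1 1 e ≠ 0 from hne)
  simp only [unifDensity_one] at hcoord
  refine he (Finset.mem_biUnion.2 ⟨e.2, Finset.mem_univ _, Finset.mem_image.2 ⟨e.1 e.2, ?_, ?_⟩⟩)
  · rcases hcoord e.2 with ⟨h, -⟩ | ⟨-, h⟩ | ⟨-, h⟩
    · have := mem_of_unifCdf_sub_ne_zero le_rfl le_rfl h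
      rw [Finset.mem_Ico]
      omega
    · exact absurd h (lt_irrefl _)
    · exact absurd h (lt_irrefl _)
  · refine Prod.ext (funext fun j => ?_) rfl
    rcases hcoord j with ⟨-, h⟩ | ⟨hy, h⟩ | ⟨hx, h⟩
    · simp [h]
    · simpa [h, eq_comm] using hy
    · simpa [h.not_gt, h.ne', eq_comm] using hx

end PathFlow

section FlowEnergy

variable {d : ℕ} {p : ℝ}

lemma energy_one_le_sum_rpow (hp : 0 < p) {θ F : Edge d → ℝ} {A : Finset (Edge d)}
    (hA : ∀ e ∉ A, θ e = 0) (hF : ∀ e, |θ e| ≤ F e) :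
    energy p 1 θ ≤ ENNReal.ofReal (∑ e ∈ A, F e ^ p) := by
  rw [energy, tsum_eq_sum fun e he => by simp [hA e he, Real.zero_rpow hp.ne'],
    ← ENNReal.ofReal_sum_of_nonneg fun e _ => by simp only [Pi.one_apply]; positivity]
  refine ENNReal.ofReal_le_ofReal (Finset.sum_le_sum fun e _ => ?_)
  rw [Pi.one_apply, one_mul]
  exact Real.rpow_le_rpow (abs_nonneg _) (hF e) hp.le

lemma energy_neg (p : ℝ) (r θ : Edge d → ℝ) : energy p r (-θ) = energy p r θ := by
  simp [energy]

lemma energy_add_le (hp : 1 ≤ p) (r θ φ : Edge d → ℝ) :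
    energy p r (θ + φ) ≤ 2 ^ (p - 1) * (energy p r θ + energy p r φ) := by
  have hterm : ∀ (s : ℝ) (t : ℝ), ENNReal.ofReal (s * |t| ^ p)
      = ENNReal.ofReal s * ENNReal.ofReal |t| ^ p := fun s t => by
    rw [ENNReal.ofReal_mul' (by positivity),
      ENNReal.ofReal_rpow_of_nonneg (abs_nonneg t) (by linarith)]
  simp only [energy, ← ENNReal.tsum_add, ← ENNReal.tsum_mul_left, hterm, Pi.add_apply]
  refine ENNReal.tsum_le_tsum fun e => ?_
  rw [← mul_add, mul_left_comm]
  gcongr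
  refine le_trans ?_ (ENNReal.rpow_add_le_mul_rpow_add_rpow _ _ hp)
  rw [← ENNReal.ofReal_add (abs_nonneg _) (abs_nonneg _)]
  gcongr
  exact abs_add_le _ _

lemma energy_add_le_ofReal (hp : 1 ≤ p) {r θ φ : Edge d → ℝ} {B B' : ℝ} (hB : 0 ≤ B)
    (hB' : 0 ≤ B') (hθ : energy p r θ ≤ ENNReal.ofReal B)
    (hφ : energy p r φ ≤ ENNReal.ofReal B') :
    energy p r (θ + φ) ≤ ENNReal.ofReal (2 ^ (p - 1) * (B + B')) := by
  rw [ENNReal.ofReal_mul (by positivity), ENNReal.ofReal_add hB hB',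
    ← ENNReal.ofReal_rpow_of_pos two_pos, ENNReal.ofReal_ofNat]
  exact (energy_add_le hp r θ φ).trans (by gcongr)

lemma energy_pathFlow_le (hp : 0 < p) (x y : Vertex d) :
    energy p 1 (pathFlow x y) ≤ ENNReal.ofReal (l1norm (x - y)) := by
  refine (energy_one_le_sum_rpow hp (fun e => pathFlow_eq_zero)
    (abs_pathFlow_le_one x y)).trans (ENNReal.ofReal_le_ofReal ?_)
  simpa using card_pathEdges_le x y

lemma pow_mul_inv_pow_rpow {x : ℝ} (hx : 0 < x) (hd : 1 ≤ d) (p : ℝ) :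
    x ^ (d - 1) * ((x ^ (d - 1))⁻¹) ^ p = x ^ (-(((d : ℝ) - 1) * (p - 1))) := by
  rw [← Real.rpow_natCast, ← Real.rpow_neg hx.le, ← Real.rpow_mul hx.le, ← Real.rpow_add hx,
    Nat.cast_sub hd, Nat.cast_one]
  ring_nf

lemma rpow_le_partialZeta {s : ℝ} (hs : 0 ≤ s) {n : ℕ} (hn : 1 ≤ n) :
    (n : ℝ) ^ (1 - s) ≤ partialZeta s n := by
  have hn0 : (0 : ℝ) < n := by exact_mod_cast hn
  calc (n : ℝ) ^ (1 - s) = ∑ _j ∈ Finset.range n, (n : ℝ) ^ (-s) := by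
        rw [Finset.sum_const, Finset.card_range, nsmul_eq_mul, sub_eq_add_neg,
          Real.rpow_add hn0, Real.rpow_one]
    _ ≤ _ := Finset.sum_le_sum fun j hj => by
        refine Real.rpow_le_rpow_of_nonpos (by positivity) ?_ (by linarith)
        exact_mod_cast Finset.mem_range.1 hj

lemma energy_cubeFlow_le (hp : 1 < p) (hd : 1 ≤ d) {v : Vertex d} (hv : v ≠ 0) :
    energy p 1 (cubeFlow 0 v (l1norm v) (l1norm v))
      ≤ ENNReal.ofReal (d * 3 ^ d * partialZeta (((d : ℝ) - 1) * (p - 1)) (l1norm v)) := by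
  have hn := one_le_l1norm hv
  set n := l1norm v
  have hn0 : (0 : ℝ) < n := by exact_mod_cast hn
  set A : Finset (Vertex d) := Fintype.piFinset fun _ => Finset.Ico (-(n : ℤ)) (2 * n)
  have hA : ∀ e ∉ A ×ˢ (Finset.univ : Finset (Fin d)), cubeFlow 0 v n n e = 0 := by
    refine fun e => not_imp_comm.1 fun hne => Finset.mem_product.2
      ⟨Fintype.mem_piFinset.2 fun j => Finset.mem_Ico.2 ?_, Finset.mem_univ _⟩
    have := natAbs_le_l1norm v j
    have := mem_of_cubeFlow_ne_zero hn hn hne j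
    rw [Pi.zero_apply] at this
    omega
  have hcard : ((A ×ˢ (Finset.univ : Finset (Fin d))).card : ℝ) = d * (3 * n) ^ d := by
    rw [Finset.card_product, Fintype.card_piFinset]
    simp only [Int.card_Ico, Finset.prod_const, Finset.card_univ, Fintype.card_fin]
    rw [show (2 * (n : ℤ) - -(n : ℤ)).toNat = 3 * n by omega, mul_comm]
    push_cast
    rfl
  refine (energy_one_le_sum_rpow (by linarith) hA (abs_cubeFlow_le 0 v n)).trans
    (ENNReal.ofReal_le_ofReal ?_)
  have hrpow : (n : ℝ) ^ d * (((n : ℝ) ^ (d - 1))⁻¹) ^ p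
      = (n : ℝ) ^ (1 - ((d : ℝ) - 1) * (p - 1)) := by
    rw [sub_eq_add_neg, Real.rpow_add hn0, Real.rpow_one, ← pow_mul_inv_pow_rpow hn0 hd,
      ← mul_assoc, mul_pow_sub_one (by omega)]
  rw [Finset.sum_const, nsmul_eq_mul, hcard, mul_pow, ← mul_assoc, mul_assoc, hrpow]
  have : (1 : ℝ) ≤ d := by exact_mod_cast hd
  gcongr
  exact rpow_le_partialZeta (mul_nonneg (by linarith) (by linarith)) hn

end FlowEnergy

section SpreadFlow

variable {d : ℕ}

/-- The flow from a point to the uniform law on the cube of side `N` with that lowest corner. -/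
noncomputable def spreadFlow (c : Vertex d) (N : ℕ) : Edge d → ℝ :=
  ∑ k ∈ Finset.Ico 1 N, cubeFlow c c k (k + 1)

/-- The sup-distance to the corner `c`, for points above `c`. -/
noncomputable def cornerDist (c x : Vertex d) : ℕ := Finset.univ.sup fun j => (x j - c j).toNat

/-- The cube of side `N` with lowest corner `c`. -/
noncomputable def cornerCube (c : Vertex d) (N : ℕ) : Finset (Vertex d) :=
  Fintype.piFinset fun j => Finset.Ico (c j) (c j + N)

lemma outflow_spreadFlow (c : Vertex d) {N : ℕ} (hN : 1 ≤ N) (x : Vertex d) :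
    outflow (spreadFlow c N) x = pointMass c x - unifCube c N x := by
  rw [spreadFlow, outflow_sum, Finset.sum_congr rfl fun k hk =>
    outflow_cubeFlow c c (Finset.mem_Ico.1 hk).1 (Nat.le_add_left 1 k) x, ← unifCube_one,
    ← neg_sub, ← Finset.sum_Ico_sub (unifCube c · x) hN, ← Finset.sum_neg_distrib]
  simp only [neg_sub]

lemma mem_cornerCube {c x : Vertex d} {N : ℕ} :
    x ∈ cornerCube c N ↔ ∀ j, c j ≤ x j ∧ x j < c j + N := by
  simp [cornerCube]

lemma spreadFlow_eq_zero {c : Vertex d} {N : ℕ} {e : Edge d} (he : e.1 ∉ cornerCube c N) :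
    spreadFlow c N e = 0 := by
  refine (Finset.sum_apply _ _ _).trans (Finset.sum_eq_zero fun k hk => ?_)
  rw [Finset.mem_Ico] at hk
  by_contra hne
  refine he (mem_cornerCube.2 fun j => ?_)
  have := mem_of_cubeFlow_ne_zero hk.1 (Nat.le_add_left 1 k) hne j
  push_cast at this
  omega

lemma cornerDist_le_of_cubeFlow_ne_zero {c : Vertex d} {k : ℕ} (hk : 1 ≤ k) {e : Edge d}
    (h : cubeFlow c c k (k + 1) e ≠ 0) : cornerDist c e.1 ≤ k :=
  Finset.sup_le fun j _ => by
    have := mem_of_cubeFlow_ne_zero hk (Nat.le_add_left 1 k) h j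
    push_cast at this
    omega

lemma sum_inv_pow_le (hd : 2 ≤ d) (ρ N : ℕ) :
    ∑ k ∈ Finset.Ico 1 N with ρ ≤ k, ((k : ℝ) ^ d)⁻¹ ≤ 2 ^ d * (((ρ : ℝ) + 1) ^ (d - 1))⁻¹ := by
  obtain ⟨m, rfl⟩ : ∃ m, d = m + 2 := ⟨d - 2, by omega⟩
  have hterm : ∀ k ∈ {k ∈ Finset.Ico 1 N | ρ ≤ k},
      ((k : ℝ) ^ (m + 2))⁻¹ ≤ 2 ^ m * (((ρ : ℝ) + 1) ^ m)⁻¹ * ((k : ℝ) ^ 2)⁻¹ := fun k hk => by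
    rw [Finset.mem_filter, Finset.mem_Ico] at hk
    have : (0 : ℝ) < k := by exact_mod_cast hk.1.1
    have : (ρ : ℝ) + 1 ≤ 2 * k := by exact_mod_cast (by omega : ρ + 1 ≤ 2 * k)
    rw [pow_add, mul_inv, ← div_eq_mul_inv (2 ^ m), ← div_pow, ← inv_pow]
    gcongr
    rw [inv_le_comm₀ (by positivity) (by positivity), inv_div, div_le_iff₀ two_pos]
    linarith
  have hsq : ∑ k ∈ Finset.Ico 1 N with ρ ≤ k, ((k : ℝ) ^ 2)⁻¹ ≤ 4 * ((ρ : ℝ) + 1)⁻¹ :=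
    calc ∑ k ∈ Finset.Ico 1 N with ρ ≤ k, ((k : ℝ) ^ 2)⁻¹
        ≤ ∑ k ∈ Finset.Ioo (max 1 ρ - 1) N, ((k : ℝ) ^ 2)⁻¹ := by
          refine Finset.sum_le_sum_of_subset_of_nonneg (fun k hk => ?_) fun k _ _ => by positivity
          rw [Finset.mem_filter, Finset.mem_Ico] at hk
          rw [Finset.mem_Ioo]
          omega
      _ ≤ 2 / ((max 1 ρ - 1 : ℕ) + 1) := sum_Ioo_inv_sq_le _ _
      _ ≤ 4 * ((ρ : ℝ) + 1)⁻¹ := by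
          have : (ρ : ℝ) + 1 ≤ 2 * ((max 1 ρ - 1 : ℕ) + 1) := by
            exact_mod_cast (by omega : ρ + 1 ≤ 2 * (max 1 ρ - 1 + 1))
          rw [← div_eq_mul_inv, div_le_div_iff₀ (by positivity) (by positivity)]
          linarith
  calc ∑ k ∈ Finset.Ico 1 N with ρ ≤ k, ((k : ℝ) ^ (m + 2))⁻¹
      ≤ 2 ^ m * (((ρ : ℝ) + 1) ^ m)⁻¹ * ∑ k ∈ Finset.Ico 1 N with ρ ≤ k, ((k : ℝ) ^ 2)⁻¹ := by
        rw [Finset.mul_sum]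
        exact Finset.sum_le_sum hterm
    _ ≤ 2 ^ m * (((ρ : ℝ) + 1) ^ m)⁻¹ * (4 * ((ρ : ℝ) + 1)⁻¹) := by gcongr
    _ = 2 ^ (m + 2) * (((ρ : ℝ) + 1) ^ (m + 2 - 1))⁻¹ := by
        rw [show m + 2 - 1 = m + 1 from rfl, pow_succ ((ρ : ℝ) + 1), mul_inv]
        ring

/-- At distance `ρ` from the corner only the growth steps of side at least `ρ` contribute. -/
lemma abs_spreadFlow_le (hd : 2 ≤ d) (c : Vertex d) (N : ℕ) (e : Edge d) :
    |spreadFlow c N e| ≤ 2 ^ d * (((cornerDist c e.1 : ℝ) + 1) ^ (d - 1))⁻¹ := by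
  refine le_trans ?_ (sum_inv_pow_le hd (cornerDist c e.1) N)
  rw [spreadFlow, Finset.sum_apply, Finset.sum_filter]
  refine (Finset.abs_sum_le_sum_abs _ _).trans (Finset.sum_le_sum fun k hk => ?_)
  have hk1 := (Finset.mem_Ico.1 hk).1
  split_ifs with hρ
  · exact abs_cubeFlow_succ_le (by omega) c hk1 e
  · exact (abs_eq_zero.2 (of_not_not (mt (cornerDist_le_of_cubeFlow_ne_zero hk1) hρ))).le

lemma exists_cornerDist_eq (hd : 1 ≤ d) (c x : Vertex d) :
    ∃ i, cornerDist c x = (x i - c i).toNat := by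
  have : Nonempty (Fin d) := ⟨⟨0, hd⟩⟩
  obtain ⟨i, -, hi⟩ := Finset.exists_mem_eq_sup Finset.univ Finset.univ_nonempty
    fun j => (x j - c j).toNat
  exact ⟨i, hi⟩

lemma card_cornerDist_eq_le (hd : 1 ≤ d) (c : Vertex d) (N m : ℕ) :
    {x ∈ cornerCube c N | cornerDist c x = m}.card ≤ d * (m + 1) ^ (d - 1) := by
  classical
  have hsub : {x ∈ cornerCube c N | cornerDist c x = m} ⊆ Finset.univ.biUnion fun i =>
      Fintype.piFinset (Function.update (fun j => Finset.Icc (c j) (c j + m)) i {c i + m}) := by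
    intro x hx
    obtain ⟨hcube, rfl⟩ := Finset.mem_filter.1 hx
    rw [mem_cornerCube] at hcube
    obtain ⟨i, hi⟩ := exists_cornerDist_eq hd c x
    refine Finset.mem_biUnion.2 ⟨i, Finset.mem_univ i, mem_piFinset_update_singleton.2
      ⟨?_, fun j _ => Finset.mem_Icc.2 ?_⟩⟩
    · have := hcube i
      omega
    · have := hcube j
      have : (x j - c j).toNat ≤ cornerDist c x :=
        Finset.le_sup (f := fun j => (x j - c j).toNat) (Finset.mem_univ j)
      omega
  refine (Finset.card_le_card hsub).trans ((Finset.card_biUnion_le_card_mul _ _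
    ((m + 1) ^ (d - 1)) fun i _ => ?_).trans (by simp))
  rw [card_piFinset_update_singleton (K := m + 1) fun j => by rw [Int.card_Icc]; omega]

lemma sum_cornerCube_le (hd : 1 ≤ d) (c : Vertex d) (N : ℕ) {φ : ℕ → ℝ} (hφ : ∀ m, 0 ≤ φ m) :
    ∑ x ∈ cornerCube c N, φ (cornerDist c x)
      ≤ ∑ m ∈ Finset.range N, d * ((m : ℝ) + 1) ^ (d - 1) * φ m := by
  have hmaps : ∀ x ∈ cornerCube c N, cornerDist c x ∈ Finset.range N := fun x hx => by
    obtain ⟨i, hi⟩ := exists_cornerDist_eq hd c x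
    have := mem_cornerCube.1 hx i
    rw [Finset.mem_range]
    omega
  rw [← Finset.sum_fiberwise_of_maps_to' hmaps φ]
  refine Finset.sum_le_sum fun m _ => ?_
  rw [Finset.sum_const, nsmul_eq_mul]
  refine mul_le_mul_of_nonneg_right ?_ (hφ m)
  exact_mod_cast card_cornerDist_eq_le hd c N m

lemma energy_spreadFlow_le {p : ℝ} (hp : 0 < p) (hd : 2 ≤ d) (c : Vertex d) (N : ℕ) :
    energy p 1 (spreadFlow c N)
      ≤ ENNReal.ofReal (d ^ 2 * (2 ^ d) ^ p * partialZeta (((d : ℝ) - 1) * (p - 1)) N) := by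
  have hsupp : ∀ e ∉ cornerCube c N ×ˢ (Finset.univ : Finset (Fin d)), spreadFlow c N e = 0 :=
    fun e he => spreadFlow_eq_zero (by simpa using he)
  refine (energy_one_le_sum_rpow hp hsupp (abs_spreadFlow_le hd c N)).trans
    (ENNReal.ofReal_le_ofReal ?_)
  simp only [Finset.sum_product_right, Finset.sum_const, Finset.card_univ, Fintype.card_fin,
    nsmul_eq_mul]
  refine (mul_le_mul_of_nonneg_left (sum_cornerCube_le (by omega) c N
    (φ := fun m => (2 ^ d * (((m : ℝ) + 1) ^ (d - 1))⁻¹) ^ p) fun m => by positivity)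
    (Nat.cast_nonneg d)).trans_eq ?_
  rw [partialZeta, Finset.mul_sum, Finset.mul_sum]
  refine Finset.sum_congr rfl fun m _ => ?_
  rw [← pow_mul_inv_pow_rpow (by positivity) (by omega),
    Real.mul_rpow (by positivity) (by positivity)]
  ring

/-- There are unit flows whose energy has the order of `∑_{j ≤ |v|} j^{-(d-1)(p-1)}`: in dimension
at least two, spread the mass out over a cube of side `|v|`, translate, and gather it again. -/
theorem exists_isUnitFlow_energy_le {p : ℝ} (hp : 1 < p) (hd : 1 ≤ d) :
    ∃ C : ℝ, 0 < C ∧ ∀ v : Vertex d, v ≠ 0 → ∃ θ, IsUnitFlow 0 v θ ∧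
      energy p 1 θ
        ≤ ENNReal.ofReal (C * partialZeta (((d : ℝ) - 1) * (p - 1)) (l1norm v)) := by
  have hp0 : 0 < p := by linarith
  rcases hd.eq_or_lt with rfl | hd2
  · refine ⟨1, one_pos, fun v hv => ⟨pathFlow 0 v,
      (isUnitFlow_iff hv.symm).2 (outflow_pathFlow 0 v), (energy_pathFlow_le hp0 _ _).trans ?_⟩⟩
    simp [partialZeta, l1norm]
  · have : (0 : ℝ) < d := by exact_mod_cast hd
    set K := (d : ℝ) ^ 2 * (2 ^ d) ^ p
    set L := (d : ℝ) * 3 ^ d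
    refine ⟨2 ^ (p - 1) * (2 ^ (p - 1) * (K + L) + K), by positivity, fun v hv => ?_⟩
    have hv1 := one_le_l1norm hv
    set n := l1norm v
    set Z := partialZeta (((d : ℝ) - 1) * (p - 1)) n
    have hZ : 0 ≤ Z := partialZeta_nonneg _ _
    refine ⟨(spreadFlow 0 n + cubeFlow 0 v n n) + -spreadFlow v n,
      (isUnitFlow_iff hv.symm).2 fun z => ?_, ?_⟩
    · rw [outflow_add, outflow_add, outflow_neg, outflow_spreadFlow _ hv1, outflow_spreadFlow _ hv1,
        outflow_cubeFlow _ _ hv1 hv1]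
      ring
    · have hspread : energy p 1 (spreadFlow 0 n) ≤ ENNReal.ofReal (K * Z) :=
        energy_spreadFlow_le hp0 hd2 0 n
      have hslide : energy p 1 (cubeFlow 0 v n n) ≤ ENNReal.ofReal (L * Z) :=
        energy_cubeFlow_le hp hd hv
      have hgather : energy p 1 (-spreadFlow v n) ≤ ENNReal.ofReal (K * Z) :=
        (energy_neg p 1 _).trans_le (energy_spreadFlow_le hp0 hd2 v n)
      refine (energy_add_le_ofReal hp.le (by positivity) (by positivity)
        (energy_add_le_ofReal hp.le (by positivity) (by positivity)
          hspread hslide) hgather).trans_eq (congrArg ENNReal.ofReal ?_)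
      ring

end SpreadFlow

section Minimizers

variable {d : ℕ} {p a b : ℝ} {r : Edge d → ℝ} {x y : Vertex d} {θ : Edge d → ℝ}

lemma mul_abs_rpow_nonneg (hr : ∀ e, 0 ≤ r e) (θ : Edge d → ℝ) (p : ℝ) (e : Edge d) :
    0 ≤ r e * |θ e| ^ p :=
  mul_nonneg (hr e) (Real.rpow_nonneg (abs_nonneg _) _)

lemma energy_eq_ofReal (hr : ∀ e, 0 ≤ r e) (hs : Summable fun e => r e * |θ e| ^ p) :
    energy p r θ = ENNReal.ofReal (∑' e, r e * |θ e| ^ p) :=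
  (ENNReal.ofReal_tsum_of_nonneg (mul_abs_rpow_nonneg hr θ p) hs).symm

lemma summable_of_energy_ne_top (hr : ∀ e, 0 ≤ r e) (h : energy p r θ ≠ ⊤) :
    Summable fun e => r e * |θ e| ^ p :=
  (ENNReal.summable_toReal h).congr fun e => ENNReal.toReal_ofReal (mul_abs_rpow_nonneg hr θ p e)

lemma summable_rpow_of_energy_ne_top (ha : 0 < a) (hr : ∀ e, a ≤ r e) (h : energy p r θ ≠ ⊤) :
    Summable fun e => |θ e| ^ p := by
  refine Summable.of_nonneg_of_le (fun e => Real.rpow_nonneg (abs_nonneg _) _) (fun e => ?_)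
    ((summable_of_energy_ne_top (fun e => ha.le.trans (hr e)) h).mul_left a⁻¹)
  rw [← mul_assoc]
  refine le_mul_of_one_le_left (Real.rpow_nonneg (abs_nonneg _) _) ?_
  rw [inv_mul_eq_div, one_le_div ha]
  exact hr e

lemma energy_mono {r' : Edge d → ℝ} (h : ∀ e, r e ≤ r' e) : energy p r θ ≤ energy p r' θ :=
  ENNReal.tsum_le_tsum fun e => ENNReal.ofReal_le_ofReal
    (mul_le_mul_of_nonneg_right (h e) (Real.rpow_nonneg (abs_nonneg _) _))

lemma energy_const (hb : 0 ≤ b) :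
    energy p (fun _ => b) θ = ENNReal.ofReal b * energy p 1 θ := by
  rw [energy, energy, ← ENNReal.tsum_mul_left]
  exact tsum_congr fun e => by rw [Pi.one_apply, one_mul, ENNReal.ofReal_mul hb]

lemma abs_le_of_energy_le (hp : 1 < p) (ha : 0 < a) (hr : ∀ e, a ≤ r e) {B : ℝ} (hB : 0 ≤ B)
    (h : energy p r θ ≤ ENNReal.ofReal B) (e : Edge d) : |θ e| ≤ (B / a) ^ p⁻¹ := by
  have hnn := Real.rpow_nonneg (abs_nonneg (θ e)) p
  have hterm : r e * |θ e| ^ p ≤ B :=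
    (ENNReal.ofReal_le_ofReal_iff hB).1 ((ENNReal.le_tsum e).trans h)
  have hpow : |θ e| ^ p ≤ B / a := by
    rw [le_div_iff₀' ha]
    exact (mul_le_mul_of_nonneg_right (hr e) hnn).trans hterm
  calc |θ e| = (|θ e| ^ p) ^ p⁻¹ := (Real.rpow_rpow_inv (abs_nonneg _) (by linarith)).symm
    _ ≤ (B / a) ^ p⁻¹ := Real.rpow_le_rpow hnn hpow (by positivity)

lemma continuous_outflow (z : Vertex d) : Continuous fun θ : Edge d → ℝ => outflow θ z := by
  unfold outflow
  fun_prop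

lemma isClosed_setOf_isUnitFlow (x y : Vertex d) :
    IsClosed {θ : Edge d → ℝ | IsUnitFlow x y θ} := by
  have heq : {θ : Edge d → ℝ | IsUnitFlow x y θ} = {θ | ∀ z, z ≠ x → z ≠ y → outflow θ z = 0}
      ∩ ({θ | outflow θ x = 1} ∩ {θ | -outflow θ y = 1}) :=
    Set.ext fun θ => ⟨fun h => ⟨h.1, h.2, h.3⟩, fun h => ⟨h.1, h.2.1, h.2.2⟩⟩
  rw [heq]
  refine IsClosed.inter ?_ ((isClosed_eq (continuous_outflow _) continuous_const).inter
    (isClosed_eq (continuous_outflow _).neg continuous_const))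
  simp only [Set.ofPred_forall]
  exact isClosed_iInter fun z => isClosed_iInter fun _ => isClosed_iInter fun _ =>
    isClosed_eq (continuous_outflow _) continuous_const

lemma lowerSemicontinuous_energy (hp : 0 ≤ p) {X : Type*} [TopologicalSpace X]
    {R Θ : X → Edge d → ℝ} (hR : Continuous R) (hΘ : Continuous Θ) :
    LowerSemicontinuous fun q => energy p (R q) (Θ q) := by
  refine lowerSemicontinuous_tsum fun e => Continuous.lowerSemicontinuous ?_
  refine ENNReal.continuous_ofReal.comp (((continuous_apply e).comp hR).mul ?_)
  exact ((continuous_apply e).comp hΘ).abs.rpow_const fun _ => Or.inr hp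

/-- The unit flows from `x` to `y` with all values in `[-M, M]`. Every flow competing for minimal
energy lies in such a set, which is compact. -/
def boundedFlows (x y : Vertex d) (M : ℝ) : Set (Edge d → ℝ) :=
  {θ | IsUnitFlow x y θ} ∩ Set.univ.pi fun _ => Set.Icc (-M) M

lemma isCompact_boundedFlows (x y : Vertex d) (M : ℝ) : IsCompact (boundedFlows x y M) :=
  (isCompact_univ_pi fun _ => isCompact_Icc).inter_left (isClosed_setOf_isUnitFlow x y)

/-- A unit flow of finite and minimal energy. -/
structure IsMinFlow (p : ℝ) (r : Edge d → ℝ) (x y : Vertex d) (θ : Edge d → ℝ) : Prop where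
  isUnitFlow : IsUnitFlow x y θ
  ne_top : energy p r θ ≠ ⊤
  le : ∀ θ', IsUnitFlow x y θ' → energy p r θ ≤ energy p r θ'

lemma IsMinFlow.iInf_eq (h : IsMinFlow p r x y θ) :
    (⨅ θ : {θ : Edge d → ℝ // IsUnitFlow x y θ}, energy p r θ.1) = energy p r θ :=
  le_antisymm (iInf_le_of_le ⟨θ, h.isUnitFlow⟩ le_rfl) (le_iInf fun θ' => h.le θ'.1 θ'.2)

lemma IsMinFlow.ofReal_resistance (h : IsMinFlow p r x y θ) :
    ENNReal.ofReal (resistance p r x y) = energy p r θ := by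
  rw [resistance, h.iInf_eq, ENNReal.ofReal_toReal h.ne_top]

lemma IsMinFlow.resistance_eq (hr : ∀ e, 0 ≤ r e) (h : IsMinFlow p r x y θ) :
    resistance p r x y = ∑' e, r e * |θ e| ^ p := by
  rw [resistance, h.iInf_eq, energy_eq_ofReal hr (summable_of_energy_ne_top hr h.ne_top),
    ENNReal.toReal_ofReal (tsum_nonneg (mul_abs_rpow_nonneg hr θ p))]

lemma resistance_nonneg (p : ℝ) (r : Edge d → ℝ) (x y : Vertex d) : 0 ≤ resistance p r x y :=
  ENNReal.toReal_nonneg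

lemma resistance_le_of_energy_le {B : ℝ} (hB : 0 ≤ B) (hθ : IsUnitFlow x y θ)
    (h : energy p r θ ≤ ENNReal.ofReal B) : resistance p r x y ≤ B :=
  ENNReal.toReal_le_of_le_ofReal hB (iInf_le_of_le ⟨θ, hθ⟩ h)

/-- An a priori bound on the values of flows from `x` to `y` of minimal energy. -/
noncomputable def flowBound (p a b : ℝ) (x y : Vertex d) : ℝ :=
  (b * l1norm (x - y) / a) ^ p⁻¹

lemma energy_pathFlow_le_of_le (hp : 0 < p) (hb : 0 ≤ b) (hr : ∀ e, r e ≤ b) :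
    energy p r (pathFlow x y) ≤ ENNReal.ofReal (b * l1norm (x - y)) := by
  refine (energy_mono hr).trans ?_
  rw [energy_const hb, ENNReal.ofReal_mul hb]
  gcongr
  exact energy_pathFlow_le hp x y

lemma mem_boundedFlows_of_energy_le (hp : 1 < p) (ha : 0 < a) (hb : 0 ≤ b)
    (hr : ∀ e, a ≤ r e) (hθ : IsUnitFlow x y θ)
    (h : energy p r θ ≤ ENNReal.ofReal (b * l1norm (x - y))) :
    θ ∈ boundedFlows x y (flowBound p a b x y) :=
  ⟨hθ, fun e _ => abs_le.1 (abs_le_of_energy_le hp ha hr (by positivity) h e)⟩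

lemma exists_isMinFlow (hp : 1 < p) (ha : 0 < a) (hr : ∀ e, a ≤ r e ∧ r e ≤ b) (hxy : x ≠ y) :
    ∃ θ ∈ boundedFlows x y (flowBound p a b x y), IsMinFlow p r x y θ := by
  have hb : 0 ≤ b := by
    obtain ⟨j, -⟩ := Function.ne_iff.1 hxy
    exact ha.le.trans ((hr (0, j)).1.trans (hr (0, j)).2)
  have hunit := (isUnitFlow_iff hxy).2 (outflow_pathFlow x y)
  have hpath := energy_pathFlow_le_of_le (x := x) (y := y) (zero_lt_one.trans hp) hb
    fun e => (hr e).2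
  have hmem := mem_boundedFlows_of_energy_le hp ha hb (fun e => (hr e).1) hunit hpath
  obtain ⟨θ, hθ, hmin⟩ := LowerSemicontinuousOn.exists_isMinOn ⟨_, hmem⟩
    (isCompact_boundedFlows x y _)
    ((lowerSemicontinuous_energy (p := p) (R := fun _ => r) (by linarith) continuous_const
      continuous_id).lowerSemicontinuousOn _)
  have hle : energy p r θ ≤ energy p r (pathFlow x y) := hmin hmem
  refine ⟨θ, hθ, hθ.1, ne_top_of_le_ne_top ENNReal.ofReal_ne_top (hle.trans hpath),
    fun θ' hθ' => ?_⟩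
  by_cases h : energy p r θ' ≤ energy p r (pathFlow x y)
  · exact hmin (mem_boundedFlows_of_energy_le hp ha hb (fun e => (hr e).1) hθ' (h.trans hpath))
  · exact hle.trans (not_le.1 h).le

lemma energy_le_energy_add (hp : 0 ≤ p) (hb : 0 ≤ b) (hr : ∀ e, r e ≤ b) {φ : Edge d → ℝ}
    {B : Finset (Edge d)} {K : ℝ} (hB : ∀ e ∈ B, |φ e| ≤ K) (hout : ∀ e ∉ B, φ e = θ e) :
    energy p r φ ≤ energy p r θ + ENNReal.ofReal (b * K ^ p * B.card) := by
  classical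
  have hterm : ∀ e, ENNReal.ofReal (r e * |φ e| ^ p) ≤ ENNReal.ofReal (r e * |θ e| ^ p)
      + if e ∈ B then ENNReal.ofReal (b * K ^ p) else 0 := fun e => by
    by_cases he : e ∈ B
    · rw [if_pos he]
      refine le_add_left (ENNReal.ofReal_le_ofReal ?_)
      exact mul_le_mul (hr e) (Real.rpow_le_rpow (abs_nonneg _) (hB e he) hp)
        (Real.rpow_nonneg (abs_nonneg _) _) hb
    · rw [if_neg he, add_zero, hout e he]
  refine (ENNReal.tsum_le_tsum hterm).trans_eq ?_
  rw [ENNReal.tsum_add, tsum_eq_sum (s := B) fun e he => if_neg he, Finset.sum_ite_mem,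
    Finset.inter_self, Finset.sum_const, nsmul_eq_mul, mul_comm (b * K ^ p),
    ENNReal.ofReal_mul (Nat.cast_nonneg _), ENNReal.ofReal_natCast]
  rfl

end Minimizers

section Potential

variable {d : ℕ} {p a b : ℝ} {r : Edge d → ℝ} {x y : Vertex d} {θ : Edge d → ℝ}

/-- The nonlinear Ohm law: the potential difference that drives the flow `θ` through `e`. -/
noncomputable def voltage (p : ℝ) (r θ : Edge d → ℝ) (e : Edge d) : ℝ :=
  r e * (|θ e| ^ (p - 2) * θ e)

lemma mul_voltage (hp : 1 < p) (e : Edge d) : θ e * voltage p r θ e = r e * |θ e| ^ p := by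
  have hpow : |θ e| ^ (p - 2) * θ e ^ 2 = |θ e| ^ p := by
    rcases eq_or_ne (θ e) 0 with h | h
    · simp [h, Real.zero_rpow (by linarith : p ≠ 0)]
    · rw [← sq_abs, ← Real.rpow_natCast, ← Real.rpow_add (abs_pos.2 h)]
      congr 1
      norm_num
  rw [← hpow, voltage]
  ring

lemma abs_voltage (hp : 1 < p) (hr : ∀ e, 0 ≤ r e) (e : Edge d) :
    |voltage p r θ e| = r e * |θ e| ^ (p - 1) := by
  rw [voltage, abs_mul, abs_of_nonneg (hr e), abs_mul,
    abs_of_nonneg (Real.rpow_nonneg (abs_nonneg _) _)]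
  rcases eq_or_ne (θ e) 0 with h | h
  · simp [h, Real.zero_rpow (by linarith : p - 1 ≠ 0)]
  · rw [← Real.rpow_add_one (abs_pos.2 h).ne']
    congr 2
    ring

lemma IsMinFlow.sum_le_sum_add (hr : ∀ e, 0 ≤ r e) (hxy : x ≠ y) (h : IsMinFlow p r x y θ)
    {η : Edge d → ℝ} {A : Finset (Edge d)} (hη : ∀ e ∉ A, η e = 0) (h0 : ∀ z, outflow η z = 0) :
    ∑ e ∈ A, r e * |θ e| ^ p ≤ ∑ e ∈ A, r e * |θ e + η e| ^ p := by
  have hunit : IsUnitFlow x y (θ + η) := (isUnitFlow_iff hxy).2 fun z => by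
    rw [outflow_add, h0, add_zero, (isUnitFlow_iff hxy).1 h.isUnitFlow]
  have hsum := summable_of_energy_ne_top hr h.ne_top
  have hdiff : ∀ e ∉ A, r e * |(θ + η) e| ^ p - r e * |θ e| ^ p = 0 := fun e he => by
    rw [Pi.add_apply, hη e he, add_zero, sub_self]
  have hsum' : Summable fun e => r e * |(θ + η) e| ^ p := by
    simpa using hsum.add (summable_of_ne_finset_zero hdiff)
  have hle := h.le _ hunit
  rwa [energy_eq_ofReal hr hsum, energy_eq_ofReal hr hsum', ENNReal.ofReal_le_ofReal_iff
    (tsum_nonneg (mul_abs_rpow_nonneg hr _ p)), ← sub_nonneg, ← hsum'.tsum_sub hsum,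
    tsum_eq_sum hdiff, Finset.sum_sub_distrib, sub_nonneg] at hle

/-- The Euler–Lagrange equation: perturbing a minimal flow by `t • η` does not change the energy to
first order in `t`. -/
lemma IsMinFlow.sum_voltage_mul_eq_zero (hp : 1 < p) (hr : ∀ e, 0 ≤ r e) (hxy : x ≠ y)
    (h : IsMinFlow p r x y θ) {η : Edge d → ℝ} {A : Finset (Edge d)} (hη : ∀ e ∉ A, η e = 0)
    (h0 : ∀ z, outflow η z = 0) : ∑ e ∈ A, voltage p r θ e * η e = 0 := by
  let G : ℝ → ℝ := fun t => ∑ e ∈ A, r e * |θ e + t * η e| ^ p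
  have hmin : ∀ t, G 0 ≤ G t := fun t => by
    simpa [G] using h.sum_le_sum_add (η := t • η) hr hxy (fun e he => by simp [hη e he])
      fun z => by rw [outflow_smul, h0, mul_zero]
  have hline : ∀ e, HasDerivAt (fun t => θ e + t * η e) (η e) 0 := fun e => by
    simpa using ((hasDerivAt_id (0 : ℝ)).mul_const (η e)).const_add (θ e)
  have hder : HasDerivAt G (∑ e ∈ A, r e * (p * |θ e| ^ (p - 2) * θ e * η e)) 0 :=
    HasDerivAt.fun_sum fun e _ => HasDerivAt.const_mul _ <| by
      simpa [Function.comp_def] using (hasDerivAt_abs_rpow (θ e + 0 * η e) hp).comp 0 (hline e)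
  have hzero := IsLocalMin.hasDerivAt_eq_zero (Eventually.of_forall hmin) hder
  have hfactor : ∑ e ∈ A, r e * (p * |θ e| ^ (p - 2) * θ e * η e)
      = p * ∑ e ∈ A, voltage p r θ e * η e := by
    rw [Finset.mul_sum]
    exact Finset.sum_congr rfl fun e _ => by rw [voltage]; ring
  exact (mul_eq_zero.1 (hfactor ▸ hzero)).resolve_left (by linarith)

/-- The voltage of `θ` summed along a path to the origin; for minimal flows the choice of the path
is immaterial, see `IsMinFlow.potential_sub_potential`. -/
noncomputable def potential (p : ℝ) (r θ : Edge d → ℝ) (z : Vertex d) : ℝ :=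
  ∑ e ∈ pathEdges z 0, voltage p r θ e * pathFlow z 0 e

lemma IsMinFlow.potential_sub_potential (hp : 1 < p) (hr : ∀ e, 0 ≤ r e) (hxy : x ≠ y)
    (h : IsMinFlow p r x y θ) {z w : Vertex d} {η : Edge d → ℝ} {A : Finset (Edge d)}
    (hη : ∀ e ∉ A, η e = 0) (ho : ∀ q, outflow η q = pointMass z q - pointMass w q) :
    potential p r θ z - potential p r θ w = ∑ e ∈ A, voltage p r θ e * η e := by
  classical
  set B := A ∪ (pathEdges z 0 ∪ pathEdges w 0)
  have hpot : ∀ q, pathEdges q 0 ⊆ B →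
      potential p r θ q = ∑ e ∈ B, voltage p r θ e * pathFlow q 0 e := fun q hq =>
    Finset.sum_subset hq fun e _ he => by rw [pathFlow_eq_zero he, mul_zero]
  have hsum : ∑ e ∈ A, voltage p r θ e * η e = ∑ e ∈ B, voltage p r θ e * η e :=
    Finset.sum_subset Finset.subset_union_left fun e _ he => by rw [hη e he, mul_zero]
  have hzero := h.sum_voltage_mul_eq_zero (A := B) (η := pathFlow z 0 - pathFlow w 0 - η) hp hr hxy
    (fun e he => by
      simp only [B, Finset.mem_union, not_or] at he
      simp [hη e he.1, pathFlow_eq_zero he.2.1, pathFlow_eq_zero he.2.2])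
    fun q => by
      rw [outflow_sub, outflow_sub, outflow_pathFlow, outflow_pathFlow, ho]
      ring
  simp only [Pi.sub_apply, mul_sub, Finset.sum_sub_distrib] at hzero
  rw [hpot z (Finset.subset_union_left.trans Finset.subset_union_right),
    hpot w (Finset.subset_union_right.trans Finset.subset_union_right), hsum]
  linarith

lemma outflow_single (e : Edge d) (z : Vertex d) :
    outflow (Pi.single e 1) z = pointMass e.1 z - pointMass e.head z := by
  obtain ⟨x, i⟩ := e
  rw [outflow, Finset.sum_eq_single i]
  · simp only [pointMass, Pi.single_apply, Prod.mk.injEq, and_true, sub_eq_iff_eq_add]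
    rw [← sub_eq_add_neg]
    rfl
  · intro j _ hj
    simp [hj]
  · simp

lemma IsMinFlow.potentialDrop_potential (hp : 1 < p) (hr : ∀ e, 0 ≤ r e) (hxy : x ≠ y)
    (h : IsMinFlow p r x y θ) (e : Edge d) :
    potentialDrop (potential p r θ) e = voltage p r θ e := by
  classical
  rw [potentialDrop, h.potential_sub_potential (A := {e}) hp hr hxy
    (fun e' he' => Pi.single_eq_of_ne (by simpa using he') 1) (outflow_single e)]
  simp

lemma IsMinFlow.mul_potentialDrop_comp_nonneg (hp : 1 < p) (hr : ∀ e, 0 ≤ r e) (hxy : x ≠ y)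
    (h : IsMinFlow p r x y θ) {f : ℝ → ℝ} (hf : Monotone f) (e : Edge d) :
    0 ≤ θ e * potentialDrop (fun z => f (potential p r θ z)) e := by
  have hv : potential p r θ e.1 - potential p r θ e.head = r e * |θ e| ^ (p - 2) * θ e :=
    (h.potentialDrop_potential hp hr hxy e).trans (mul_assoc _ _ _).symm
  have hc : 0 ≤ r e * |θ e| ^ (p - 2) := mul_abs_rpow_nonneg hr θ (p - 2) e
  rcases le_total 0 (θ e) with hθ | hθ
  · exact mul_nonneg hθ (sub_nonneg.2 (hf (sub_nonneg.1 (hv ▸ mul_nonneg hc hθ))))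
  · exact mul_nonneg_of_nonpos_of_nonpos hθ
      (sub_nonpos.2 (hf (sub_nonpos.1 (hv ▸ mul_nonpos_of_nonneg_of_nonpos hc hθ))))

lemma eventually_subset_box (S : Finset (Vertex d)) : ∀ᶠ N in atTop, S ⊆ box d N :=
  (eventually_ge_atTop (S.sup l1norm)).mono fun _ hN _ hz =>
    mem_box_of_l1norm_le ((Finset.le_sup hz).trans hN)

/-- The potential truncated to `[α, β]`, tested against the flow, sees the energy of the edges whose
endpoints have potentials in `[α, β]`; when `(d - 1) p ≤ d` the flux at infinity is negligible. -/
lemma IsMinFlow.sum_le_of_potential_mem_Icc (hd : 1 ≤ d) (hp : 1 < p)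
    (hdp : ((d : ℝ) - 1) * p ≤ d) (ha : 0 < a) (hr : ∀ e, a ≤ r e) (hxy : x ≠ y)
    (h : IsMinFlow p r x y θ) {α β : ℝ} (hαβ : α ≤ β) {A : Finset (Edge d)}
    (hA : ∀ e ∈ A, potential p r θ e.1 ∈ Set.Icc α β ∧ potential p r θ e.head ∈ Set.Icc α β) :
    ∑ e ∈ A, r e * |θ e| ^ p ≤ β - α := by
  classical
  have hr0 : ∀ e, 0 ≤ r e := fun e => ha.le.trans (hr e)
  let f : ℝ → ℝ := fun s => Set.projIcc α β hαβ s - α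
  let k : Vertex d → ℝ := fun z => f (potential p r θ z)
  have hk0 : ∀ z, 0 ≤ k z := fun z => sub_nonneg.2 (Set.projIcc α β hαβ _).2.1
  have hkK : ∀ z, k z ≤ β - α := fun z => sub_le_sub_right (Set.projIcc α β hαβ _).2.2 α
  have hmono : Monotone f := fun s t hst =>
    sub_le_sub_right (Subtype.coe_le_coe.2 (Set.monotone_projIcc hαβ hst)) α
  have henergy : ∑ e ∈ A, θ e * potentialDrop k e = ∑ e ∈ A, r e * |θ e| ^ p := by
    refine Finset.sum_congr rfl fun e he => ?_
    rw [← mul_voltage hp e, ← h.potentialDrop_potential hp hr0 hxy e]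
    simp only [potentialDrop, k, f, Set.projIcc_of_mem hαβ (hA e he).1,
      Set.projIcc_of_mem hαβ (hA e he).2, sub_sub_sub_cancel_right]
  obtain ⟨N₀, hN₀⟩ := eventually_atTop.1
    (eventually_subset_box ({x, y} ∪ (A.image Prod.fst ∪ A.image Edge.head)))
  refine le_of_forall_pos_le_add fun ε hε => ?_
  have hpos : 0 < β - α + 1 := by linarith
  obtain ⟨N, hN, hflux⟩ := exists_sum_boxBdry_lt hd hp hdp
    (summable_rpow_of_energy_ne_top ha hr h.ne_top) (div_pos hε hpos) N₀
  have hbox := hN₀ N hN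
  simp only [Finset.union_subset_iff, Finset.insert_subset_iff, Finset.singleton_subset_iff,
    Finset.image_subset_iff] at hbox
  obtain ⟨⟨hx, hy⟩, hA1, hA2⟩ := hbox
  have hparts := sum_mul_potentialDrop_sub_le θ hk0 hkK (fun e he => ⟨hA1 e he, hA2 e he⟩)
    (h.mul_potentialDrop_comp_nonneg hp hr0 hxy hmono)
  simp only [(isUnitFlow_iff hxy).1 h.isUnitFlow, mul_sub, Finset.sum_sub_distrib] at hparts
  rw [henergy, sum_box_mul_pointMass hx, sum_box_mul_pointMass hy] at hparts
  have hsmall : (β - α) * ∑ e ∈ boxBdry d N, |θ e| ≤ ε := by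
    rw [lt_div_iff₀' hpos] at hflux
    have hnn : 0 ≤ ∑ e ∈ boxBdry d N, |θ e| := Finset.sum_nonneg fun _ _ => abs_nonneg _
    linarith
  linarith [hkK x, hk0 y]

lemma IsMinFlow.abs_le_one (hd : 1 ≤ d) (hp : 1 < p) (hdp : ((d : ℝ) - 1) * p ≤ d)
    (ha : 0 < a) (hr : ∀ e, a ≤ r e) (hxy : x ≠ y) (h : IsMinFlow p r x y θ) (e : Edge d) :
    |θ e| ≤ 1 := by
  have hr0 : ∀ e, 0 ≤ r e := fun e => ha.le.trans (hr e)
  set u := potential p r θ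
  have henergy := h.sum_le_of_potential_mem_Icc (α := min (u e.1) (u e.head))
    (β := max (u e.1) (u e.head)) (A := {e}) hd hp hdp ha hr hxy min_le_max fun e' he' => by
      rw [Finset.mem_singleton.1 he']
      exact ⟨⟨min_le_left _ _, le_max_left _ _⟩, ⟨min_le_right _ _, le_max_right _ _⟩⟩
  have hdrop : u e.1 - u e.head = voltage p r θ e := h.potentialDrop_potential hp hr0 hxy e
  rw [Finset.sum_singleton, max_sub_min_eq_abs', hdrop, abs_voltage hp hr0] at henergy
  by_contra! hlt
  exact (le_of_mul_le_mul_left henergy (ha.trans_le (hr e))).not_gt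
    (Real.rpow_lt_rpow_of_exponent_lt hlt (by linarith))

lemma IsMinFlow.abs_potential_sub_le (hd : 1 ≤ d) (hp : 1 < p) (hdp : ((d : ℝ) - 1) * p ≤ d)
    (ha : 0 < a) (hr : ∀ e, a ≤ r e ∧ r e ≤ b) (hxy : x ≠ y) (h : IsMinFlow p r x y θ)
    (z w : Vertex d) : |potential p r θ z - potential p r θ w| ≤ b * l1norm (z - w) := by
  have hr0 : ∀ e, 0 ≤ r e := fun e => ha.le.trans (hr e).1
  have hb : 0 ≤ b := (hr0 (0, ⟨0, hd⟩)).trans (hr _).2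
  have hvolt : ∀ e, |voltage p r θ e| ≤ b := fun e => by
    rw [abs_voltage hp hr0, ← mul_one b]
    exact mul_le_mul (hr e).2 (Real.rpow_le_one (abs_nonneg _)
      (h.abs_le_one hd hp hdp ha (fun e => (hr e).1) hxy e) (by linarith))
      (Real.rpow_nonneg (abs_nonneg _) _) hb
  rw [h.potential_sub_potential hp hr0 hxy (fun _ => pathFlow_eq_zero) (outflow_pathFlow z w)]
  calc |∑ e ∈ pathEdges z w, voltage p r θ e * pathFlow z w e|
      ≤ (pathEdges z w).card • b := (Finset.abs_sum_le_sum_abs _ _).trans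
        (Finset.sum_le_card_nsmul _ _ _ fun e _ => by
          rw [abs_mul, ← mul_one b]
          exact mul_le_mul (hvolt e) (abs_pathFlow_le_one z w e) (abs_nonneg _) hb)
    _ ≤ b * l1norm (z - w) := by
        rw [nsmul_eq_mul, mul_comm]
        gcongr
        exact card_pathEdges_le z w

lemma IsMinFlow.sum_le_of_l1norm_le (hd : 1 ≤ d) (hp : 1 < p) (hdp : ((d : ℝ) - 1) * p ≤ d)
    (ha : 0 < a) (hr : ∀ e, a ≤ r e ∧ r e ≤ b) (hxy : x ≠ y) (h : IsMinFlow p r x y θ)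
    {A : Finset (Edge d)} {c : Vertex d} {R : ℕ}
    (hA : ∀ e ∈ A, l1norm (e.1 - c) ≤ R ∧ l1norm (e.head - c) ≤ R) :
    ∑ e ∈ A, r e * |θ e| ^ p ≤ 2 * b * R := by
  have hb : 0 ≤ b := ha.le.trans ((hr (0, ⟨0, hd⟩)).1.trans (hr _).2)
  set u := potential p r θ
  have hmem : ∀ z, l1norm (z - c) ≤ R → u z ∈ Set.Icc (u c - b * R) (u c + b * R) := fun z hz => by
    rw [← Set.mem_Icc_iff_abs_le]
    refine (abs_sub_comm (u c) (u z)).trans_le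
      ((h.abs_potential_sub_le hd hp hdp ha hr hxy z c).trans ?_)
    gcongr
  have hle : u c - b * R ≤ u c + b * R := by
    have : 0 ≤ b * R := by positivity
    linarith
  refine (h.sum_le_of_potential_mem_Icc hd hp hdp ha (fun e => (hr e).1) hxy hle
    fun e he => ⟨hmem _ (hA e he).1, hmem _ (hA e he).2⟩).trans_eq ?_
  ring

lemma resistance_le_resistance_add (hd : 1 ≤ d) (hp : 1 < p) (hdp : ((d : ℝ) - 1) * p ≤ d)
    (ha : 0 < a) (hr : ∀ e, a ≤ r e ∧ r e ≤ b) (hxy : x ≠ y) {x' y' : Vertex d} (hxy' : x' ≠ y') :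
    resistance p r x' y' ≤ resistance p r x y
      + b * 3 ^ p * (l1norm (x' - x) + l1norm (y - y')) := by
  classical
  have hb : 0 ≤ b := ha.le.trans ((hr (0, ⟨0, hd⟩)).1.trans (hr _).2)
  obtain ⟨θ, -, h⟩ := exists_isMinFlow hp ha hr hxy
  set φ : Edge d → ℝ := θ + pathFlow x' x + pathFlow y y' with hφ
  set B := pathEdges x' x ∪ pathEdges y y'
  have hunit : IsUnitFlow x' y' φ := (isUnitFlow_iff hxy').2 fun z => by
    rw [hφ, outflow_add, outflow_add, outflow_pathFlow, outflow_pathFlow,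
      (isUnitFlow_iff hxy).1 h.isUnitFlow]
    ring
  have hφ3 : ∀ e ∈ B, |φ e| ≤ 3 := fun e _ =>
    (abs_add_three (θ e) (pathFlow x' x e) (pathFlow y y' e)).trans (by
      linarith [h.abs_le_one hd hp hdp ha (fun e => (hr e).1) hxy e, abs_pathFlow_le_one x' x e,
        abs_pathFlow_le_one y y' e])
  have hout : ∀ e ∉ B, φ e = θ e := fun e he => by
    simp only [B, Finset.mem_union, not_or] at he
    simp [hφ, pathFlow_eq_zero he.1, pathFlow_eq_zero he.2]
  have hcard : (B.card : ℝ) ≤ l1norm (x' - x) + l1norm (y - y') := mod_cast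
    (Finset.card_union_le _ _).trans (add_le_add (card_pathEdges_le x' x) (card_pathEdges_le y y'))
  have hnn := resistance_nonneg p r x y
  refine resistance_le_of_energy_le (by positivity) hunit
    ((energy_le_energy_add (by linarith) hb (fun e => (hr e).2) hφ3 hout).trans ?_)
  rw [← h.ofReal_resistance, ← ENNReal.ofReal_add hnn (by positivity)]
  gcongr

end Potential

section Perturbation

variable {d : ℕ} {p a b : ℝ} {r r' : Edge d → ℝ} {x y : Vertex d} {θ : Edge d → ℝ}

section Continuity

variable {X : Type*} [TopologicalSpace X] {R : X → Edge d → ℝ}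

lemma lowerSemicontinuous_resistance (hp : 1 < p) (ha : 0 < a)
    (hr : ∀ q e, a ≤ R q e ∧ R q e ≤ b) (hxy : x ≠ y) (hR : Continuous R) :
    LowerSemicontinuous fun q => resistance p (R q) x y := by
  rw [lowerSemicontinuous_iff_isClosed_preimage]
  intro c
  rcases lt_or_ge c 0 with hc | hc
  · convert isClosed_empty
    exact Set.eq_empty_of_forall_notMem fun q hq =>
      (hc.trans_le (resistance_nonneg p (R q) x y)).not_ge hq
  · let K := boundedFlows x y (flowBound p a b x y)
    have : CompactSpace K := isCompact_iff_compactSpace.1 (isCompact_boundedFlows x y _)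
    let Z : Set (X × K) := {q | energy p (R q.1) q.2 ≤ ENNReal.ofReal c}
    have hZ : IsClosed Z := (lowerSemicontinuous_energy (zero_le_one.trans hp.le)
      (hR.comp continuous_fst) (continuous_subtype_val.comp continuous_snd)).isClosed_preimage _
    -- By compactness of the minimizers, sublevel sets of the resistance are projections.
    have hproj : (fun q => resistance p (R q) x y) ⁻¹' Set.Iic c = Prod.fst '' Z := by
      ext q
      constructor
      · intro hq
        obtain ⟨θ, hθ, hmin⟩ := exists_isMinFlow hp ha (hr q) hxy
        exact ⟨(q, ⟨θ, hθ⟩),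
          hmin.ofReal_resistance.symm.trans_le (ENNReal.ofReal_le_ofReal hq), rfl⟩
      · rintro ⟨⟨q, θ, hθ⟩, hle, rfl⟩
        exact resistance_le_of_energy_le hc hθ.1 hle
    rw [hproj]
    exact isClosedMap_fst_of_compactSpace _ hZ

lemma upperSemicontinuous_resistance (hp : 1 < p) (ha : 0 < a)
    (hr : ∀ q e, a ≤ R q e ∧ R q e ≤ b) (hxy : x ≠ y) (hR : Continuous R) :
    UpperSemicontinuous fun q => resistance p (R q) x y := by
  intro q₀ c hc
  have hr0 : ∀ q e, 0 ≤ R q e := fun q e => ha.le.trans (hr q e).1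
  obtain ⟨θ, -, hmin⟩ := exists_isMinFlow hp ha (hr q₀) hxy
  have hsum : Summable fun e => b * |θ e| ^ p :=
    (summable_rpow_of_energy_ne_top ha (fun e => (hr q₀ e).1) hmin.ne_top).mul_left b
  have hle : ∀ q e, R q e * |θ e| ^ p ≤ b * |θ e| ^ p := fun q e =>
    mul_le_mul_of_nonneg_right (hr q e).2 (Real.rpow_nonneg (abs_nonneg _) _)
  have hcont : Continuous fun q => ∑' e, R q e * |θ e| ^ p := by
    refine continuous_tsum (fun e => by fun_prop) hsum fun e q => ?_
    rw [Real.norm_of_nonneg (mul_abs_rpow_nonneg (hr0 q) θ p e)]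
    exact hle q e
  have hlt : ∑' e, R q₀ e * |θ e| ^ p < c := (hmin.resistance_eq (hr0 q₀)).symm.trans_lt hc
  filter_upwards [hcont.continuousAt.eventually_lt continuousAt_const hlt] with q hq
  refine (resistance_le_of_energy_le (tsum_nonneg (mul_abs_rpow_nonneg (hr0 q) θ p))
    hmin.isUnitFlow (energy_eq_ofReal (hr0 q) ?_).le).trans_lt hq
  exact .of_nonneg_of_le (mul_abs_rpow_nonneg (hr0 q) θ p) (hle q) hsum

lemma continuous_resistance (hp : 1 < p) (ha : 0 < a) (hr : ∀ q e, a ≤ R q e ∧ R q e ≤ b)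
    (hxy : x ≠ y) (hR : Continuous R) : Continuous fun q => resistance p (R q) x y :=
  continuous_iff_lower_upperSemicontinuous.2
    ⟨lowerSemicontinuous_resistance hp ha hr hxy hR, upperSemicontinuous_resistance hp ha hr hxy hR⟩

end Continuity

lemma IsMinFlow.resistance_le_of_le (h : IsMinFlow p r' x y θ) (hle : ∀ e, r e ≤ r' e) :
    resistance p r x y ≤ resistance p r' x y :=
  resistance_le_of_energy_le (resistance_nonneg p r' x y) h.isUnitFlow
    ((energy_mono hle).trans_eq h.ofReal_resistance.symm)

lemma IsMinFlow.resistance_update_le (h : IsMinFlow p r x y θ) {e : Edge d} {t : ℝ}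
    (ht : r e ≤ t) : resistance p (Function.update r e t) x y
      ≤ resistance p r x y + (t - r e) * |θ e| ^ p := by
  have hnn : 0 ≤ (t - r e) * |θ e| ^ p :=
    mul_nonneg (sub_nonneg.2 ht) (Real.rpow_nonneg (abs_nonneg _) _)
  have hterm : ∀ e', ENNReal.ofReal (Function.update r e t e' * |θ e'| ^ p)
      ≤ ENNReal.ofReal (r e' * |θ e'| ^ p)
        + if e' = e then ENNReal.ofReal ((t - r e) * |θ e| ^ p) else 0 := fun e' => by
    rcases eq_or_ne e' e with rfl | he
    · rw [Function.update_self, if_pos rfl]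
      refine le_trans (ENNReal.ofReal_le_ofReal (le_of_eq ?_)) ENNReal.ofReal_add_le
      ring
    · rw [Function.update_of_ne he, if_neg he, add_zero]
  refine resistance_le_of_energy_le (add_nonneg (resistance_nonneg p r x y) hnn) h.isUnitFlow ?_
  calc energy p (Function.update r e t) θ
      ≤ energy p r θ + ENNReal.ofReal ((t - r e) * |θ e| ^ p) := by
        refine (ENNReal.tsum_le_tsum hterm).trans_eq ?_
        rw [ENNReal.tsum_add, tsum_ite_eq, energy]
    _ = ENNReal.ofReal (resistance p r x y + (t - r e) * |θ e| ^ p) := by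
        rw [ENNReal.ofReal_add (resistance_nonneg p r x y) hnn, h.ofReal_resistance]

end Perturbation

section Coins

lemma continuous_ite_apply {ι Y : Type*} [TopologicalSpace Y] (i : ι) {f g : (ι → Bool) → Y}
    (hf : Continuous f) (hg : Continuous g) : Continuous fun ω => if ω i then f ω else g ω := by
  have hclopen : IsClopen {ω : ι → Bool | ω i = true} :=
    (isClopen_discrete {true}).preimage (continuous_apply i)
  exact hf.if (fun ω hω => (hclopen.frontier_eq.subset hω).elim) hg

lemma influence_eq_two_mul_integral {ι : Type*} [DecidableEq ι] [Countable ι]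
    {P : Measure (ι → Bool)} [IsProbabilityMeasure P] (hP : IsFlipInvariant P)
    {f : (ι → Bool) → ℝ} (hf : Continuous f) (i : ι) :
    influence P f i = 2 * ∫ ω, (if ω i then 0 else |flipDiff i f ω|) ∂P := by
  let g : (ι → Bool) → ℝ := fun ω => if ω i then 0 else |flipDiff i f ω|
  have hg : Continuous g := continuous_ite_apply i continuous_const (by fun_prop)
  have hsplit : ∀ ω, |flipDiff i f ω| = g ω + g (flipBit i ω) := fun ω => by
    cases h : ω i <;> simp [g, h, flipDiff, abs_sub_comm]
  calc influence P f i = ∫ ω, g ω + g (flipBit i ω) ∂P := by simp only [influence, hsplit]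
    _ = ∫ ω, g ω ∂P + ∫ ω, g (flipBit i ω) ∂P :=
      integral_add (integrable_of_continuous hg) (integrable_of_continuous (by fun_prop))
    _ = 2 * ∫ ω, g ω ∂P := by rw [hP.integral_comp_flipBit i g, two_mul]

variable {d : ℕ} {p a b : ℝ} {x y : Vertex d}

/-- The resistances `a` and `b` read off from coin tosses. -/
def coinResistances (a b : ℝ) (ω : Edge d → Bool) (e : Edge d) : ℝ := if ω e then b else a

lemma coinResistances_mem (hab : a ≤ b) (ω : Edge d → Bool) (e : Edge d) :
    a ≤ coinResistances a b ω e ∧ coinResistances a b ω e ≤ b := by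
  unfold coinResistances
  split_ifs <;> simp [hab]

lemma continuous_coinResistances (a b : ℝ) : Continuous (coinResistances (d := d) a b) :=
  continuous_pi fun e => continuous_ite_apply e continuous_const continuous_const

lemma coinResistances_flipBit (a b : ℝ) {ω : Edge d → Bool} {e : Edge d} (he : ω e = false) :
    coinResistances a b (flipBit e ω) = Function.update (coinResistances a b ω) e b := by
  ext e'
  rcases eq_or_ne e' e with rfl | h
  · simp [coinResistances, he]
  · simp [coinResistances, h]

/-- The resistance between two points as a function of the coin tosses. -/
noncomputable def coinRes (p a b : ℝ) (x y : Vertex d) (ω : Edge d → Bool) : ℝ :=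
  resistance p (coinResistances a b ω) x y

lemma continuous_coinRes (hp : 1 < p) (ha : 0 < a) (hab : a ≤ b) (hxy : x ≠ y) :
    Continuous (coinRes p a b x y) :=
  continuous_resistance hp ha (coinResistances_mem hab) hxy (continuous_coinResistances a b)

-- Both bounds come from testing one configuration with the minimal flow of the other.
lemma IsMinFlow.abs_flipDiff_coinRes_le (hp : 1 < p) (ha : 0 < a) (hab : a ≤ b) (hxy : x ≠ y)
    {ω : Edge d → Bool} {θ : Edge d → ℝ} (h : IsMinFlow p (coinResistances a b ω) x y θ)
    {e : Edge d} (he : ω e = false) : |flipDiff e (coinRes p a b x y) ω| ≤ (b - a) * |θ e| ^ p := by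
  have hωe : coinResistances a b ω e = a := by simp [coinResistances, he]
  obtain ⟨θ', -, h'⟩ := exists_isMinFlow hp ha (coinResistances_mem hab (flipBit e ω)) hxy
  have hmono : coinRes p a b x y ω ≤ coinRes p a b x y (flipBit e ω) := by
    refine h'.resistance_le_of_le ?_
    rw [coinResistances_flipBit a b he]
    exact le_update_iff.2 ⟨hωe.trans_le hab, fun _ _ => le_rfl⟩
  have hle := h.resistance_update_le (hωe.trans_le hab)
  rw [← coinResistances_flipBit a b he, hωe] at hle
  rw [flipDiff, abs_sub_comm, abs_of_nonneg (sub_nonneg.2 hmono), sub_le_iff_le_add']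
  exact hle

lemma abs_flipDiff_coinRes_le (hd : 1 ≤ d) (hp : 1 < p) (hdp : ((d : ℝ) - 1) * p ≤ d)
    (ha : 0 < a) (hab : a ≤ b) (hxy : x ≠ y) (e : Edge d) (ω : Edge d → Bool) :
    |flipDiff e (coinRes p a b x y) ω| ≤ b - a := by
  wlog he : ω e = false generalizing ω
  · have hflip := this (flipBit e ω) (by simpa using he)
    rwa [flipDiff, flipBit_flipBit, abs_sub_comm] at hflip
  obtain ⟨θ, -, h⟩ := exists_isMinFlow hp ha (coinResistances_mem hab ω) hxy
  have hθ := h.abs_le_one hd hp hdp ha (fun e => (coinResistances_mem hab ω e).1) hxy e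
  exact (h.abs_flipDiff_coinRes_le hp ha hab hxy he).trans (mul_le_of_le_one_right
    (sub_nonneg.2 hab) (Real.rpow_le_one (abs_nonneg _) hθ (by linarith)))

lemma IsMinFlow.sum_abs_flipDiff_coinRes_le (hp : 1 < p) (ha : 0 < a) (hab : a ≤ b) (hxy : x ≠ y)
    {ω : Edge d → Bool} {θ : Edge d → ℝ} (h : IsMinFlow p (coinResistances a b ω) x y θ)
    (A : Finset (Edge d)) :
    ∑ e ∈ A, (if ω e then 0 else |flipDiff e (coinRes p a b x y) ω|)
      ≤ (b - a) / a * ∑ e ∈ A, coinResistances a b ω e * |θ e| ^ p := by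
  rw [Finset.mul_sum]
  refine Finset.sum_le_sum fun e _ => ?_
  cases he : ω e
  · calc (if false = true then 0 else |flipDiff e (coinRes p a b x y) ω|)
        ≤ (b - a) * |θ e| ^ p := h.abs_flipDiff_coinRes_le hp ha hab hxy he
      _ = (b - a) / a * (coinResistances a b ω e * |θ e| ^ p) := by
        simp only [coinResistances, he, Bool.false_eq_true, if_false]
        field_simp
  · exact mul_nonneg (div_nonneg (sub_nonneg.2 hab) ha.le) (mul_abs_rpow_nonneg
      (fun e => ha.le.trans (coinResistances_mem hab ω e).1) θ p e)

lemma sum_influence_coinRes_le {P : Measure (Edge d → Bool)} [IsProbabilityMeasure P]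
    (hP : IsFlipInvariant P) (hp : 1 < p) (ha : 0 < a) (hab : a ≤ b) (hxy : x ≠ y)
    {A : Finset (Edge d)} {B : ℝ} (hB : ∀ ω θ, IsMinFlow p (coinResistances a b ω) x y θ →
      ∑ e ∈ A, coinResistances a b ω e * |θ e| ^ p ≤ B) :
    ∑ e ∈ A, influence P (coinRes p a b x y) e ≤ 2 * ((b - a) / a * B) := by
  have hF := continuous_coinRes hp ha hab hxy
  have hcont : ∀ e, Continuous fun ω : Edge d → Bool =>
      if ω e then 0 else |flipDiff e (coinRes p a b x y) ω| :=
    fun e => continuous_ite_apply e continuous_const (by fun_prop)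
  have hle : ∀ ω, ∑ e ∈ A, (if ω e then 0 else |flipDiff e (coinRes p a b x y) ω|)
      ≤ (b - a) / a * B := fun ω => by
    obtain ⟨θ, -, h⟩ := exists_isMinFlow hp ha (coinResistances_mem hab ω) hxy
    refine (h.sum_abs_flipDiff_coinRes_le hp ha hab hxy A).trans ?_
    exact mul_le_mul_of_nonneg_left (hB ω θ h) (div_nonneg (sub_nonneg.2 hab) ha.le)
  simp only [influence_eq_two_mul_integral hP hF]
  rw [← Finset.mul_sum, ← integral_finsetSum _ fun e _ => integrable_of_continuous (hcont e)]
  gcongr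
  calc ∫ ω, ∑ e ∈ A, (if ω e then 0 else |flipDiff e (coinRes p a b x y) ω|) ∂P
      ≤ ∫ _, (b - a) / a * B ∂P :=
        integral_mono (integrable_of_continuous (by fun_prop)) (integrable_const _) hle
    _ = (b - a) / a * B := by simp

end Coins

section Translation

variable {d : ℕ} {x y : Vertex d}

/-- The translation of edges by `z`. -/
def shiftEdge (z : Vertex d) : Edge d ≃ Edge d := (Equiv.addRight z).prodCongr (Equiv.refl _)

lemma outflow_comp_shiftEdge (z : Vertex d) (θ : Edge d → ℝ) (q : Vertex d) :
    outflow (θ ∘ shiftEdge z) q = outflow θ (q + z) := by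
  simp [outflow, shiftEdge, sub_add_eq_add_sub]

lemma isUnitFlow_comp_shiftEdge (hxy : x ≠ y) (z : Vertex d) (θ : Edge d → ℝ) :
    IsUnitFlow (x + z) (y + z) θ ↔ IsUnitFlow x y (θ ∘ shiftEdge z) := by
  rw [isUnitFlow_iff hxy, isUnitFlow_iff (by simpa using hxy),
    ← (Equiv.addRight z).forall_congr_right]
  simp [outflow_comp_shiftEdge, pointMass]

lemma resistance_add_add (p : ℝ) (r : Edge d → ℝ) (hxy : x ≠ y) (z : Vertex d) :
    resistance p r (x + z) (y + z) = resistance p (r ∘ shiftEdge z) x y := by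
  let T : {θ : Edge d → ℝ // IsUnitFlow (x + z) (y + z) θ} ≃ {θ : Edge d → ℝ // IsUnitFlow x y θ} :=
    ((shiftEdge z).symm.arrowCongr (Equiv.refl ℝ)).subtypeEquiv (isUnitFlow_comp_shiftEdge hxy z)
  rw [resistance, resistance, T.iInf_congr fun θ => ?_]
  exact (shiftEdge z).tsum_eq fun e => ENNReal.ofReal (r e * |θ.1 e| ^ p)

lemma coinRes_comp_shiftEdge (p a b : ℝ) (hxy : x ≠ y) (z : Vertex d) (ω : Edge d → Bool) :
    coinRes p a b x y (ω ∘ shiftEdge z) = coinRes p a b (x + z) (y + z) ω := by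
  rw [coinRes, coinRes, resistance_add_add p _ hxy]
  rfl

lemma flipBit_comp_shiftEdge (z : Vertex d) (e : Edge d) (ω : Edge d → Bool) :
    flipBit e ω ∘ shiftEdge z = flipBit ((shiftEdge z).symm e) (ω ∘ shiftEdge z) := by
  simp [flipBit, Function.update_comp_equiv]

end Translation

section CoinLaw

/-- The law of a fair coin. -/
noncomputable def coin : Measure Bool :=
  (2⁻¹ : ℝ≥0∞) • Measure.dirac false + (2⁻¹ : ℝ≥0∞) • Measure.dirac true

instance : IsProbabilityMeasure coin :=
  ⟨by simp [coin, ENNReal.inv_two_add_inv_two]⟩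

lemma coin_map {Y : Type*} [MeasurableSpace Y] (f : Bool → Y) :
    coin.map f =
      (2⁻¹ : ℝ≥0∞) • Measure.dirac (f false) + (2⁻¹ : ℝ≥0∞) • Measure.dirac (f true) := by
  have hf : Measurable f := measurable_of_countable f
  rw [coin, Measure.map_add _ _ hf, Measure.map_smul, Measure.map_smul, Measure.map_dirac' hf,
    Measure.map_dirac' hf]

/-- The law of independent fair coins on the edges of `ℤ^d`. -/
noncomputable def coinLaw (d : ℕ) : Measure (Edge d → Bool) :=
  Measure.infinitePi fun _ : Edge d => coin

instance (d : ℕ) : IsProbabilityMeasure (coinLaw d) := by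
  unfold coinLaw
  infer_instance

lemma coinLaw_map_coinResistances (d : ℕ) (a b : ℝ) :
    (coinLaw d).map (coinResistances a b) = resistanceLaw d a b := by
  refine (Measure.infinitePi_map_pi (fun _ : Edge d => coin)
    (f := fun _ (t : Bool) => if t then b else a) fun _ => measurable_of_countable _).trans ?_
  simp only [coin_map, resistanceLaw, bernoulliLaw, if_true, Bool.false_eq_true, if_false]

lemma isFlipInvariant_coinLaw (d : ℕ) : IsFlipInvariant (coinLaw d) := by
  refine fun e => ⟨(continuous_flipBit e).measurable, ?_⟩
  let g : Edge d → Bool → Bool := Function.update (fun _ => id) e not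
  have hg : flipBit e = fun (ω : Edge d → Bool) e' => g e' (ω e') := by
    funext ω e'
    rcases eq_or_ne e' e with rfl | h
    · simp [g]
    · simp [g, h]
  have hcoin : ∀ e', coin.map (g e') = coin := fun e' => by
    rcases eq_or_ne e' e with rfl | h
    · rw [coin_map]
      simp [g, coin, add_comm]
    · simp [g, h]
  rw [hg, coinLaw, Measure.infinitePi_map_pi _ fun _ => measurable_of_countable _]
  simp only [hcoin]

lemma measurePreserving_comp_shiftEdge (d : ℕ) (z : Vertex d) :
    MeasurePreserving (fun ω : Edge d → Bool => ω ∘ shiftEdge z) (coinLaw d) (coinLaw d) :=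
  ⟨by fun_prop, by
    unfold coinLaw
    convert Measure.infinitePi_map_piCongrLeft (fun _ : Edge d => coin) (shiftEdge z).symm using 2
    funext ω e
    obtain ⟨e, rfl⟩ := (shiftEdge z).symm.surjective e
    simp [MeasurableEquiv.coe_piCongrLeft]⟩

end CoinLaw

section Variance

variable {ι : Type*} [Countable ι] {P : Measure (ι → Bool)} [IsProbabilityMeasure P]
  {f g : (ι → Bool) → ℝ}

lemma variance_le_sq_mul_of_influence_le [DecidableEq ι] (hP : IsFlipInvariant P)
    (hf : Continuous f) {c T δ : ℝ} (hc : 0 < c) (h1 : ∀ i ω, |flipDiff i f ω| ≤ c)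
    (hT : ∀ B : Finset ι, ∑ i ∈ B, influence P f i ≤ c * T) (hδ : ∀ i, influence P f i ≤ c * δ)
    {k : ℕ} (hk : 1 ≤ k) : variance f P ≤ c ^ 2 * (T / k + 3 ^ k * √δ * T) := by
  let g : (ι → Bool) → ℝ := fun ω => c⁻¹ * f ω
  have hdiff : ∀ i ω, |flipDiff i g ω| = c⁻¹ * |flipDiff i f ω| := fun i ω => by
    simp only [g, flipDiff]
    rw [← mul_sub, abs_mul, abs_of_pos (inv_pos.2 hc)]
  have hinfl : ∀ i, influence P g i = c⁻¹ * influence P f i := fun i => by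
    simp only [influence, hdiff, integral_const_mul]
  have hg := variance_le_of_influence_le (f := g) (T := T) (δ := δ) hP (by fun_prop)
    (fun i ω => by rw [hdiff, inv_mul_le_one₀ hc]; exact h1 i ω)
    (fun B => by simp only [hinfl]; rw [← Finset.mul_sum, inv_mul_le_iff₀ hc]; exact hT B)
    (fun i => by rw [hinfl, inv_mul_le_iff₀ hc]; exact hδ i) hk
  rwa [variance_const_mul, inv_pow, inv_mul_le_iff₀ (by positivity)] at hg

lemma variance_le_of_abs_sub_le (hf : Continuous f) (hg : Continuous g) {D : ℝ}
    (h : ∀ ω, |f ω - g ω| ≤ D) : variance f P ≤ 2 * D ^ 2 + 2 * variance g P := by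
  let c := ∫ ω, g ω ∂P
  have hle : ∀ ω, (f ω - c) ^ 2 ≤ 2 * D ^ 2 + 2 * (g ω - c) ^ 2 := fun ω => by
    have := sq_le_sq' (abs_le.1 (h ω)).1 (abs_le.1 (h ω)).2
    nlinarith [sq_nonneg ((f ω - g ω) - (g ω - c))]
  calc variance f P = variance (fun ω => f ω - c) P :=
        (variance_sub_const hf.aestronglyMeasurable c).symm
    _ ≤ ∫ ω, (f ω - c) ^ 2 ∂P :=
        variance_le_expectation_sq (Continuous.aestronglyMeasurable (by fun_prop))
    _ ≤ ∫ ω, (2 * D ^ 2 + 2 * (g ω - c) ^ 2) ∂P :=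
        integral_mono (integrable_of_continuous (by fun_prop))
          (integrable_of_continuous (by fun_prop)) hle
    _ = 2 * D ^ 2 + 2 * ∫ ω, (g ω - c) ^ 2 ∂P := by
        rw [integral_add (integrable_const _) (integrable_of_continuous (by fun_prop))]
        simp [integral_const_mul]
    _ = 2 * D ^ 2 + 2 * variance g P := by
        rw [variance_eq_integral hg.aestronglyMeasurable.aemeasurable]

end Variance

section Averaging

open scoped BigOperators

variable {d : ℕ} {p a b : ℝ} {v x y : Vertex d}

lemma l1norm_neg (z : Vertex d) : l1norm (-z) = l1norm z := by simp [l1norm]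

lemma abs_resistance_sub_resistance_add_add_le (hd : 1 ≤ d) (hp : 1 < p)
    (hdp : ((d : ℝ) - 1) * p ≤ d) (ha : 0 < a) {r : Edge d → ℝ} (hr : ∀ e, a ≤ r e ∧ r e ≤ b)
    (hxy : x ≠ y) (z : Vertex d) :
    |resistance p r x y - resistance p r (x + z) (y + z)| ≤ b * 3 ^ p * (2 * l1norm z) := by
  have hxy' : x + z ≠ y + z := by simpa using hxy
  have hle := resistance_le_resistance_add hd hp hdp ha hr hxy hxy'
  have hge := resistance_le_resistance_add hd hp hdp ha hr hxy' hxy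
  simp only [add_sub_cancel_left, sub_add_cancel_left, l1norm_neg, ← two_mul] at hle hge
  exact abs_sub_le_iff.2 ⟨by linarith, by linarith⟩

/-- The cube of translations `[0, m)^d`. -/
noncomputable def shiftCube (d m : ℕ) : Finset (Vertex d) :=
  Fintype.piFinset fun _ => Finset.Ico 0 (m : ℤ)

lemma card_shiftCube (d m : ℕ) : (shiftCube d m).card = m ^ d := by
  simp [shiftCube, Fintype.card_piFinset]

lemma mem_shiftCube {m : ℕ} {z : Vertex d} : z ∈ shiftCube d m ↔ ∀ j, 0 ≤ z j ∧ z j < m := by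
  simp [shiftCube]

lemma shiftCube_nonempty (d : ℕ) {m : ℕ} (hm : 1 ≤ m) : (shiftCube d m).Nonempty :=
  ⟨0, mem_shiftCube.2 fun _ => ⟨le_rfl, show (0 : ℤ) < m by exact_mod_cast hm⟩⟩

lemma l1norm_le_of_natAbs_le {m : ℕ} {z : Vertex d} (h : ∀ j, (z j).natAbs ≤ m) :
    l1norm z ≤ d * m := by
  refine (Finset.sum_le_card_nsmul _ _ m fun j _ => h j).trans ?_
  simp

lemma l1norm_le_of_mem_shiftCube {m : ℕ} {z : Vertex d} (hz : z ∈ shiftCube d m) :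
    l1norm z ≤ d * m :=
  l1norm_le_of_natAbs_le fun j => by have := mem_shiftCube.1 hz j; omega

/-- The average over `z ∈ [0, m)^d` of the resistances between `z` and `v + z`. It is close to the
resistance between `0` and `v`, but its influences are small. -/
noncomputable def avgRes (p a b : ℝ) (v : Vertex d) (m : ℕ) (ω : Edge d → Bool) : ℝ :=
  𝔼 z ∈ shiftCube d m, coinRes p a b 0 v (ω ∘ shiftEdge z)

lemma continuous_avgRes (hp : 1 < p) (ha : 0 < a) (hab : a ≤ b) (hv : v ≠ 0) (m : ℕ) :
    Continuous (avgRes p a b v m) := by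
  have := continuous_coinRes hp ha hab hv.symm
  unfold avgRes
  simp only [Finset.expect_eq_sum_div_card]
  fun_prop

lemma abs_coinRes_sub_avgRes_le (hd : 1 ≤ d) (hp : 1 < p) (hdp : ((d : ℝ) - 1) * p ≤ d)
    (ha : 0 < a) (hab : a ≤ b) (hv : v ≠ 0) {m : ℕ} (hm : 1 ≤ m) (ω : Edge d → Bool) :
    |coinRes p a b 0 v ω - avgRes p a b v m ω| ≤ b * 3 ^ p * (2 * (d * m)) := by
  have hb : 0 ≤ b := ha.le.trans hab
  have hne := shiftCube_nonempty d hm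
  rw [avgRes, ← Finset.expect_const hne (coinRes p a b 0 v ω), ← Finset.expect_sub_distrib]
  refine (Finset.abs_expect_le _ _).trans (Finset.expect_le hne fun z hz => ?_)
  have hz' : (l1norm z : ℝ) ≤ d * m := by exact_mod_cast l1norm_le_of_mem_shiftCube hz
  rw [coinRes_comp_shiftEdge p a b hv.symm]
  refine (abs_resistance_sub_resistance_add_add_le hd hp hdp ha (coinResistances_mem hab ω)
    hv.symm z).trans ?_
  gcongr

lemma abs_flipDiff_avgRes_le (p a b : ℝ) (v : Vertex d) (m : ℕ) (e : Edge d) (ω : Edge d → Bool) :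
    |flipDiff e (avgRes p a b v m) ω| ≤ 𝔼 z ∈ shiftCube d m,
      |flipDiff ((shiftEdge z).symm e) (coinRes p a b 0 v) (ω ∘ shiftEdge z)| := by
  simp only [flipDiff, avgRes, ← Finset.expect_sub_distrib, flipBit_comp_shiftEdge]
  exact Finset.abs_expect_le _ _

lemma influence_avgRes_le (hp : 1 < p) (ha : 0 < a) (hab : a ≤ b) (hv : v ≠ 0) (m : ℕ)
    (e : Edge d) : influence (coinLaw d) (avgRes p a b v m) e ≤
      𝔼 z ∈ shiftCube d m, influence (coinLaw d) (coinRes p a b 0 v) ((shiftEdge z).symm e) := by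
  have hF := continuous_coinRes hp ha hab hv.symm
  have hA := continuous_avgRes hp ha hab hv m
  let g : Vertex d → (Edge d → Bool) → ℝ :=
    fun z ω => |flipDiff ((shiftEdge z).symm e) (coinRes p a b 0 v) ω|
  have hg : ∀ z, Continuous (g z) := fun z => by fun_prop
  have hinv : ∀ z, ∫ ω, g z (ω ∘ shiftEdge z) ∂(coinLaw d) = ∫ ω, g z ω ∂(coinLaw d) := fun z => by
    have hshift := measurePreserving_comp_shiftEdge d z
    rw [← integral_map hshift.measurable.aemeasurable (hg z).aestronglyMeasurable, hshift.map_eq]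
  calc influence (coinLaw d) (avgRes p a b v m) e
      ≤ ∫ ω, (𝔼 z ∈ shiftCube d m, g z (ω ∘ shiftEdge z)) ∂(coinLaw d) := by
        refine integral_mono (integrable_of_continuous (by fun_prop))
          (integrable_of_continuous ?_) (abs_flipDiff_avgRes_le p a b v m e)
        simp only [Finset.expect_eq_sum_div_card]
        fun_prop
    _ = 𝔼 z ∈ shiftCube d m, ∫ ω, g z (ω ∘ shiftEdge z) ∂(coinLaw d) := by
        simp only [Finset.expect_eq_sum_div_card]
        rw [integral_div, integral_finsetSum _ fun z _ => integrable_of_continuous (by fun_prop)]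
    _ = 𝔼 z ∈ shiftCube d m, influence (coinLaw d) (coinRes p a b 0 v) ((shiftEdge z).symm e) := by
        simp only [hinv, influence, g]

lemma IsMinFlow.sum_le_resistance {r : Edge d → ℝ} (hr : ∀ e, 0 ≤ r e) {θ : Edge d → ℝ}
    (h : IsMinFlow p r x y θ) (A : Finset (Edge d)) :
    ∑ e ∈ A, r e * |θ e| ^ p ≤ resistance p r x y :=
  ((summable_of_energy_ne_top hr h.ne_top).sum_le_tsum A fun e _ =>
    mul_abs_rpow_nonneg hr θ p e).trans_eq (h.resistance_eq hr).symm

lemma sum_influence_avgRes_le (hp : 1 < p) (ha : 0 < a) (hab : a ≤ b) (hv : v ≠ 0) {B : ℝ}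
    (hB : ∀ ω, coinRes p a b 0 v ω ≤ B) {m : ℕ} (hm : 1 ≤ m) (A : Finset (Edge d)) :
    ∑ e ∈ A, influence (coinLaw d) (avgRes p a b v m) e ≤ 2 * ((b - a) / a * B) := by
  refine (Finset.sum_le_sum fun e _ => influence_avgRes_le hp ha hab hv m e).trans ?_
  rw [← Finset.expect_sum_comm]
  refine Finset.expect_le (shiftCube_nonempty d hm) fun z _ => ?_
  refine (Finset.sum_map A (shiftEdge z).symm.toEmbedding
    (influence (coinLaw d) (coinRes p a b 0 v))).symm.trans_le ?_
  exact sum_influence_coinRes_le (isFlipInvariant_coinLaw d) hp ha hab hv.symm fun ω θ h =>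
    (h.sum_le_resistance (fun e => ha.le.trans (coinResistances_mem hab ω e).1) _).trans (hB ω)

-- The `m ^ d` translates of an edge lie in a ball of radius `d * m`, which dissipates energy of
-- order `m` only.
lemma influence_avgRes_le_div (hd : 1 ≤ d) (hp : 1 < p) (hdp : ((d : ℝ) - 1) * p ≤ d) (ha : 0 < a)
    (hab : a ≤ b) (hv : v ≠ 0) (m : ℕ) (e : Edge d) :
    influence (coinLaw d) (avgRes p a b v m) e
      ≤ 2 * ((b - a) / a * (2 * b * (d * m : ℕ))) / m ^ d := by
  refine (influence_avgRes_le hp ha hab hv m e).trans ?_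
  have hinj : Set.InjOn (fun z => (shiftEdge z).symm e) (shiftCube d m) := fun z _ z' _ h => by
    simpa [shiftEdge] using congrArg Prod.fst h
  rw [Finset.expect_eq_sum_div_card, card_shiftCube, Nat.cast_pow, ← Finset.sum_image hinj]
  gcongr
  refine sum_influence_coinRes_le (isFlipInvariant_coinLaw d) hp ha hab hv.symm fun ω θ h =>
    h.sum_le_of_l1norm_le hd hp hdp ha (coinResistances_mem hab ω) hv.symm (c := e.1) ?_
  simp only [Finset.forall_mem_image]
  intro z hz
  have hz' := mem_shiftCube.1 hz
  refine ⟨l1norm_le_of_natAbs_le fun j => ?_, l1norm_le_of_natAbs_le fun j => ?_⟩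
  · have := hz' j
    simp only [shiftEdge, Equiv.prodCongr_symm, Equiv.prodCongr_apply, Prod.map_fst,
      Equiv.addRight_symm, Equiv.coe_addRight, Pi.add_apply, Pi.sub_apply, Pi.neg_apply]
    omega
  · have := hz' j
    have hbasis : basisVec e.2 j = 0 ∨ basisVec e.2 j = 1 := by
      rcases eq_or_ne j e.2 with rfl | hj
      · exact .inr (basisVec_same _)
      · exact .inl (basisVec_of_ne hj)
    simp only [shiftEdge, Edge.head, Equiv.prodCongr_symm, Equiv.prodCongr_apply, Prod.map_fst,
      Prod.map_snd, Equiv.refl_symm, Equiv.refl_apply, Equiv.addRight_symm, Equiv.coe_addRight,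
      Pi.add_apply, Pi.sub_apply, Pi.neg_apply]
    omega

theorem variance_coinRes_le (hd : 2 ≤ d) (hp : 1 < p) (hdp : ((d : ℝ) - 1) * p ≤ d) (ha : 0 < a)
    (hab : a ≤ b) (hv : v ≠ 0) {B : ℝ} (hB : ∀ ω, coinRes p a b 0 v ω ≤ B) {m k : ℕ}
    (hm : 1 ≤ m) (hk : 1 ≤ k) :
    variance (coinRes p a b 0 v) (coinLaw d) ≤ 2 * (b * 3 ^ p * (2 * (d * m))) ^ 2
      + 2 * (b ^ 2 * (2 * B / a / k + 3 ^ k * √(4 * b * d / a / m) * (2 * B / a))) := by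
  have hd1 : 1 ≤ d := by omega
  have hb : 0 < b := ha.trans_le hab
  have hm1 : (1 : ℝ) ≤ m := by exact_mod_cast hm
  have hB0 : 0 ≤ B := (resistance_nonneg p _ 0 v).trans (hB fun _ => false)
  have hA := continuous_avgRes hp ha hab hv m
  have hscale : ∀ {Y : ℝ}, 0 ≤ Y → 2 * ((b - a) / a * Y) ≤ b * (2 * Y / a) := fun {Y} hY =>
    calc 2 * ((b - a) / a * Y) = (b - a) * (2 * Y / a) := by ring
      _ ≤ b * (2 * Y / a) := by gcongr; linarith
  refine (variance_le_of_abs_sub_le (continuous_coinRes hp ha hab hv.symm) hA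
    (abs_coinRes_sub_avgRes_le hd1 hp hdp ha hab hv hm)).trans ?_
  gcongr
  refine variance_le_sq_mul_of_influence_le (isFlipInvariant_coinLaw d) hA hb (fun e ω => ?_)
    (fun S => (sum_influence_avgRes_le hp ha hab hv hB hm S).trans (hscale hB0)) (fun e => ?_) hk
  · refine (abs_flipDiff_avgRes_le p a b v m e ω).trans
      (Finset.expect_le (shiftCube_nonempty d hm) fun z _ => ?_)
    exact (abs_flipDiff_coinRes_le hd1 hp hdp ha hab hv.symm _ _).trans (by linarith)
  · calc influence (coinLaw d) (avgRes p a b v m) e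
        ≤ 2 * ((b - a) / a * (2 * b * (d * m : ℕ))) / m ^ d :=
          influence_avgRes_le_div hd1 hp hdp ha hab hv m e
      _ ≤ b * (2 * (2 * b * (d * m : ℕ)) / a) / m ^ 2 := by
          gcongr ?_ / ?_
          · exact hscale (by positivity)
          · exact pow_le_pow_right₀ hm1 hd
      _ = b * (4 * b * d / a / m) := by
          push_cast
          field_simp
          ring

end Averaging

section PartialZeta

variable {s : ℝ}

lemma partialZeta_mono (s : ℝ) : Monotone (partialZeta s) := fun _ _ h =>
  Finset.sum_le_sum_of_subset_of_nonneg (Finset.range_mono h) fun _ _ _ => by positivity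

lemma partialZeta_succ (s : ℝ) (n : ℕ) :
    partialZeta s (n + 1) = partialZeta s n + ((n : ℝ) + 1) ^ (-s) :=
  Finset.sum_range_succ _ n

lemma partialZeta_mul_le (hs : 0 ≤ s) {d : ℕ} (hd : 1 ≤ d) (M : ℕ) :
    partialZeta s (d * M) ≤ d * partialZeta s M := by
  induction M with
  | zero => simp [partialZeta]
  | succ M ih =>
    have hblock : ∀ i : ℕ, (((d * M + i : ℕ) : ℝ) + 1) ^ (-s) ≤ ((M : ℝ) + 1) ^ (-s) := fun i => by
      have : M ≤ d * M + i := by nlinarith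
      exact Real.rpow_le_rpow_of_nonpos (by positivity) (by gcongr) (by linarith)
    calc partialZeta s (d * (M + 1))
        = partialZeta s (d * M) + ∑ i ∈ Finset.range d, (((d * M + i : ℕ) : ℝ) + 1) ^ (-s) := by
          rw [partialZeta, partialZeta, mul_add, mul_one, Finset.sum_range_add]
      _ ≤ d * partialZeta s M + ∑ i ∈ Finset.range d, ((M : ℝ) + 1) ^ (-s) :=
          add_le_add ih (Finset.sum_le_sum fun i _ => hblock i)
      _ = d * partialZeta s (M + 1) := by
          rw [Finset.sum_const, Finset.card_range, nsmul_eq_mul, partialZeta_succ, mul_add]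

lemma rpow_add_le_rpow_add_one {t x : ℝ} (ht : 0 ≤ t) (ht1 : t ≤ 1) (hx : 0 ≤ x) :
    x ^ t + t * (x + 1) ^ (t - 1) ≤ (x + 1) ^ t := by
  have hx1 : 0 < x + 1 := by linarith
  have hinv : -1 ≤ -(x + 1)⁻¹ := neg_le_neg (inv_le_one_of_one_le₀ (by linarith))
  have hbernoulli : x ^ t ≤ (x + 1) ^ t * (1 + t * -(x + 1)⁻¹) :=
    calc x ^ t = ((x + 1) * (1 + -(x + 1)⁻¹)) ^ t := by congr 1; field_simp; ring
      _ = (x + 1) ^ t * (1 + -(x + 1)⁻¹) ^ t := Real.mul_rpow hx1.le (by linarith)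
      _ ≤ (x + 1) ^ t * (1 + t * -(x + 1)⁻¹) := by
          gcongr
          exact rpow_one_add_le_one_add_mul_self hinv ht ht1
  rw [Real.rpow_sub_one hx1.ne', div_eq_mul_inv]
  linarith

lemma partialZeta_le_of_lt_one (hs : 0 ≤ s) (hs1 : s < 1) (n : ℕ) :
    (1 - s) * partialZeta s n ≤ (n : ℝ) ^ (1 - s) := by
  induction n with
  | zero => simp [partialZeta, Real.zero_rpow (by linarith : 1 - s ≠ 0)]
  | succ n ih =>
    have hstep := rpow_add_le_rpow_add_one (by linarith : 0 ≤ 1 - s) (by linarith)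
      (Nat.cast_nonneg n)
    rw [sub_sub_cancel_left] at hstep
    rw [partialZeta_succ, mul_add, Nat.cast_succ]
    linarith

lemma partialZeta_one (n : ℕ) : partialZeta 1 n = (harmonic n : ℝ) := by
  simp [partialZeta, harmonic, Real.rpow_neg_one]

lemma log_le_partialZeta_one {n : ℕ} (hn : 1 ≤ n) : Real.log n ≤ partialZeta 1 n := by
  rw [partialZeta_one]
  refine le_trans (Real.log_le_log (by positivity) ?_) (log_add_one_le_harmonic n)
  exact_mod_cast n.le_succ

lemma partialZeta_one_le {n : ℕ} (hn : 3 ≤ n) : partialZeta 1 n ≤ 2 * Real.log n := by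
  have hn3 : (3 : ℝ) ≤ n := by exact_mod_cast hn
  have hlog : 1 ≤ Real.log n := by
    rw [Real.le_log_iff_exp_le (by linarith)]
    linarith [Real.exp_one_lt_d9]
  rw [partialZeta_one]
  linarith [harmonic_le_one_add_log n]

lemma one_le_partialZeta (s : ℝ) {n : ℕ} (hn : 1 ≤ n) : 1 ≤ partialZeta s n := by
  simpa [partialZeta] using partialZeta_mono s hn

lemma exists_partialZeta_le (hs : 1 < s) : ∃ C : ℝ, 0 < C ∧ ∀ n, partialZeta s n ≤ C := by
  have hnonneg : ∀ n : ℕ, 0 ≤ ((n : ℝ) + 1) ^ (-s) := fun n => by positivity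
  have hsum : Summable fun n : ℕ => ((n : ℝ) + 1) ^ (-s) := by
    simpa using (summable_nat_add_iff 1).2 (Real.summable_nat_rpow.2 (by linarith : -s < -1))
  exact ⟨_, hsum.tsum_pos hnonneg 0 (by simp), fun n => hsum.sum_le_tsum _ fun _ _ => hnonneg _⟩

end PartialZeta

section Rate

variable {d : ℕ} {p a b : ℝ} {v : Vertex d}

lemma rate_eq (d n : ℕ) (p : ℝ) : rate d n p =
    open Classical in
    if ((d : ℝ) - 1) * (p - 1) < 1 then (n : ℝ) ^ (1 - ((d : ℝ) - 1) * (p - 1))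
    else if ((d : ℝ) - 1) * (p - 1) = 1 then Real.log n else 1 := by
  have hlt : ((d : ℝ) - 1) * (p - 1) < 1 ↔ ((d : ℝ) - 1) * p < d := by
    constructor <;> intro h <;> linarith
  have heq : ((d : ℝ) - 1) * (p - 1) = 1 ↔ ((d : ℝ) - 1) * p = d := by
    constructor <;> intro h <;> linarith
  simp only [rate, hlt, heq]

lemma rate_nonneg (d n : ℕ) (p : ℝ) : 0 ≤ rate d n p := by
  rw [rate]
  split_ifs <;> positivity

lemma rate_of_lt (hdp : (d : ℝ) < ((d : ℝ) - 1) * p) (n : ℕ) : rate d n p = 1 := by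
  rw [rate, if_neg hdp.not_gt, if_neg hdp.ne']

lemma exists_rate_le_partialZeta_le (hd : 1 ≤ d) (hp : 1 < p) : ∃ C : ℝ, 0 < C ∧ ∀ n : ℕ, 3 ≤ n →
    rate d n p ≤ partialZeta (((d : ℝ) - 1) * (p - 1)) n ∧
      partialZeta (((d : ℝ) - 1) * (p - 1)) n ≤ C * rate d n p := by
  have hd1 : (1 : ℝ) ≤ d := by exact_mod_cast hd
  simp only [rate_eq]
  set s := ((d : ℝ) - 1) * (p - 1)
  have hs : 0 ≤ s := mul_nonneg (by linarith) (by linarith)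
  rcases lt_trichotomy s 1 with h | h | h
  · refine ⟨(1 - s)⁻¹, inv_pos.2 (by linarith), fun n hn => ?_⟩
    rw [if_pos h, le_inv_mul_iff₀ (by linarith)]
    exact ⟨rpow_le_partialZeta hs (by omega), partialZeta_le_of_lt_one hs h n⟩
  · refine ⟨2, two_pos, fun n hn => ?_⟩
    rw [if_neg h.not_lt, if_pos h, h]
    exact ⟨log_le_partialZeta_one (by omega), partialZeta_one_le hn⟩
  · obtain ⟨C, hC, hle⟩ := exists_partialZeta_le h
    refine ⟨C, hC, fun n hn => ?_⟩
    rw [if_neg h.not_gt, if_neg h.ne', mul_one]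
    exact ⟨one_le_partialZeta s (by omega), hle n⟩

lemma tendsto_rate (hdp : ((d : ℝ) - 1) * p ≤ d) :
    Tendsto (fun n => rate d n p) atTop atTop := by
  rcases hdp.lt_or_eq with h | h
  · simp only [rate, if_pos h]
    exact (tendsto_rpow_atTop (by linarith)).comp tendsto_natCast_atTop_atTop
  · simp only [rate, h, lt_irrefl, if_false, if_true]
    exact Real.tendsto_log_atTop.comp tendsto_natCast_atTop_atTop

lemma tendsto_l1norm (d : ℕ) : Tendsto (l1norm : Vertex d → ℕ) cofinite atTop := by
  rw [← Nat.cofinite_eq_atTop]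
  refine Tendsto.cofinite_of_finite_preimage_singleton fun n => ?_
  exact (box d n).finite_toSet.subset fun _ hx => mem_box_of_l1norm_le (le_of_eq hx)

lemma mul_partialZeta_le_resistance (hd : 1 ≤ d) (hp : 1 < p) (ha : 0 < a) {r : Edge d → ℝ}
    (hr : ∀ e, a ≤ r e ∧ r e ≤ b) (hv : v ≠ 0) :
    a * ((d : ℝ) * 2 ^ d) ^ (-(p - 1)) / d
      * partialZeta (((d : ℝ) - 1) * (p - 1)) (l1norm v) ≤ resistance p r 0 v := by
  have hd1 : (1 : ℝ) ≤ d := by exact_mod_cast hd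
  have hr0 : ∀ e, 0 ≤ r e := fun e => ha.le.trans (hr e).1
  set s := ((d : ℝ) - 1) * (p - 1)
  have hs : 0 ≤ s := mul_nonneg (by linarith) (by linarith)
  set κ := ((d : ℝ) * 2 ^ d) ^ (-(p - 1))
  obtain ⟨θ, -, h⟩ := exists_isMinFlow hp ha hr hv.symm
  have hsum := summable_rpow_of_energy_ne_top ha (fun e => (hr e).1) h.ne_top
  let M := l1norm v ⌈/⌉ d
  have hM : l1norm v ≤ d * M := (ceilDiv_le_iff_le_mul hd).1 le_rfl
  have hflux : κ * partialZeta s M ≤ ∑' e, |θ e| ^ p :=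
    mul_partialZeta_le_tsum_rpow hd hp hv.symm h.isUnitFlow hsum fun N hN hmem =>
      hN.not_ge <| (ceilDiv_le_iff_le_mul hd).2 <| l1norm_le_of_natAbs_le fun j => by
        have := mem_box.1 hmem j
        omega
  have hzeta : partialZeta s (l1norm v) ≤ d * partialZeta s M :=
    (partialZeta_mono s hM).trans (partialZeta_mul_le hs hd M)
  rw [h.resistance_eq hr0]
  calc a * κ / d * partialZeta s (l1norm v) ≤ a * κ / d * (d * partialZeta s M) := by gcongr
    _ = a * (κ * partialZeta s M) := by field_simp
    _ ≤ a * ∑' e, |θ e| ^ p := by gcongr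
    _ = ∑' e, a * |θ e| ^ p := tsum_mul_left.symm
    _ ≤ ∑' e, r e * |θ e| ^ p := (hsum.mul_left a).tsum_le_tsum
        (fun e => mul_le_mul_of_nonneg_right (hr e).1 (Real.rpow_nonneg (abs_nonneg _) _))
        (summable_of_energy_ne_top hr0 h.ne_top)

lemma exists_resistance_le (hd : 1 ≤ d) (hp : 1 < p) (hb : 0 < b) : ∃ C : ℝ, 0 < C ∧
    ∀ r : Edge d → ℝ, (∀ e, r e ≤ b) → ∀ v : Vertex d, v ≠ 0 →
      resistance p r 0 v ≤ C * partialZeta (((d : ℝ) - 1) * (p - 1)) (l1norm v) := by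
  obtain ⟨C, hC, hflow⟩ := exists_isUnitFlow_energy_le (d := d) hp hd
  refine ⟨b * C, by positivity, fun r hr v hv => ?_⟩
  obtain ⟨θ, hθ, hE⟩ := hflow v hv
  refine resistance_le_of_energy_le (mul_nonneg (by positivity) (partialZeta_nonneg _ _)) hθ ?_
  calc energy p r θ ≤ energy p (fun _ => b) θ := energy_mono hr
    _ = ENNReal.ofReal b * energy p 1 θ := energy_const hb.le
    _ ≤ ENNReal.ofReal b
        * ENNReal.ofReal (C * partialZeta (((d : ℝ) - 1) * (p - 1)) (l1norm v)) := by gcongr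
    _ = _ := by rw [← ENNReal.ofReal_mul hb.le, mul_assoc]

theorem exists_mul_rate_le_resistance_le (hd : 1 ≤ d) (hp : 1 < p) (ha : 0 < a) (hab : a ≤ b) :
    ∃ c C : ℝ, 0 < c ∧ 0 < C ∧ ∀ r : Edge d → ℝ, (∀ e, a ≤ r e ∧ r e ≤ b) →
      ∀ v : Vertex d, 3 ≤ l1norm v →
        c * rate d (l1norm v) p ≤ resistance p r 0 v ∧
          resistance p r 0 v ≤ C * rate d (l1norm v) p := by
  have : (1 : ℝ) ≤ d := by exact_mod_cast hd
  obtain ⟨K, hK, hrate⟩ := exists_rate_le_partialZeta_le hd hp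
  obtain ⟨C, hC, hle⟩ := exists_resistance_le hd hp (ha.trans_le hab)
  refine ⟨a * ((d : ℝ) * 2 ^ d) ^ (-(p - 1)) / d, C * K, by positivity, by positivity,
    fun r hr v hv3 => ?_⟩
  have hv : v ≠ 0 := by rintro rfl; simp [l1norm] at hv3
  obtain ⟨hlow, hup⟩ := hrate _ hv3
  constructor
  · refine le_trans ?_ (mul_partialZeta_le_resistance hd hp ha hr hv)
    gcongr
  · refine (hle r (fun e => (hr e).2) v hv).trans ?_
    rw [mul_assoc]
    gcongr

end Rate

section Parameters

variable {ρ : ℝ}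

lemma sq_natCeil_rpow_le (hρ : 1 < ρ) :
    (⌈ρ ^ (1 / 4 : ℝ)⌉₊ : ℝ) ^ 2 ≤ 8 * (ρ / Real.log ρ) := by
  have hρ0 : 0 < ρ := by linarith
  have hq : 1 ≤ ρ ^ (1 / 4 : ℝ) := Real.one_le_rpow hρ.le (by norm_num)
  have hceil := Nat.ceil_lt_add_one (zero_le_one.trans hq)
  have hlog : Real.log ρ ≤ ρ ^ (1 / 2 : ℝ) / (1 / 2) := Real.log_le_rpow_div hρ0.le (by norm_num)
  rw [← mul_div_assoc, le_div_iff₀ (Real.log_pos hρ)]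
  calc (⌈ρ ^ (1 / 4 : ℝ)⌉₊ : ℝ) ^ 2 * Real.log ρ
      ≤ (2 * ρ ^ (1 / 4 : ℝ)) ^ 2 * (ρ ^ (1 / 2 : ℝ) / (1 / 2)) := by
        gcongr
        · exact (Real.log_pos hρ).le
        · linarith
    _ = 8 * (ρ ^ (1 / 4 : ℝ) * ρ ^ (1 / 4 : ℝ) * ρ ^ (1 / 2 : ℝ)) := by ring
    _ = 8 * ρ := by rw [← Real.rpow_add hρ0, ← Real.rpow_add hρ0]; norm_num

lemma div_natFloor_log_le (hρ : 1 < ρ) :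
    ρ / (⌊Real.log ρ / 32⌋₊ + 1 : ℕ) ≤ 32 * (ρ / Real.log ρ) := by
  have hlog : 0 < Real.log ρ := Real.log_pos hρ
  have hfloor : Real.log ρ / 32 ≤ (⌊Real.log ρ / 32⌋₊ + 1 : ℕ) := by
    exact_mod_cast (Nat.lt_floor_add_one _).le
  calc ρ / (⌊Real.log ρ / 32⌋₊ + 1 : ℕ) ≤ ρ / (Real.log ρ / 32) := by gcongr
    _ = 32 * (ρ / Real.log ρ) := by field_simp

lemma three_pow_natFloor_log_le (hρ : 1 < ρ) :
    (3 : ℝ) ^ (⌊Real.log ρ / 32⌋₊ + 1) ≤ 3 * ρ ^ (1 / 16 : ℝ) := by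
  have hlog : 0 < Real.log ρ := Real.log_pos hρ
  have hexp : (3 : ℝ) ≤ Real.exp 2 := by linarith [Real.add_one_le_exp (2 : ℝ)]
  have hfloor := Nat.floor_le (by positivity : 0 ≤ Real.log ρ / 32)
  rw [pow_succ']
  gcongr
  calc (3 : ℝ) ^ ⌊Real.log ρ / 32⌋₊ ≤ Real.exp 2 ^ ⌊Real.log ρ / 32⌋₊ := by gcongr
    _ = Real.exp (⌊Real.log ρ / 32⌋₊ * 2) := (Real.exp_nat_mul _ _).symm
    _ ≤ Real.exp (Real.log ρ * (1 / 16)) := Real.exp_le_exp.2 (by linarith)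
    _ = ρ ^ (1 / 16 : ℝ) := (Real.rpow_def_of_pos (by linarith) _).symm

lemma sqrt_one_div_natCeil_rpow_le (hρ : 0 < ρ) :
    √(1 / (⌈ρ ^ (1 / 4 : ℝ)⌉₊ : ℝ)) ≤ ρ ^ (-(1 / 8) : ℝ) := by
  rw [Real.sqrt_le_left (by positivity), ← Real.rpow_mul_natCast hρ.le,
    show (-(1 / 8) : ℝ) * (2 : ℕ) = -(1 / 4) by norm_num, Real.rpow_neg hρ.le, one_div]
  gcongr
  exact Nat.le_ceil _

lemma three_pow_mul_sqrt_mul_le (hρ : 1 < ρ) :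
    (3 : ℝ) ^ (⌊Real.log ρ / 32⌋₊ + 1) * √(1 / (⌈ρ ^ (1 / 4 : ℝ)⌉₊ : ℝ)) * ρ
      ≤ 48 * (ρ / Real.log ρ) := by
  have hρ0 : 0 < ρ := by linarith
  have hlog0 := Real.log_pos hρ
  have hlog : Real.log ρ ≤ ρ ^ (1 / 16 : ℝ) / (1 / 16) := Real.log_le_rpow_div hρ0.le (by norm_num)
  rw [← mul_div_assoc, le_div_iff₀ hlog0]
  calc 3 ^ (⌊Real.log ρ / 32⌋₊ + 1) * √(1 / (⌈ρ ^ (1 / 4 : ℝ)⌉₊ : ℝ)) * ρ * Real.log ρ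
      ≤ 3 * ρ ^ (1 / 16 : ℝ) * ρ ^ (-(1 / 8) : ℝ) * ρ * (ρ ^ (1 / 16 : ℝ) / (1 / 16)) := by
        gcongr
        · exact three_pow_natFloor_log_le hρ
        · exact sqrt_one_div_natCeil_rpow_le hρ0
    _ = 48 * (ρ ^ (1 / 16 : ℝ) * ρ ^ (-(1 / 8) : ℝ) * ρ ^ (1 / 16 : ℝ)) * ρ := by ring
    _ = 48 * ρ := by rw [← Real.rpow_add hρ0, ← Real.rpow_add hρ0]; norm_num

lemma exists_variance_coinRes_le_div_log {d : ℕ} {p a b : ℝ} (hd : 2 ≤ d) (hp : 1 < p)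
    (hdp : ((d : ℝ) - 1) * p ≤ d) (ha : 0 < a) (hab : a ≤ b) {C : ℝ} (hC : 0 ≤ C) :
    ∃ K : ℝ, ∀ v : Vertex d, v ≠ 0 → ∀ ρ : ℝ, 1 < ρ → (∀ ω, coinRes p a b 0 v ω ≤ C * ρ) →
      variance (coinRes p a b 0 v) (coinLaw d) ≤ K * (ρ / Real.log ρ) := by
  have hb : 0 < b := ha.trans_le hab
  let K₁ := 2 * (b * 3 ^ p * (2 * d)) ^ 2
  let K₂ := 2 * (b ^ 2 * (2 * C / a))
  let K₃ := 2 * (b ^ 2 * (√(4 * b * d / a) * (2 * C / a)))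
  refine ⟨K₁ * 8 + K₂ * 32 + K₃ * 48, fun v hv ρ hρ hB => ?_⟩
  let m := ⌈ρ ^ (1 / 4 : ℝ)⌉₊
  let k := ⌊Real.log ρ / 32⌋₊ + 1
  have hm : 1 ≤ m := Nat.one_le_ceil_iff.2 (by positivity)
  have hsqrt : √(4 * b * d / a / m) = √(4 * b * d / a) * √(1 / m) := by
    rw [← Real.sqrt_mul (by positivity), mul_one_div]
  calc variance (coinRes p a b 0 v) (coinLaw d)
      ≤ 2 * (b * 3 ^ p * (2 * (d * m))) ^ 2 + 2 * (b ^ 2 * (2 * (C * ρ) / a / k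
          + 3 ^ k * √(4 * b * d / a / m) * (2 * (C * ρ) / a))) :=
        variance_coinRes_le hd hp hdp ha hab hv hB hm (Nat.le_add_left 1 _)
    _ = K₁ * (m : ℝ) ^ 2 + K₂ * (ρ / k) + K₃ * (3 ^ k * √(1 / m) * ρ) := by
        rw [hsqrt]
        ring
    _ ≤ K₁ * (8 * (ρ / Real.log ρ)) + K₂ * (32 * (ρ / Real.log ρ))
        + K₃ * (48 * (ρ / Real.log ρ)) := by
        gcongr ?_ * ?_ + ?_ * ?_ + ?_ * ?_
        · exact sq_natCeil_rpow_le hρ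
        · exact div_natFloor_log_le hρ
        · exact three_pow_mul_sqrt_mul_le hρ
    _ = (K₁ * 8 + K₂ * 32 + K₃ * 48) * (ρ / Real.log ρ) := by ring

end Parameters

section RandomResistances

variable {d : ℕ} {p a b : ℝ} {v : Vertex d}

instance (d : ℕ) (a b : ℝ) : IsProbabilityMeasure (resistanceLaw d a b) := by
  unfold resistanceLaw
  infer_instance

lemma ae_mem_resistanceLaw (d : ℕ) (hab : a ≤ b) :
    ∀ᵐ r ∂(resistanceLaw d a b), ∀ e : Edge d, a ≤ r e ∧ r e ≤ b := by
  rw [← coinLaw_map_coinResistances,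
    ae_map_iff (continuous_coinResistances a b).measurable.aemeasurable]
  · exact ae_of_all _ (coinResistances_mem hab)
  · simp only [Set.ofPred_forall]
    exact MeasurableSet.iInter fun e => measurableSet_Icc.preimage (measurable_pi_apply e)

-- Truncating the resistances to `[a, b]` makes the resistance a continuous function of them.
lemma aestronglyMeasurable_resistance (hp : 1 < p) (ha : 0 < a) (hab : a ≤ b) (hv : v ≠ 0) :
    AEStronglyMeasurable (fun r => resistance p r 0 v) (resistanceLaw d a b) := by
  refine ⟨fun r => resistance p (fun e => max a (min b (r e))) 0 v,
    (continuous_resistance hp ha (fun r e => ⟨le_max_left _ _, max_le hab (min_le_left _ _)⟩)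
      hv.symm (by fun_prop)).stronglyMeasurable, ?_⟩
  filter_upwards [ae_mem_resistanceLaw d hab] with r hr
  simp only [min_eq_right (hr _).2, max_eq_right (hr _).1]

lemma resistance_self (p : ℝ) (r : Edge d → ℝ) (x : Vertex d) : resistance p r x x = 0 := by
  have : IsEmpty {θ : Edge d → ℝ // IsUnitFlow x x θ} :=
    ⟨fun θ => by linarith [θ.2.source, θ.2.sink]⟩
  rw [resistance, iInf_of_empty, ENNReal.toReal_top]

theorem memLp_resistance (hp : 1 < p) (ha : 0 < a) (hab : a ≤ b) (v : Vertex d) (q : ℝ≥0∞) :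
    MemLp (fun r => resistance p r 0 v) q (resistanceLaw d a b) := by
  rcases eq_or_ne v 0 with rfl | hv
  · simp only [resistance_self]
    exact MemLp.zero'
  have h := aestronglyMeasurable_resistance hp ha hab hv
  rw [← coinLaw_map_coinResistances] at h ⊢
  exact (memLp_map_measure_iff h (continuous_coinResistances a b).measurable.aemeasurable).2
    (memLp_of_continuous (continuous_coinRes hp ha hab hv.symm) q)

lemma variance_resistance (hp : 1 < p) (ha : 0 < a) (hab : a ≤ b) (hv : v ≠ 0) :
    variance (fun r => resistance p r 0 v) (resistanceLaw d a b)
      = variance (coinRes p a b 0 v) (coinLaw d) := by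
  have h := aestronglyMeasurable_resistance hp ha hab hv
  rw [← coinLaw_map_coinResistances] at h ⊢
  exact variance_map h.aemeasurable (continuous_coinResistances a b).measurable.aemeasurable

theorem isTheta_integral_resistance (hd : 1 ≤ d) (hp : 1 < p) (ha : 0 < a) (hab : a ≤ b) :
    (fun v : Vertex d => ∫ r, resistance p r 0 v ∂(resistanceLaw d a b))
      =Θ[cofinite] fun v => rate d (l1norm v) p := by
  obtain ⟨c, C, hc, -, hbounds⟩ := exists_mul_rate_le_resistance_le hd hp ha hab
  have hint : ∀ v, Integrable (fun r => resistance p r 0 v) (resistanceLaw d a b) := fun v =>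
    (memLp_resistance hp ha hab v 2).integrable one_le_two
  have hnorm : ∀ v, ‖∫ r, resistance p r 0 v ∂(resistanceLaw d a b)‖
      = ∫ r, resistance p r 0 v ∂(resistanceLaw d a b) := fun v =>
    Real.norm_of_nonneg (integral_nonneg fun r => resistance_nonneg p r 0 v)
  have hlarge := (tendsto_l1norm d).eventually_ge_atTop 3
  constructor
  · refine IsBigO.of_bound C ?_
    filter_upwards [hlarge] with v hv
    rw [hnorm, Real.norm_of_nonneg (rate_nonneg _ _ _)]
    refine (integral_mono_ae (hint v) (integrable_const (C * rate d (l1norm v) p)) ?_).trans_eq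
      (by simp)
    filter_upwards [ae_mem_resistanceLaw d hab] with r hr using (hbounds r hr v hv).2
  · refine IsBigO.of_bound c⁻¹ ?_
    filter_upwards [hlarge] with v hv
    rw [hnorm, Real.norm_of_nonneg (rate_nonneg _ _ _), le_inv_mul_iff₀ hc]
    refine Eq.trans_le (by simp)
      (integral_mono_ae (integrable_const (c * rate d (l1norm v) p)) (hint v) ?_)
    filter_upwards [ae_mem_resistanceLaw d hab] with r hr using (hbounds r hr v hv).1

theorem isBigO_variance_of_recurrent (hd : 2 ≤ d) (hp : 1 < p) (hdp : ((d : ℝ) - 1) * p ≤ d)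
    (ha : 0 < a) (hab : a ≤ b) :
    (fun v : Vertex d => variance (fun r => resistance p r 0 v) (resistanceLaw d a b))
      =O[cofinite] fun v => rate d (l1norm v) p / Real.log (rate d (l1norm v) p) := by
  obtain ⟨_, C, -, hC, hbounds⟩ :=
    exists_mul_rate_le_resistance_le (one_le_two.trans hd) hp ha hab
  obtain ⟨K, hK⟩ := exists_variance_coinRes_le_div_log hd hp hdp ha hab hC.le
  refine IsBigO.of_bound K ?_
  filter_upwards [(tendsto_l1norm d).eventually_ge_atTop 3,
    ((tendsto_rate hdp).comp (tendsto_l1norm d)).eventually_gt_atTop 1] with v hv3 hρ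
  rw [Function.comp_apply] at hρ
  have hv : v ≠ 0 := by rintro rfl; simp [l1norm] at hv3
  have hlog : 0 < Real.log (rate d (l1norm v) p) := Real.log_pos hρ
  rw [variance_resistance hp ha hab hv, Real.norm_of_nonneg (variance_nonneg _ _),
    Real.norm_of_nonneg (div_nonneg (rate_nonneg _ _ _) hlog.le)]
  exact hK v hv _ hρ fun ω => (hbounds _ (coinResistances_mem hab ω) v hv3).2

theorem isBigO_variance_of_transient (hd : 1 ≤ d) (hp : 1 < p) (hdp : (d : ℝ) < ((d : ℝ) - 1) * p)
    (ha : 0 < a) (hab : a ≤ b) :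
    (fun v : Vertex d => variance (fun r => resistance p r 0 v) (resistanceLaw d a b))
      =O[cofinite] fun _ => (1 : ℝ) := by
  obtain ⟨_, C, -, -, hbounds⟩ := exists_mul_rate_le_resistance_le hd hp ha hab
  refine IsBigO.of_bound (((C - 0) / 2) ^ 2) ?_
  filter_upwards [(tendsto_l1norm d).eventually_ge_atTop 3] with v hv
  rw [Real.norm_of_nonneg (variance_nonneg _ _), norm_one, mul_one]
  refine variance_le_sq_of_bounded ?_ (memLp_resistance hp ha hab v 2).aemeasurable
  filter_upwards [ae_mem_resistanceLaw d hab] with r hr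
  refine ⟨resistance_nonneg _ _ _ _, (hbounds r hr v hv).2.trans_eq ?_⟩
  rw [rate_of_lt hdp, mul_one]

end RandomResistances

end PResistance

theorem proposition3 (d : ℕ) (hd : 1 ≤ d) (a b : ℝ) (ha : 0 < a) (hab : a ≤ b)
    (p : ℝ) (hp : 1 < p) :
    (∀ v : PResistance.Vertex d,
      MemLp (fun r => PResistance.resistance p r 0 v) 2 (PResistance.resistanceLaw d a b)) ∧
    ((fun v : PResistance.Vertex d =>
        ∫ r, PResistance.resistance p r 0 v ∂(PResistance.resistanceLaw d a b))
      =Θ[cofinite] fun v => PResistance.rate d (PResistance.l1norm v) p) ∧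
    (2 ≤ d → p ≤ (d : ℝ) / ((d : ℝ) - 1) →
      (fun v : PResistance.Vertex d =>
        variance (fun r => PResistance.resistance p r 0 v) (PResistance.resistanceLaw d a b))
      =O[cofinite] fun v => PResistance.rate d (PResistance.l1norm v) p /
        Real.log (PResistance.rate d (PResistance.l1norm v) p)) ∧
    (2 ≤ d → (d : ℝ) / ((d : ℝ) - 1) < p →
      (fun v : PResistance.Vertex d =>
        variance (fun r => PResistance.resistance p r 0 v) (PResistance.resistanceLaw d a b))
      =O[cofinite] fun _ => (1 : ℝ)) := by
  have hpos : 2 ≤ d → (0 : ℝ) < (d : ℝ) - 1 := fun h => by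
    have : (2 : ℝ) ≤ d := by exact_mod_cast h
    linarith
  refine ⟨fun v => PResistance.memLp_resistance hp ha hab v 2,
    PResistance.isTheta_integral_resistance hd hp ha hab, fun h2 hpd => ?_, fun h2 hpd => ?_⟩
  · rw [le_div_iff₀ (hpos h2), mul_comm] at hpd
    exact PResistance.isBigO_variance_of_recurrent h2 hp hpd ha hab
  · rw [div_lt_iff₀ (hpos h2), mul_comm] at hpd
    exact PResistance.isBigO_variance_of_transient hd hp hpd ha hab
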